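/- Let $n\ge 2$ and $0\le l<k\le n$ be integers, and let $M$ be a closed (compact, without boundary) smooth $n$-dimensional manifold. For a smooth Riemannian metric $g$ on $M$ with volume element $dv_g$, let $S_g=\mathrm{Ric}_g-\frac{R_g}{2(n-1)}g$ be its Schouten tensor ($\mathrm{Ric}_g$ the Ricci tensor, $R_g$ the scalar curvature), and let $\sigma_j(g)$ be the $j$-th elementary symmetric polynomial of the eigenvalues of $S_g$ with respect to $g$, with $\sigma_0(g)=1$. Let $\bar g$ be a smooth Einstein metric on $M$, $\mathrm{Ric}_{\bar g}=(n-1)\lambda\bar g$ with $\lambda\in\mathbb R$ constant, and assume that $\lambda\neq 0$ or $2l\le n$. Put $$\mathcal F_{\bar g}(g)=\left(\int_M\sigma_l(g)\,dv_g\right)^{2k}\left(\int_M\sigma_k(g)\,dv_{\bar g}\right)^{n-2l},$$ where, if $n-2l<0$ and the second integral vanishes, the second factor is taken to be $0$. Then $\mathcal F_{\bar g}$ is scale invariant, i.e. $\mathcal F_{\bar g}(cg)=\mathcal F_{\bar g}(g)$ for every smooth Riemannian metric $g$ and every constant $c>0$, and $\bar g$ is a critical point of $\mathcal F_{\bar g}$: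 for every smooth symmetric $2$-tensor field $h$ on $M$, $\bar g+th$ is a Riemannian metric for all sufficiently small $|t|$, the function $t\mapsto\mathcal F_{\bar g}(\bar g+th)$ is differentiable at $t=0$, and $$D\mathcal F_{\bar g}(\bar g)\cdot h=\frac{d}{dt}\bigg|_{t=0}\mathcal F_{\bar g}(\bar g+th)=0 .$$ -/

import Mathlib

open scoped Manifold ContDiff Topology

noncomputable section

namespace TotalSigma

/-! ### Curvature of a matrix-valued function (a metric written in coordinates) -/

section Coordinates

variable {n : ℕ}

/-- The partial derivative `∂ f / ∂ y_i` at `y`. -/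
def partialDeriv (i : Fin n) (f : EuclideanSpace ℝ (Fin n) → ℝ)
    (y : EuclideanSpace ℝ (Fin n)) : ℝ :=
  fderiv ℝ f y (EuclideanSpace.single i 1)

/-- Christoffel symbols `Γ^k_{ij} = 1/2 G^{kl} (∂_i G_{jl} + ∂_j G_{il} - ∂_l G_{ij})`. -/
def christoffel (G : EuclideanSpace ℝ (Fin n) → Matrix (Fin n) (Fin n) ℝ) (k i j : Fin n)
    (y : EuclideanSpace ℝ (Fin n)) : ℝ :=
  (1 / 2) * ∑ l, (G y)⁻¹ k l *
    (partialDeriv i (fun z => G z j l) y + partialDeriv j (fun z => G z i l) y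
      - partialDeriv l (fun z => G z i j) y)

/-- Ricci curvature
`R_{ij} = ∂_k Γ^k_{ij} - ∂_j Γ^k_{ik} + Γ^k_{kl} Γ^l_{ij} - Γ^k_{jl} Γ^l_{ik}`
(positive on round spheres). -/
def ricciMatrix (G : EuclideanSpace ℝ (Fin n) → Matrix (Fin n) (Fin n) ℝ)
    (y : EuclideanSpace ℝ (Fin n)) : Matrix (Fin n) (Fin n) ℝ :=
  Matrix.of fun i j =>
    ∑ k, partialDeriv k (christoffel G k i j) y
      - ∑ k, partialDeriv j (christoffel G k i k) y
      + ∑ k, ∑ l, christoffel G k k l y * christoffel G l i j y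
      - ∑ k, ∑ l, christoffel G k j l y * christoffel G l i k y

/-- Scalar curvature `R = G^{ij} R_{ij}`. -/
def scalarCurv (G : EuclideanSpace ℝ (Fin n) → Matrix (Fin n) (Fin n) ℝ)
    (y : EuclideanSpace ℝ (Fin n)) : ℝ :=
  ∑ i, ∑ j, (G y)⁻¹ i j * ricciMatrix G y i j

/-- The Schouten tensor `S = Ric - R / (2 (n - 1)) G`. -/
def schoutenMatrix (G : EuclideanSpace ℝ (Fin n) → Matrix (Fin n) (Fin n) ℝ)
    (y : EuclideanSpace ℝ (Fin n)) : Matrix (Fin n) (Fin n) ℝ :=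
  ricciMatrix G y - (scalarCurv G y / (2 * ((n : ℝ) - 1))) • G y

/-- The `k`-th elementary symmetric polynomial of the eigenvalues (with multiplicity) of the
Schouten tensor with respect to the metric, i.e. of the endomorphism `G^{ip} S_{pj}`. The
eigenvalues are listed as the real roots of its characteristic polynomial; when `G` is positive
definite this endomorphism is self-adjoint for `G`, so there are `n` of them. -/
def sigmaCoord (k : ℕ) (G : EuclideanSpace ℝ (Fin n) → Matrix (Fin n) (Fin n) ℝ)
    (y : EuclideanSpace ℝ (Fin n)) : ℝ :=
  (((G y)⁻¹ * schoutenMatrix G y).charpoly.roots).esymm k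

end Coordinates

/-! ### Tensor fields on a manifold -/

/-- Fields of bilinear forms on the tangent spaces of `M` (no regularity imposed). -/
abbrev TwoTensorField (n : ℕ) (M : Type*) [TopologicalSpace M]
    [ChartedSpace (EuclideanSpace ℝ (Fin n)) M] : Type _ :=
  ∀ x : M, TangentSpace (𝓡 n) x →L[ℝ] TangentSpace (𝓡 n) x →L[ℝ] ℝ

/-- Smooth Riemannian metrics on `M`. -/
abbrev RMetric (n : ℕ) (M : Type*) [TopologicalSpace M]
    [ChartedSpace (EuclideanSpace ℝ (Fin n)) M] [IsManifold (𝓡 n) ∞ M] : Type _ :=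
  Bundle.ContMDiffRiemannianMetric (𝓡 n) ∞ (EuclideanSpace ℝ (Fin n))
    (fun x : M => TangentSpace (𝓡 n) x)

/-- Smooth symmetric `2`-tensor fields on `M`. -/
structure SymTwoTensor (n : ℕ) (M : Type*) [TopologicalSpace M]
    [ChartedSpace (EuclideanSpace ℝ (Fin n)) M] [IsManifold (𝓡 n) ∞ M] where
  /-- The underlying field of bilinear forms. -/
  form : TwoTensorField n M
  symm : ∀ (x : M) (v w : TangentSpace (𝓡 n) x), form x v w = form x w v
  contMDiff : ContMDiff (𝓡 n)
    ((𝓡 n).prod 𝓘(ℝ, EuclideanSpace ℝ (Fin n) →L[ℝ] EuclideanSpace ℝ (Fin n) →L[ℝ] ℝ)) ∞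
    (fun x : M => Bundle.TotalSpace.mk'
      (EuclideanSpace ℝ (Fin n) →L[ℝ] EuclideanSpace ℝ (Fin n) →L[ℝ] ℝ) x (form x))

section Manifold

variable {n : ℕ} {M : Type*} [TopologicalSpace M] [ChartedSpace (EuclideanSpace ℝ (Fin n)) M]

/-- The `i`-th coordinate vector field of the chart `e`, at the point with coordinates `y`. -/
def coordVector (e : OpenPartialHomeomorph M (EuclideanSpace ℝ (Fin n)))
    (y : EuclideanSpace ℝ (Fin n)) (i : Fin n) : TangentSpace (𝓡 n) (e.symm y) :=
  mfderiv (𝓡 n) (𝓡 n) e.symm y (EuclideanSpace.single i 1 : EuclideanSpace ℝ (Fin n))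

/-- The matrix `g_{ij} = g (∂_i, ∂_j)` of a tensor field in the chart `e`, as a function of the
coordinates. -/
def coordMatrix (g : TwoTensorField n M)
    (e : OpenPartialHomeomorph M (EuclideanSpace ℝ (Fin n)))
    (y : EuclideanSpace ℝ (Fin n)) : Matrix (Fin n) (Fin n) ℝ :=
  Matrix.of fun i j => g (e.symm y) (coordVector e y i) (coordVector e y j)

/-- The `σ_k`-curvature of `g` at the point `x`, computed in the preferred chart at `x`. -/
def sigmaCurv (k : ℕ) (g : TwoTensorField n M) (x : M) : ℝ :=
  sigmaCoord k (coordMatrix g (chartAt (EuclideanSpace ℝ (Fin n)) x))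
    (chartAt (EuclideanSpace ℝ (Fin n)) x x)

/-- `Ric_g = (n - 1) lam g` on `M`; the two tensors are compared at each point `x` in the
coordinate frame of the preferred chart at `x`. -/
def IsEinstein (g : TwoTensorField n M) (lam : ℝ) : Prop :=
  ∀ x : M,
    ricciMatrix (coordMatrix g (chartAt (EuclideanSpace ℝ (Fin n)) x))
        (chartAt (EuclideanSpace ℝ (Fin n)) x x)
      = (((n : ℝ) - 1) * lam) • coordMatrix g (chartAt (EuclideanSpace ℝ (Fin n)) x)
        (chartAt (EuclideanSpace ℝ (Fin n)) x x)

/-- Positive definiteness at every point. -/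
def IsPositive (g : TwoTensorField n M) : Prop :=
  ∀ (x : M) (v : TangentSpace (𝓡 n) x), v ≠ 0 → 0 < g x v v

end Manifold

section Integral

variable {n : ℕ} {M : Type*} [TopologicalSpace M] [ChartedSpace (EuclideanSpace ℝ (Fin n)) M]
  [IsManifold (𝓡 n) ∞ M] [CompactSpace M] [T2Space M]

variable (n M) in
/-- A smooth partition of unity on `M` subordinate to the preferred charts. -/
def chartPartition : SmoothPartitionOfUnity M (𝓡 n) M Set.univ :=
  Classical.choose (SmoothPartitionOfUnity.exists_isSubordinate_chartAt_source (𝓡 n) M)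

/-- The integral `∫_M f dv_g` with respect to the Riemannian volume element:
`∑_p ∫ ρ_p f √(det g_{ij}) dy`, the `p`-th term being computed in the chart at `p`. The partition
of unity is locally finite and `M` is compact, so only finitely many terms are nonzero. -/
def volIntegral (g : TwoTensorField n M) (f : M → ℝ) : ℝ :=
  ∑ᶠ p : M, ∫ y in (chartAt (EuclideanSpace ℝ (Fin n)) p).target,
    chartPartition n M p ((chartAt (EuclideanSpace ℝ (Fin n)) p).symm y)
      * f ((chartAt (EuclideanSpace ℝ (Fin n)) p).symm y)
      * √(coordMatrix g (chartAt (EuclideanSpace ℝ (Fin n)) p) y).det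

/-- The functional
`F_{gbar}(g) = (∫_M σ_l(g) dv_g)^(2k) * (∫_M σ_k(g) dv_{gbar})^(n - 2l)`,
with the integer exponent `n - 2l` (possibly negative). -/
def functionalF (k l : ℕ) (gbar g : TwoTensorField n M) : ℝ :=
  (volIntegral g (sigmaCurv l g)) ^ (2 * k)
    * (volIntegral gbar (sigmaCurv k g)) ^ ((n : ℤ) - 2 * (l : ℤ))

/-- `g` is a critical point of `Φ`: for every smooth symmetric `2`-tensor `h`, the tensors
`g + t h` are Riemannian metrics for small `t`, and `t ↦ Φ (g + t h)` is differentiable at `0`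
with derivative `0`. -/
def IsCriticalPoint (Φ : TwoTensorField n M → ℝ) (g : RMetric n M) : Prop :=
  ∀ h : SymTwoTensor n M,
    (∀ᶠ t : ℝ in 𝓝 0, IsPositive (g.inner + t • h.form)) ∧
      HasDerivAt (fun t : ℝ => Φ (g.inner + t • h.form)) 0 0

end Integral

end TotalSigma

end

/-!
Write `g_t = g + t h` with `g` Einstein, `s = (n - 2) λ / 2`, `V` for the volume of `g` and `τ` for
the integral of `tr_g h`. The Schouten tensor of `g` is `s g`, so `σ_j(g) = C(n, j) s ^ j` is
constant.

At a multiple of the identity the derivative of the `j`-th elementary symmetric function of an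
endomorphism `A` depends only on `tr A'` (`hasDerivAt_sigmaPoly`), and the trace of the Schouten
endomorphism is `(n - 2) / (2 (n - 1))` times the scalar curvature. Hence the first variation of
`σ_j` at `g` is a constant multiple of the first variation `δR` of the scalar curvature. The
Palatini identity (`sum_partialDeriv_palatiniField`) writes `δR = - ⟨Ric, h⟩ + div X`, so that
`∫ δR dv = - (n - 1) λ τ` by the divergence theorem (`volIntegral_dScalField`). This gives, for the
integrals `A(t)` of `σ_l(g_t)` with respect to `g_t` and `B(t)` of `σ_k(g_t)` with respect to `g`,

* `A(0) = C(n, l) s ^ l V` and `A'(0) = (1 / 2 - l / n) C(n, l) s ^ l τ`,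
* `B(0) = C(n, k) s ^ k V` and `B'(0) = - (k / n) C(n, k) s ^ k τ`.

If `s ≠ 0` then `A(0)` and `B(0)` are nonzero and the logarithmic derivative of
`A ^ (2 k) B ^ (n - 2 l)` is `(2 k (1 / 2 - l / n) - (n - 2 l) k / n) τ / V = 0`. If `s = 0`,
then `λ = 0` or `n = 2`, hence `2 l ≤ n`, and one of the two factors vanishes to second order at
`t = 0`: the first if `l ≥ 1`, the second if `l = 0`.

The divergence theorem is only used in coordinates (`integral_dScal`): `δR` is linear in `h`, and
`h` is the sum of its pieces `ρ_q h`, each of which is compactly supported in one chart. To pass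
between charts one needs that the Ricci matrix transforms as a tensor (`ricciMatrix_pullback`),
which makes scalar curvature, `σ_j` and `δR` independent of the chart. Differentiation under the
integral sign rests on the joint smoothness in `(t, y)` of the integrands, which holds because, for
a positive definite metric, `σ_j` is the polynomial `sigmaPoly` in the entries of `G⁻¹ S`
(`sigmaCoord_eq_sigmaPoly`). Scale invariance holds because the Ricci and Schouten tensors do not
change under `g ↦ c g`.
-/

noncomputable section

namespace TotalSigma

/-! ### Determinants, inverses and elementary symmetric functions of matrices -/

section MatrixCalculus

variable {X : Type*} [NormedAddCommGroup X] [NormedSpace ℝ X] {ι : Type*} [Fintype ι]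
  [DecidableEq ι]

lemma contDiffAt_det {A : X → Matrix ι ι ℝ} {x : X} {r : WithTop ℕ∞}
    (hA : ∀ i j, ContDiffAt ℝ r (fun z => A z i j) x) :
    ContDiffAt ℝ r (fun z => (A z).det) x := by
  simp only [Matrix.det_apply]
  refine ContDiffAt.sum fun σ _ => ?_
  refine ContDiffAt.const_smul _ ?_
  exact contDiffAt_prod fun i _ => hA _ _

lemma contDiffAt_adjugate {A : X → Matrix ι ι ℝ} {x : X} {r : WithTop ℕ∞}
    (hA : ∀ i j, ContDiffAt ℝ r (fun z => A z i j) x) (i j : ι) :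
    ContDiffAt ℝ r (fun z => (A z).adjugate i j) x := by
  simp only [Matrix.adjugate_apply]
  refine contDiffAt_det fun a b => ?_
  by_cases h : a = j
  · simp only [h, Matrix.updateRow_self]
    exact contDiffAt_const
  · simp only [Matrix.updateRow_ne h]
    exact hA a b

lemma contDiffAt_inv {A : X → Matrix ι ι ℝ} {x : X} {r : WithTop ℕ∞}
    (hA : ∀ i j, ContDiffAt ℝ r (fun z => A z i j) x) (hx : (A x).det ≠ 0) (i j : ι) :
    ContDiffAt ℝ r (fun z => (A z)⁻¹ i j) x := by
  simp only [Matrix.inv_def, Matrix.smul_apply, Ring.inverse_eq_inv', smul_eq_mul]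
  exact ((contDiffAt_det hA).inv hx).mul (contDiffAt_adjugate hA i j)

/-- Jacobi's formula. -/
lemma hasDerivAt_det {A : ℝ → Matrix ι ι ℝ} {A' : Matrix ι ι ℝ} {t : ℝ}
    (hA : ∀ i j, HasDerivAt (fun s => A s i j) (A' i j) t) :
    HasDerivAt (fun s => (A s).det) ((A t).adjugate * A').trace t := by
  have h1 : HasDerivAt (fun s => (A s).det)
      (∑ σ : Equiv.Perm ι, Equiv.Perm.sign σ • ∑ i, (∏ j ∈ Finset.univ.erase i, A t (σ j) j)
        • A' (σ i) i) t := by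
    simp only [Matrix.det_apply]
    refine HasDerivAt.fun_sum fun σ _ => ?_
    refine HasDerivAt.const_smul _ ?_
    exact HasDerivAt.fun_finsetProd fun i _ => hA _ _
  convert h1 using 1
  simp only [Finset.smul_sum]
  rw [Finset.sum_comm]
  simp only [Matrix.trace, Matrix.diag, Matrix.mul_apply]
  refine Finset.sum_congr rfl fun i _ => ?_
  have h2 : ∑ j, (A t).adjugate i j * A' j i = ((A t).updateCol i (fun j => A' j i)).det := by
    rw [← Matrix.cramer_apply, Matrix.cramer_eq_adjugate_mulVec]
    rfl
  rw [h2, Matrix.det_apply]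
  refine Finset.sum_congr rfl fun σ _ => ?_
  congr 1
  rw [← Finset.mul_prod_erase Finset.univ _ (Finset.mem_univ i), mul_comm, smul_eq_mul]
  congr 1
  · refine Finset.prod_congr rfl fun j hj => ?_
    rw [Matrix.updateCol_ne (Finset.ne_of_mem_erase hj)]
  · simp

lemma adjugate_eq_det_smul_inv {A : Matrix ι ι ℝ} (hA : A.det ≠ 0) :
    A.adjugate = A.det • A⁻¹ := by
  rw [Matrix.inv_def, smul_smul, Ring.inverse_eq_inv', mul_inv_cancel₀ hA, one_smul]

lemma hasDerivAt_det_of_ne_zero {A : ℝ → Matrix ι ι ℝ} {A' : Matrix ι ι ℝ} {t : ℝ}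
    (hA : ∀ i j, HasDerivAt (fun s => A s i j) (A' i j) t) (ht : (A t).det ≠ 0) :
    HasDerivAt (fun s => (A s).det) ((A t).det * ((A t)⁻¹ * A').trace) t := by
  have := hasDerivAt_det hA
  rwa [adjugate_eq_det_smul_inv ht, Matrix.smul_mul, Matrix.trace_smul, smul_eq_mul] at this

lemma hasDerivAt_mul_apply {m : Type*} [Fintype m] {A B : ℝ → Matrix m m ℝ}
    {A' B' : Matrix m m ℝ} {t : ℝ}
    (hA : ∀ i j, HasDerivAt (fun s => A s i j) (A' i j) t)
    (hB : ∀ i j, HasDerivAt (fun s => B s i j) (B' i j) t) (i j : m) :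
    HasDerivAt (fun s => (A s * B s) i j) ((A' * B t + A t * B') i j) t := by
  simp only [Matrix.add_apply, Matrix.mul_apply, ← Finset.sum_add_distrib]
  exact HasDerivAt.fun_sum fun k _ => (hA i k).mul (hB k j)

lemma hasDerivAt_inv {A : ℝ → Matrix ι ι ℝ} {A' : Matrix ι ι ℝ} {t : ℝ}
    (hA : ∀ i j, HasDerivAt (fun s => A s i j) (A' i j) t) (ht : (A t).det ≠ 0) (i j : ι) :
    HasDerivAt (fun s => (A s)⁻¹ i j) ((-((A t)⁻¹ * A' * (A t)⁻¹)) i j) t := by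
  -- The inverse is differentiable as a rational function; its derivative `D` is then found by
  -- differentiating `A⁻¹ * A = 1`.
  have hdiff : ∀ i j, DifferentiableAt ℝ (fun s => (A s)⁻¹ i j) t := by
    intro i j
    have hdet : DifferentiableAt ℝ (fun s => (A s).det) t := (hasDerivAt_det hA).differentiableAt
    simp only [Matrix.inv_def, Matrix.smul_apply, Ring.inverse_eq_inv', smul_eq_mul]
    refine (hdet.inv ht).mul ?_
    simp only [Matrix.adjugate_apply]
    refine (hasDerivAt_det (A' := A'.updateRow j 0) fun a b => ?_).differentiableAt
    by_cases h : a = j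
    · simp only [h, Matrix.updateRow_self]
      exact hasDerivAt_const _ _
    · simp only [Matrix.updateRow_ne h]
      exact hA a b
  set D : Matrix ι ι ℝ := Matrix.of fun i j => deriv (fun s => (A s)⁻¹ i j) t with hD
  have hinv : ∀ i j, HasDerivAt (fun s => (A s)⁻¹ i j) (D i j) t :=
    fun i j => (hdiff i j).hasDerivAt
  have hev : ∀ᶠ s in 𝓝 t, (A s).det ≠ 0 :=
    (hasDerivAt_det hA).continuousAt.eventually_ne ht
  have hprod : D * A t + (A t)⁻¹ * A' = 0 := by
    ext a b
    have h1 := hasDerivAt_mul_apply hinv hA a b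
    have h2 : HasDerivAt (fun s => ((A s)⁻¹ * A s) a b) 0 t := by
      refine (hasDerivAt_const t ((1 : Matrix ι ι ℝ) a b)).congr_of_eventuallyEq ?_
      filter_upwards [hev] with s hs
      rw [Matrix.nonsing_inv_mul _ (isUnit_iff_ne_zero.2 hs)]
    simpa using h1.unique h2
  have hDeq : D = -((A t)⁻¹ * A' * (A t)⁻¹) := by
    have h3 : D * A t = -((A t)⁻¹ * A') := eq_neg_of_add_eq_zero_left hprod
    calc D = D * (A t * (A t)⁻¹) := by
          rw [Matrix.mul_nonsing_inv _ (isUnit_iff_ne_zero.2 ht), mul_one]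
      _ = _ := by rw [← mul_assoc, h3, neg_mul]
  rw [← hDeq]
  exact hinv i j

/-- The sum of the principal minors of size `k`: the `k`-th elementary symmetric function of the
eigenvalues, as a polynomial in the entries. -/
def sigmaPoly (k : ℕ) (A : Matrix ι ι ℝ) : ℝ :=
  ∑ s ∈ (Finset.univ : Finset ι).powersetCard k,
    (A.submatrix (Subtype.val : s → ι) (Subtype.val : s → ι)).det

lemma contDiffAt_sigmaPoly (k : ℕ) {A : X → Matrix ι ι ℝ} {x : X} {r : WithTop ℕ∞}
    (hA : ∀ i j, ContDiffAt ℝ r (fun z => A z i j) x) :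
    ContDiffAt ℝ r (fun z => sigmaPoly k (A z)) x :=
  ContDiffAt.sum fun _ _ => contDiffAt_det fun _ _ => hA _ _

lemma esymm_roots_charpoly {A : Matrix ι ι ℝ} (hA : A.charpoly.Splits) {k : ℕ}
    (hk : k ≤ Fintype.card ι) : A.charpoly.roots.esymm k = sigmaPoly k A := by
  have h1 := Polynomial.coeff_eq_esymm_roots_of_splits hA (k := Fintype.card ι - k)
    (by simp [Matrix.charpoly_natDegree_eq_dim])
  rw [Matrix.charpoly_coeff_eq_sum_minors A k hk, Matrix.charpoly_natDegree_eq_dim,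
    (Matrix.charpoly_monic A).leadingCoeff, one_mul, Nat.sub_sub_self hk] at h1
  exact (mul_left_cancel₀ (by simp) h1).symm

open scoped MatrixOrder in
/-- An endomorphism `G⁻¹ S` with `G` positive definite and `S` symmetric has only real
eigenvalues. -/
lemma splits_charpoly_inv_mul {G S : Matrix ι ι ℝ} (hG : G.PosDef) (hS : S.IsSymm) :
    (G⁻¹ * S).charpoly.Splits := by
  obtain ⟨B, hB⟩ := CStarAlgebra.nonneg_iff_eq_star_mul_self.mp hG.inv.posSemidef.nonneg
  rw [hB, mul_assoc, Matrix.charpoly_mul_comm]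
  refine Matrix.IsHermitian.splits_charpoly (𝕜 := ℝ) ?_
  have hS' : S.IsHermitian := by
    rw [Matrix.IsHermitian, Matrix.conjTranspose_eq_transpose_of_trivial, hS]
  exact Matrix.isHermitian_mul_mul_conjTranspose B hS'

lemma card_powersetCard_mem (k : ℕ) (i : ι) :
    ((Finset.univ.powersetCard k).filter (i ∈ ·)).card * Fintype.card ι
      = k * (Fintype.card ι).choose k := by
  have hpos : 0 < Fintype.card ι := Fintype.card_pos_iff.2 ⟨i⟩
  obtain _ | k := k
  · simp
  have h1 : (Finset.univ.powersetCard (k + 1)).filter (i ∈ ·)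
      = ((Finset.univ.erase i).powersetCard k).image (insert i) := by
    ext s
    simp only [Finset.mem_filter, Finset.mem_powersetCard, Finset.subset_univ, true_and,
      Finset.mem_image]
    constructor
    · rintro ⟨hs, hi⟩
      exact ⟨s.erase i, ⟨Finset.erase_subset_erase _ (Finset.subset_univ _), by
        rw [Finset.card_erase_of_mem hi, hs, Nat.add_sub_cancel]⟩, Finset.insert_erase hi⟩
    · rintro ⟨u, ⟨hu, hc⟩, rfl⟩
      have hi : i ∉ u := fun h => by simpa using hu h
      exact ⟨by rw [Finset.card_insert_of_notMem hi, hc], Finset.mem_insert_self _ _⟩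
  rw [h1, Finset.card_image_of_injOn, Finset.card_powersetCard,
    Finset.card_erase_of_mem (Finset.mem_univ i), Finset.card_univ]
  · obtain ⟨m, hm⟩ : ∃ m, Fintype.card ι = m + 1 := ⟨_, (Nat.succ_pred_eq_of_pos hpos).symm⟩
    rw [hm, Nat.add_sub_cancel, mul_comm, Nat.add_one_mul_choose_eq, mul_comm]
  · intro u hu v hv huv
    have hi : ∀ w ∈ (Finset.univ.erase i).powersetCard k, i ∉ w := fun w hw h => by
      simpa using (Finset.mem_powersetCard.1 hw).1 h
    rw [← Finset.erase_insert (hi u hu), ← Finset.erase_insert (hi v hv)]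
    exact congrArg (fun w => Finset.erase w i) huv

lemma sigmaPoly_smul_one (k : ℕ) (s : ℝ) :
    sigmaPoly k (s • (1 : Matrix ι ι ℝ)) = ((Fintype.card ι).choose k) * s ^ k := by
  unfold sigmaPoly
  have h : ∀ u ∈ (Finset.univ : Finset ι).powersetCard k,
      ((s • (1 : Matrix ι ι ℝ)).submatrix (Subtype.val : u → ι) (Subtype.val : u → ι)).det
        = s ^ k := by
    intro u hu
    have : (s • (1 : Matrix ι ι ℝ)).submatrix (Subtype.val : u → ι) (Subtype.val : u → ι)
        = s • 1 := by
      rw [← Matrix.submatrix_one (Subtype.val : u → ι) Subtype.val_injective]; rfl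
    rw [this, Matrix.det_smul, Matrix.det_one, mul_one, Fintype.card_coe,
      (Finset.mem_powersetCard.1 hu).2]
  rw [Finset.sum_congr rfl h]
  simp

/-- The derivative of the elementary symmetric function at a multiple of the identity. -/
lemma hasDerivAt_sigmaPoly [Nonempty ι] (k : ℕ) {A : ℝ → Matrix ι ι ℝ} {A' : Matrix ι ι ℝ}
    {t s : ℝ} (hA : ∀ i j, HasDerivAt (fun s => A s i j) (A' i j) t) (ht : A t = s • 1) :
    HasDerivAt (fun s => sigmaPoly k (A s))
      ((k * (Fintype.card ι).choose k / Fintype.card ι : ℝ) * s ^ (k - 1) * A'.trace) t := by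
  have h1 : HasDerivAt (fun s => sigmaPoly k (A s))
      (∑ u ∈ (Finset.univ : Finset ι).powersetCard k, s ^ (k - 1) * ∑ i ∈ u, A' i i) t := by
    unfold sigmaPoly
    refine HasDerivAt.fun_sum fun u hu => ?_
    have h2 := hasDerivAt_det
      (A := fun s => (A s).submatrix (Subtype.val : u → ι) (Subtype.val : u → ι))
      (A' := A'.submatrix Subtype.val Subtype.val) (t := t) (fun _ _ => hA _ _)
    refine h2.congr_deriv ?_
    have h3 : (A t).submatrix (Subtype.val : u → ι) (Subtype.val : u → ι) = s • 1 := by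
      rw [ht, ← Matrix.submatrix_one (Subtype.val : u → ι) Subtype.val_injective]; rfl
    rw [h3, Matrix.adjugate_smul, Matrix.adjugate_one, Matrix.smul_mul, one_mul,
      Matrix.trace_smul, Fintype.card_coe, (Finset.mem_powersetCard.1 hu).2, smul_eq_mul]
    congr 1
    simp only [Matrix.trace, Matrix.diag, Matrix.submatrix_apply]
    exact Finset.sum_coe_sort u (fun i => A' i i)
  refine h1.congr_deriv ?_
  have hcard : (Fintype.card ι : ℝ) ≠ 0 := by simp
  have h4 : ∑ u ∈ (Finset.univ : Finset ι).powersetCard k, ∑ i ∈ u, A' i i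
      = ∑ i, (k * (Fintype.card ι).choose k / Fintype.card ι : ℝ) * A' i i := by
    have : ∀ u ∈ (Finset.univ : Finset ι).powersetCard k, ∑ i ∈ u, A' i i
        = ∑ i, if i ∈ u then A' i i else 0 := by
      intro u _
      simp
    rw [Finset.sum_congr rfl this, Finset.sum_comm]
    refine Finset.sum_congr rfl fun i _ => ?_
    rw [← Finset.sum_filter, Finset.sum_const, nsmul_eq_mul]
    congr 1
    rw [eq_div_iff hcard]
    exact_mod_cast card_powersetCard_mem k i
  rw [← Finset.mul_sum, h4, ← Finset.mul_sum]
  simp only [Matrix.trace, Matrix.diag]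
  ring

end MatrixCalculus

/-! ### Partial derivatives -/

section PartialDerivatives

variable {n : ℕ}

local notation "𝔼" => EuclideanSpace ℝ (Fin n)

/-- The `i`-th standard basis vector. -/
abbrev basisVec (i : Fin n) : 𝔼 := EuclideanSpace.single i 1

lemma partialDeriv_congr {f g : 𝔼 → ℝ} {y : 𝔼} (h : f =ᶠ[𝓝 y] g) (i : Fin n) :
    partialDeriv i f y = partialDeriv i g y := by
  unfold partialDeriv
  rw [h.fderiv_eq]

lemma partialDeriv_add {f g : 𝔼 → ℝ} {y : 𝔼} (hf : DifferentiableAt ℝ f y)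
    (hg : DifferentiableAt ℝ g y) (i : Fin n) :
    partialDeriv i (fun z => f z + g z) y = partialDeriv i f y + partialDeriv i g y := by
  unfold partialDeriv
  rw [fderiv_fun_add hf hg]; rfl

lemma partialDeriv_sub {f g : 𝔼 → ℝ} {y : 𝔼} (hf : DifferentiableAt ℝ f y)
    (hg : DifferentiableAt ℝ g y) (i : Fin n) :
    partialDeriv i (fun z => f z - g z) y = partialDeriv i f y - partialDeriv i g y := by
  unfold partialDeriv
  rw [fderiv_fun_sub hf hg]; rfl

lemma partialDeriv_mul {f g : 𝔼 → ℝ} {y : 𝔼} (hf : DifferentiableAt ℝ f y)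
    (hg : DifferentiableAt ℝ g y) (i : Fin n) :
    partialDeriv i (fun z => f z * g z) y
      = partialDeriv i f y * g y + f y * partialDeriv i g y := by
  unfold partialDeriv
  rw [fderiv_fun_mul hf hg]
  simp only [add_apply, smul_apply, smul_eq_mul]
  ring

lemma partialDeriv_const_mul (c : ℝ) (f : 𝔼 → ℝ) (y : 𝔼) (i : Fin n) :
    partialDeriv i (fun z => c * f z) y = c * partialDeriv i f y := by
  unfold partialDeriv
  have : (fun z => c * f z) = c • f := rfl
  rw [this, fderiv_const_smul_field]; rfl

lemma partialDeriv_sum {α : Type*} {s : Finset α} {f : α → 𝔼 → ℝ} {y : 𝔼}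
    (hf : ∀ a ∈ s, DifferentiableAt ℝ (f a) y) (i : Fin n) :
    partialDeriv i (fun z => ∑ a ∈ s, f a z) y = ∑ a ∈ s, partialDeriv i (f a) y := by
  unfold partialDeriv
  rw [fderiv_fun_sum hf, sum_apply]

/-- A partial derivative is a derivative along a line, so that one-variable calculus applies. -/
lemma hasDerivAt_line {f : 𝔼 → ℝ} {y : 𝔼} (hf : DifferentiableAt ℝ f y) (i : Fin n) :
    HasDerivAt (fun s : ℝ => f (y + s • basisVec i)) (partialDeriv i f y) 0 := by
  have h1 : HasFDerivAt f (fderiv ℝ f y) (y + (0 : ℝ) • basisVec i) := by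
    simpa using hf.hasFDerivAt
  have h2 : HasDerivAt (fun s : ℝ => y + s • basisVec i) (basisVec i) 0 := by
    simpa using ((hasDerivAt_id (0 : ℝ)).smul_const (basisVec i)).const_add y
  exact h1.comp_hasDerivAt (0 : ℝ) h2

lemma partialDeriv_comm {f : 𝔼 → ℝ} {y : 𝔼} (hf : ContDiffAt ℝ ∞ f y) (i j : Fin n) :
    partialDeriv i (partialDeriv j f) y = partialDeriv j (partialDeriv i f) y := by
  have hd : DifferentiableAt ℝ (fderiv ℝ f) y :=
    (hf.fderiv_right (m := 1) (by norm_cast)).differentiableAt one_ne_zero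
  have key : ∀ a b : Fin n, partialDeriv a (partialDeriv b f) y
      = fderiv ℝ (fderiv ℝ f) y (basisVec a) (basisVec b) := by
    intro a b
    change fderiv ℝ (fun z => fderiv ℝ f z (basisVec b)) y (basisVec a) = _
    rw [fderiv_clm_apply hd (differentiableAt_const _)]
    simp
  rw [key, key]
  exact (hf.isSymmSndFDerivAt (by simp; norm_cast)).eq _ _

lemma ContDiffAt.eventually_differentiableAt {F : Type*} [NormedAddCommGroup F] [NormedSpace ℝ F]
    {X : Type*} [NormedAddCommGroup X] [NormedSpace ℝ X] {f : X → F} {x : X}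
    (hf : ContDiffAt ℝ ∞ f x) : ∀ᶠ z in 𝓝 x, DifferentiableAt ℝ f z := by
  have h1 : ContDiffAt ℝ 1 f x := hf.of_le (by norm_cast)
  filter_upwards [h1.eventually (by simp)] with z hz
  exact hz.differentiableAt one_ne_zero

lemma partialDeriv_eq_fderiv_prod {f : ℝ → 𝔼 → ℝ} {p : ℝ × 𝔼}
    (hf : DifferentiableAt ℝ (fun q : ℝ × 𝔼 => f q.1 q.2) p) (i : Fin n) :
    partialDeriv i (f p.1) p.2 = fderiv ℝ (fun q : ℝ × 𝔼 => f q.1 q.2) p (0, basisVec i) := by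
  have h1 : HasFDerivAt (fun z : 𝔼 => ((p.1, z) : ℝ × 𝔼))
      ((0 : 𝔼 →L[ℝ] ℝ).prod (ContinuousLinearMap.id ℝ 𝔼)) p.2 :=
    (hasFDerivAt_const p.1 p.2).prodMk (hasFDerivAt_id p.2)
  have h2 : HasFDerivAt (f p.1) _ p.2 :=
    HasFDerivAt.comp (g := fun q : ℝ × 𝔼 => f q.1 q.2) p.2 hf.hasFDerivAt h1
  unfold partialDeriv
  rw [h2.fderiv]
  rfl

/-- Partial derivatives of a smooth family are jointly smooth. -/
lemma contDiffAt_partialDeriv_family {f : ℝ → 𝔼 → ℝ} {p : ℝ × 𝔼}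
    (hf : ContDiffAt ℝ ∞ (fun q : ℝ × 𝔼 => f q.1 q.2) p) (i : Fin n) :
    ContDiffAt ℝ ∞ (fun q : ℝ × 𝔼 => partialDeriv i (f q.1) q.2) p := by
  have h1 : ContDiffAt ℝ ∞
      (fun q : ℝ × 𝔼 => fderiv ℝ (fun q : ℝ × 𝔼 => f q.1 q.2) q (0, basisVec i)) p :=
    (hf.fderiv_right (m := ∞) (by simp)).clm_apply contDiffAt_const
  refine h1.congr_of_eventuallyEq ?_
  filter_upwards [ContDiffAt.eventually_differentiableAt hf] with q hq
  exact partialDeriv_eq_fderiv_prod hq i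

lemma contDiffAt_of_family {f : ℝ → 𝔼 → ℝ} {t : ℝ} {y : 𝔼}
    (hf : ContDiffAt ℝ ∞ (fun q : ℝ × 𝔼 => f q.1 q.2) (t, y)) : ContDiffAt ℝ ∞ (f t) y :=
  ContDiffAt.comp (g := fun q : ℝ × 𝔼 => f q.1 q.2) y hf (contDiffAt_const.prodMk contDiffAt_id)

lemma contDiffAt_family_const {f : 𝔼 → ℝ} {t : ℝ} {y : 𝔼} (hf : ContDiffAt ℝ ∞ f y) :
    ContDiffAt ℝ ∞ (fun q : ℝ × 𝔼 => f q.2) (t, y) :=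
  ContDiffAt.comp (g := f) (t, y) hf contDiffAt_snd

lemma contDiffAt_partialDeriv {f : 𝔼 → ℝ} {y : 𝔼} (hf : ContDiffAt ℝ ∞ f y) (i : Fin n) :
    ContDiffAt ℝ ∞ (partialDeriv i f) y :=
  contDiffAt_of_family (f := fun _ => partialDeriv i f) (t := 0)
    (contDiffAt_partialDeriv_family (f := fun _ => f) (contDiffAt_family_const hf) i)

/-- The `t`-derivative of a jointly smooth family commutes with partial derivatives. -/
lemma hasDerivAt_partialDeriv_family {f : ℝ → 𝔼 → ℝ} {f' : 𝔼 → ℝ} {t : ℝ} {y : 𝔼}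
    (hf : ContDiffAt ℝ ∞ (fun q : ℝ × 𝔼 => f q.1 q.2) (t, y))
    (hf' : ∀ᶠ z in 𝓝 y, HasDerivAt (fun s => f s z) (f' z) t) (i : Fin n) :
    HasDerivAt (fun s => partialDeriv i (f s) y) (partialDeriv i f' y) t := by
  set F : ℝ × 𝔼 → ℝ := fun q => f q.1 q.2 with hF
  have hdF : DifferentiableAt ℝ (fderiv ℝ F) (t, y) :=
    (hf.fderiv_right (m := 1) (by norm_cast)).differentiableAt one_ne_zero
  have hcurve : ∀ z, HasDerivAt (fun s : ℝ => ((s, z) : ℝ × 𝔼)) (1, 0) t := fun z =>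
    (hasDerivAt_id t).prodMk (hasDerivAt_const t z)
  have hslice : ∀ᶠ z in 𝓝 y, DifferentiableAt ℝ F (t, z) :=
    (Continuous.prodMk_right t).continuousAt.eventually
      (ContDiffAt.eventually_differentiableAt hf)
  have hslice' : ∀ᶠ s in 𝓝 t, DifferentiableAt ℝ F (s, y) :=
    (Continuous.prodMk_left y).continuousAt.eventually
      (ContDiffAt.eventually_differentiableAt hf)
  -- Both sides are the mixed second derivative of the function of two variables.
  have h1 : partialDeriv i f' y = fderiv ℝ (fderiv ℝ F) (t, y) (0, basisVec i) (1, 0) := by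
    have e1 : f' =ᶠ[𝓝 y] fun z => fderiv ℝ F (t, z) (1, 0) := by
      filter_upwards [hf', hslice] with z hz hz'
      have hz2 := HasFDerivAt.comp_hasDerivAt (f := fun s : ℝ => ((s, z) : ℝ × 𝔼)) t
        hz'.hasFDerivAt (hcurve z)
      exact hz.unique hz2
    rw [partialDeriv_congr e1]
    have h2 : HasFDerivAt (fun z : 𝔼 => ((t, z) : ℝ × 𝔼))
        ((0 : 𝔼 →L[ℝ] ℝ).prod (ContinuousLinearMap.id ℝ 𝔼)) y :=
      (hasFDerivAt_const t y).prodMk (hasFDerivAt_id y)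
    have h3 : HasFDerivAt (fun z => fderiv ℝ F (t, z)) _ y :=
      HasFDerivAt.comp (g := fderiv ℝ F) y hdF.hasFDerivAt h2
    have h4 := h3.clm_apply (hasFDerivAt_const ((1, 0) : ℝ × 𝔼) y)
    unfold partialDeriv
    rw [h4.fderiv]
    simp
  have h5 : HasDerivAt (fun s => fderiv ℝ F (s, y) (0, basisVec i))
      (fderiv ℝ (fderiv ℝ F) (t, y) (1, 0) (0, basisVec i)) t := by
    have h6 : HasDerivAt (fun s => fderiv ℝ F (s, y)) (fderiv ℝ (fderiv ℝ F) (t, y) (1, 0)) t :=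
      HasFDerivAt.comp_hasDerivAt (f := fun s : ℝ => ((s, y) : ℝ × 𝔼)) t hdF.hasFDerivAt (hcurve y)
    simpa using h6.clm_apply (hasDerivAt_const t ((0, basisVec i) : ℝ × 𝔼))
  rw [h1, (hf.isSymmSndFDerivAt (by simp; norm_cast)).eq]
  refine h5.congr_of_eventuallyEq ?_
  filter_upwards [hslice'] with s hs
  exact partialDeriv_eq_fderiv_prod (p := (s, y)) hs i

end PartialDerivatives

/-! ### Christoffel symbols and curvature in coordinates -/

section Curvature

variable {n : ℕ}

local notation "𝔼" => EuclideanSpace ℝ (Fin n)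

/-- Near `y`, the matrix function `G` is smooth, symmetric and nondegenerate, i.e. it is a
pseudo-Riemannian metric in coordinates. -/
def IsMetricNear (G : 𝔼 → Matrix (Fin n) (Fin n) ℝ) (y : 𝔼) : Prop :=
  ∀ᶠ z in 𝓝 y, (∀ i j, ContDiffAt ℝ ∞ (fun w => G w i j) z) ∧ (G z).IsSymm ∧ (G z).det ≠ 0

variable {G : EuclideanSpace ℝ (Fin n) → Matrix (Fin n) (Fin n) ℝ} {y : EuclideanSpace ℝ (Fin n)}

lemma IsMetricNear.eventually (hG : IsMetricNear G y) : ∀ᶠ z in 𝓝 y, IsMetricNear G z :=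
  hG.eventually_nhds

lemma IsMetricNear.smooth (hG : IsMetricNear G y) (i j : Fin n) :
    ContDiffAt ℝ ∞ (fun w => G w i j) y := hG.self_of_nhds.1 i j

lemma IsMetricNear.differentiableAt (hG : IsMetricNear G y) (i j : Fin n) :
    DifferentiableAt ℝ (fun w => G w i j) y := (hG.smooth i j).differentiableAt (by simp)

lemma IsMetricNear.symm (hG : IsMetricNear G y) : (G y).IsSymm := hG.self_of_nhds.2.1

lemma IsMetricNear.det_ne_zero (hG : IsMetricNear G y) : (G y).det ≠ 0 := hG.self_of_nhds.2.2

lemma IsMetricNear.inv_symm (hG : IsMetricNear G y) (i j : Fin n) :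
    (G y)⁻¹ i j = (G y)⁻¹ j i := by
  have : ((G y)⁻¹).IsSymm := by
    rw [Matrix.IsSymm, Matrix.transpose_nonsing_inv, hG.symm]
  exact this.apply j i

lemma IsMetricNear.apply_comm (hG : IsMetricNear G y) (i j : Fin n) : G y i j = G y j i :=
  hG.symm.apply j i

lemma IsMetricNear.mul_inv (hG : IsMetricNear G y) : G y * (G y)⁻¹ = 1 :=
  Matrix.mul_nonsing_inv _ (isUnit_iff_ne_zero.2 hG.det_ne_zero)

lemma IsMetricNear.inv_mul (hG : IsMetricNear G y) : (G y)⁻¹ * G y = 1 :=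
  Matrix.nonsing_inv_mul _ (isUnit_iff_ne_zero.2 hG.det_ne_zero)

lemma IsMetricNear.partialDeriv_comm_index (hG : IsMetricNear G y) (k i j : Fin n) :
    partialDeriv k (fun z => G z i j) y = partialDeriv k (fun z => G z j i) y :=
  partialDeriv_congr (hG.eventually.mono fun _ hz => hz.apply_comm i j) k

section Families

variable {𝒢 : ℝ → EuclideanSpace ℝ (Fin n) → Matrix (Fin n) (Fin n) ℝ}
  {p : ℝ × EuclideanSpace ℝ (Fin n)}

lemma contDiffAt_christoffel_family
    (h𝒢 : ∀ i j, ContDiffAt ℝ ∞ (fun q : ℝ × 𝔼 => 𝒢 q.1 q.2 i j) p)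
    (hdet : (𝒢 p.1 p.2).det ≠ 0) (k i j : Fin n) :
    ContDiffAt ℝ ∞ (fun q : ℝ × 𝔼 => christoffel (𝒢 q.1) k i j q.2) p := by
  unfold christoffel
  refine contDiffAt_const.mul (ContDiffAt.sum fun l _ => ?_)
  refine (contDiffAt_inv h𝒢 hdet k l).mul ?_
  exact ((contDiffAt_partialDeriv_family (f := fun t z => 𝒢 t z j l) (h𝒢 j l) i).add
    (contDiffAt_partialDeriv_family (f := fun t z => 𝒢 t z i l) (h𝒢 i l) j)).sub
    (contDiffAt_partialDeriv_family (f := fun t z => 𝒢 t z i j) (h𝒢 i j) l)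

lemma contDiffAt_ricciMatrix_family
    (h𝒢 : ∀ i j, ContDiffAt ℝ ∞ (fun q : ℝ × 𝔼 => 𝒢 q.1 q.2 i j) p)
    (hdet : (𝒢 p.1 p.2).det ≠ 0) (i j : Fin n) :
    ContDiffAt ℝ ∞ (fun q : ℝ × 𝔼 => ricciMatrix (𝒢 q.1) q.2 i j) p := by
  have hc := contDiffAt_christoffel_family h𝒢 hdet
  have hd : ∀ m k i j, ContDiffAt ℝ ∞
      (fun q : ℝ × 𝔼 => partialDeriv m (christoffel (𝒢 q.1) k i j) q.2) p := fun m k i j =>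
    contDiffAt_partialDeriv_family (f := fun t => christoffel (𝒢 t) k i j) (hc k i j) m
  simp only [ricciMatrix, Matrix.of_apply]
  refine (((ContDiffAt.sum fun k _ => hd _ _ _ _).sub (ContDiffAt.sum fun k _ => hd _ _ _ _)).add
    (ContDiffAt.sum fun k _ => ContDiffAt.sum fun l _ => (hc _ _ _).mul (hc _ _ _))).sub
    (ContDiffAt.sum fun k _ => ContDiffAt.sum fun l _ => (hc _ _ _).mul (hc _ _ _))

lemma contDiffAt_scalarCurv_family
    (h𝒢 : ∀ i j, ContDiffAt ℝ ∞ (fun q : ℝ × 𝔼 => 𝒢 q.1 q.2 i j) p)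
    (hdet : (𝒢 p.1 p.2).det ≠ 0) :
    ContDiffAt ℝ ∞ (fun q : ℝ × 𝔼 => scalarCurv (𝒢 q.1) q.2) p :=
  ContDiffAt.sum fun _ _ => ContDiffAt.sum fun _ _ =>
    (contDiffAt_inv h𝒢 hdet _ _).mul (contDiffAt_ricciMatrix_family h𝒢 hdet _ _)

lemma contDiffAt_schoutenMatrix_family
    (h𝒢 : ∀ i j, ContDiffAt ℝ ∞ (fun q : ℝ × 𝔼 => 𝒢 q.1 q.2 i j) p)
    (hdet : (𝒢 p.1 p.2).det ≠ 0) (i j : Fin n) :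
    ContDiffAt ℝ ∞ (fun q : ℝ × 𝔼 => schoutenMatrix (𝒢 q.1) q.2 i j) p := by
  simp only [schoutenMatrix, Matrix.sub_apply, Matrix.smul_apply, smul_eq_mul]
  exact (contDiffAt_ricciMatrix_family h𝒢 hdet i j).sub
    (((contDiffAt_scalarCurv_family h𝒢 hdet).div_const _).mul (h𝒢 i j))

lemma contDiffAt_inv_mul_schouten_family
    (h𝒢 : ∀ i j, ContDiffAt ℝ ∞ (fun q : ℝ × 𝔼 => 𝒢 q.1 q.2 i j) p)
    (hdet : (𝒢 p.1 p.2).det ≠ 0) (i j : Fin n) :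
    ContDiffAt ℝ ∞ (fun q : ℝ × 𝔼 => ((𝒢 q.1 q.2)⁻¹ * schoutenMatrix (𝒢 q.1) q.2) i j) p := by
  simp only [Matrix.mul_apply]
  exact ContDiffAt.sum fun _ _ => (contDiffAt_inv h𝒢 hdet _ _).mul
    (contDiffAt_schoutenMatrix_family h𝒢 hdet _ _)

end Families

lemma IsMetricNear.contDiffAt_inv_apply (hG : IsMetricNear G y) (i j : Fin n) :
    ContDiffAt ℝ ∞ (fun z => (G z)⁻¹ i j) y :=
  contDiffAt_inv hG.smooth hG.det_ne_zero i j

lemma IsMetricNear.contDiffAt_christoffel (hG : IsMetricNear G y) (k i j : Fin n) :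
    ContDiffAt ℝ ∞ (christoffel G k i j) y :=
  contDiffAt_of_family (f := fun _ => christoffel G k i j) (t := 0)
    (contDiffAt_christoffel_family (𝒢 := fun _ => G)
      (fun i j => contDiffAt_family_const (hG.smooth i j)) hG.det_ne_zero k i j)

lemma IsMetricNear.differentiableAt_christoffel (hG : IsMetricNear G y) (k i j : Fin n) :
    DifferentiableAt ℝ (christoffel G k i j) y :=
  (hG.contDiffAt_christoffel k i j).differentiableAt (by simp)

lemma IsMetricNear.christoffel_symm (hG : IsMetricNear G y) (k i j : Fin n) :
    christoffel G k i j y = christoffel G k j i y := by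
  unfold christoffel
  congr 1
  refine Finset.sum_congr rfl fun l _ => ?_
  rw [hG.partialDeriv_comm_index l i j]
  ring

/-- The Christoffel symbols of the first kind. -/
lemma IsMetricNear.sum_mul_christoffel (hG : IsMetricNear G y) (m i j : Fin n) :
    ∑ k, G y m k * christoffel G k i j y
      = (1 / 2) * (partialDeriv i (fun z => G z j m) y + partialDeriv j (fun z => G z i m) y
      - partialDeriv m (fun z => G z i j) y) := by
  set v : Fin n → ℝ := fun l => (1 / 2) * (partialDeriv i (fun z => G z j l) y
    + partialDeriv j (fun z => G z i l) y - partialDeriv l (fun z => G z i j) y) with hv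
  have h1 : (fun k => christoffel G k i j y) = (G y)⁻¹.mulVec v := by
    funext k
    simp only [christoffel, Matrix.mulVec, dotProduct, hv, Finset.mul_sum]
    exact Finset.sum_congr rfl fun l _ => by ring
  have h2 : (G y).mulVec (fun k => christoffel G k i j y) = v := by
    rw [h1, Matrix.mulVec_mulVec, hG.mul_inv, Matrix.one_mulVec]
  exact congrFun h2 m

/-- The Levi-Civita connection is compatible with the metric. -/
lemma IsMetricNear.partialDeriv_eq (hG : IsMetricNear G y) (k i j : Fin n) :
    partialDeriv k (fun z => G z i j) y
      = ∑ m, G y j m * christoffel G m k i y + ∑ m, G y i m * christoffel G m k j y := by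
  rw [hG.sum_mul_christoffel, hG.sum_mul_christoffel, hG.partialDeriv_comm_index k j i,
    hG.partialDeriv_comm_index i k j, hG.partialDeriv_comm_index j k i,
    hG.partialDeriv_comm_index k i j, hG.partialDeriv_comm_index j i k,
    hG.partialDeriv_comm_index i j k]
  ring

lemma IsMetricNear.partialDeriv_inv (hG : IsMetricNear G y) (k i j : Fin n) :
    partialDeriv k (fun z => (G z)⁻¹ i j) y
      = -((G y)⁻¹ * Matrix.of (fun a b => partialDeriv k (fun z => G z a b) y) * (G y)⁻¹) i j := by
  have h := hasDerivAt_inv (A := fun s : ℝ => G (y + s • basisVec k))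
    (A' := Matrix.of (fun a b => partialDeriv k (fun z => G z a b) y)) (t := 0)
    (fun a b => hasDerivAt_line (hG.differentiableAt a b) k) (by simpa using hG.det_ne_zero) i j
  have h2 := hasDerivAt_line ((hG.contDiffAt_inv_apply i j).differentiableAt (by simp)) k
  simpa using h2.unique h

lemma IsMetricNear.partialDeriv_inv_eq (hG : IsMetricNear G y) (k i j : Fin n) :
    partialDeriv k (fun z => (G z)⁻¹ i j) y
      = -(∑ a, christoffel G i k a y * (G y)⁻¹ a j) - ∑ a, christoffel G j k a y * (G y)⁻¹ i a := by
  set C : Matrix (Fin n) (Fin n) ℝ := Matrix.of fun a b => christoffel G a k b y with hC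
  have h1 : Matrix.of (fun a b => partialDeriv k (fun z => G z a b) y)
      = (G y * C).transpose + G y * C := by
    ext a b
    simp only [Matrix.of_apply, hG.partialDeriv_eq k a b, Matrix.add_apply, Matrix.transpose_apply,
      Matrix.mul_apply, hC]
  have hs : ((G y)⁻¹).transpose = (G y)⁻¹ := by
    rw [Matrix.transpose_nonsing_inv, hG.symm]
  have h2 : (G y)⁻¹ * ((G y * C).transpose + G y * C) * (G y)⁻¹
      = (C * (G y)⁻¹).transpose + C * (G y)⁻¹ := by
    rw [Matrix.transpose_mul, hG.symm, Matrix.transpose_mul, hs, Matrix.mul_add, Matrix.add_mul,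
      ← Matrix.mul_assoc, ← Matrix.mul_assoc, hG.inv_mul, Matrix.one_mul, Matrix.mul_assoc,
      Matrix.mul_assoc, hG.mul_inv, Matrix.mul_one]
  rw [hG.partialDeriv_inv, h1, h2]
  simp only [Matrix.add_apply, Matrix.transpose_apply, Matrix.mul_apply, hC, Matrix.of_apply]
  have h3 : ∑ a, christoffel G j k a y * (G y)⁻¹ a i = ∑ a, christoffel G j k a y * (G y)⁻¹ i a :=
    Finset.sum_congr rfl fun a _ => by rw [hG.inv_symm a i]
  rw [h3]
  ring

lemma IsMetricNear.sum_christoffel (hG : IsMetricNear G y) (i : Fin n) :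
    ∑ k, christoffel G k i k y
      = (1 / 2) * ((G y)⁻¹ * Matrix.of (fun a b => partialDeriv i (fun z => G z a b) y)).trace := by
  simp only [christoffel, ← Finset.mul_sum]
  congr 1
  simp only [Matrix.trace, Matrix.diag, Matrix.mul_apply, Matrix.of_apply, mul_sub, mul_add,
    Finset.sum_sub_distrib, Finset.sum_add_distrib]
  have h1 : ∑ k, ∑ l, (G y)⁻¹ k l * partialDeriv k (fun z => G z i l) y
      = ∑ k, ∑ l, (G y)⁻¹ k l * partialDeriv l (fun z => G z i k) y := by
    rw [Finset.sum_comm]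
    exact Finset.sum_congr rfl fun l _ => Finset.sum_congr rfl fun k _ => by rw [hG.inv_symm]
  have h2 : ∑ k, ∑ l, (G y)⁻¹ k l * partialDeriv i (fun z => G z k l) y
      = ∑ k, ∑ l, (G y)⁻¹ k l * partialDeriv i (fun z => G z l k) y :=
    Finset.sum_congr rfl fun k _ => Finset.sum_congr rfl fun l _ => by
      rw [hG.partialDeriv_comm_index]
  rw [h1, h2]
  ring

lemma IsMetricNear.partialDeriv_det (hG : IsMetricNear G y) (i : Fin n) :
    partialDeriv i (fun z => (G z).det) y = 2 * (G y).det * ∑ k, christoffel G k i k y := by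
  have h := hasDerivAt_det_of_ne_zero (A := fun s : ℝ => G (y + s • basisVec i))
    (A' := Matrix.of (fun a b => partialDeriv i (fun z => G z a b) y)) (t := 0)
    (fun a b => hasDerivAt_line (hG.differentiableAt a b) i) (by simpa using hG.det_ne_zero)
  have h2 := hasDerivAt_line ((contDiffAt_det hG.smooth).differentiableAt (by simp)) i
  rw [h2.unique h, hG.sum_christoffel]
  simp only [zero_smul, add_zero]
  ring

/-- The trace of the Christoffel symbols is the gradient of `log √|det G|`. -/
lemma IsMetricNear.sum_christoffel_eq (hG : IsMetricNear G y) (i : Fin n) :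
    ∑ k, christoffel G k i k y = (1 / 2) * partialDeriv i (fun z => Real.log (G z).det) y := by
  have hd : DifferentiableAt ℝ (fun z => (G z).det) y :=
    (contDiffAt_det hG.smooth).differentiableAt (by simp)
  have : partialDeriv i (fun z => Real.log (G z).det) y
      = ((G y).det)⁻¹ * partialDeriv i (fun z => (G z).det) y := by
    unfold partialDeriv
    rw [fderiv.log hd hG.det_ne_zero]; rfl
  rw [this, hG.partialDeriv_det]
  field_simp [hG.det_ne_zero]

/-- The Ricci tensor is symmetric, because the trace of the Christoffel symbols is a gradient. -/
lemma IsMetricNear.ricciMatrix_isSymm (hG : IsMetricNear G y) : (ricciMatrix G y).IsSymm := by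
  refine Matrix.IsSymm.ext fun j i => ?_
  have h0 : ∀ k i j m, partialDeriv m (christoffel G k i j) y
      = partialDeriv m (christoffel G k j i) y := fun k i j m =>
    partialDeriv_congr (hG.eventually.mono fun _ hz => hz.christoffel_symm k i j) m
  have h1 : ∀ i j, ∑ k, partialDeriv j (christoffel G k i k) y
      = (1 / 2) * partialDeriv j (partialDeriv i (fun z => Real.log (G z).det)) y := by
    intro i j
    rw [← partialDeriv_sum fun k _ => hG.differentiableAt_christoffel k i k,
      ← partialDeriv_const_mul]
    exact partialDeriv_congr (hG.eventually.mono fun _ hz => hz.sum_christoffel_eq i) j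
  have h2 : ∑ k, partialDeriv j (christoffel G k i k) y
      = ∑ k, partialDeriv i (christoffel G k j k) y := by
    rw [h1, h1, partialDeriv_comm ((contDiffAt_det hG.smooth).log hG.det_ne_zero)]
  have h3 : ∑ k, ∑ l, christoffel G k j l y * christoffel G l i k y
      = ∑ k, ∑ l, christoffel G k i l y * christoffel G l j k y := by
    rw [Finset.sum_comm]
    exact Finset.sum_congr rfl fun _ _ => Finset.sum_congr rfl fun _ _ => mul_comm _ _
  simp only [ricciMatrix, Matrix.of_apply]
  rw [h2, h3]
  simp only [h0 _ i j, fun l => hG.christoffel_symm l i j]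

lemma IsMetricNear.schoutenMatrix_isSymm (hG : IsMetricNear G y) :
    (schoutenMatrix G y).IsSymm :=
  hG.ricciMatrix_isSymm.sub (hG.symm.smul _)

end Curvature

/-! ### Tensoriality of the Ricci curvature -/

section Tensoriality

variable {n : ℕ}

local notation "𝔼" => EuclideanSpace ℝ (Fin n)

variable {G G' : EuclideanSpace ℝ (Fin n) → Matrix (Fin n) (Fin n) ℝ}
  {y : EuclideanSpace ℝ (Fin n)}

/-- The bilinear form `(u, v) ↦ uᵢ vⱼ`. -/
def bilinBasis (i j : Fin n) : 𝔼 →L[ℝ] 𝔼 →L[ℝ] ℝ :=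
  (EuclideanSpace.proj i : 𝔼 →L[ℝ] ℝ).smulRight (EuclideanSpace.proj j : 𝔼 →L[ℝ] ℝ)

/-- The bilinear map `(u, v) ↦ uᵢ vⱼ eₖ`. -/
def bilinVecBasis (k i j : Fin n) : 𝔼 →L[ℝ] 𝔼 →L[ℝ] 𝔼 :=
  (EuclideanSpace.proj i : 𝔼 →L[ℝ] ℝ).smulRight
    ((EuclideanSpace.proj j : 𝔼 →L[ℝ] ℝ).smulRight (basisVec k))

lemma bilinBasis_apply (i j : Fin n) (u v : 𝔼) : bilinBasis i j u v = u i * v j := by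
  simp [bilinBasis]

lemma bilinVecBasis_apply (k i j : Fin n) (u v : 𝔼) (m : Fin n) :
    bilinVecBasis k i j u v m = if m = k then u i * v j else 0 := by
  simp [bilinVecBasis]

/-- The field of bilinear forms with coefficients `G`. -/
def bilinField (G : 𝔼 → Matrix (Fin n) (Fin n) ℝ) (y : 𝔼) : 𝔼 →L[ℝ] 𝔼 →L[ℝ] ℝ :=
  ∑ p : Fin n × Fin n, G y p.1 p.2 • bilinBasis p.1 p.2

/-- The Christoffel symbols as a field of bilinear maps `(u, v) ↦ Γ(u, v)`. -/
def chrField (G : 𝔼 → Matrix (Fin n) (Fin n) ℝ) (y : 𝔼) : 𝔼 →L[ℝ] 𝔼 →L[ℝ] 𝔼 :=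
  ∑ p : Fin n × Fin n × Fin n, christoffel G p.2.2 p.1 p.2.1 y • bilinVecBasis p.2.2 p.1 p.2.1

lemma bilinField_apply (u v : 𝔼) : bilinField G y u v = ∑ i, ∑ j, G y i j * (u i * v j) := by
  simp [bilinField, sum_apply, bilinBasis_apply, Fintype.sum_prod_type]

lemma chrField_apply (u v : 𝔼) (k : Fin n) :
    chrField G y u v k = ∑ i, ∑ j, christoffel G k i j y * (u i * v j) := by
  simp [chrField, sum_apply, Finset.sum_apply, bilinVecBasis_apply, Fintype.sum_prod_type]

lemma fderiv_eq_sum_partialDeriv (f : 𝔼 → ℝ) (y x : 𝔼) :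
    fderiv ℝ f y x = ∑ k, partialDeriv k f y * x k := by
  have hx : x = ∑ k, x k • basisVec k := by
    ext i
    simp [Finset.sum_apply, Pi.single_apply]
  conv_lhs => rw [hx]
  simp only [map_sum, map_smul, smul_eq_mul, partialDeriv]
  exact Finset.sum_congr rfl fun k _ => mul_comm _ _

lemma hasFDerivAt_sum_smul {α F : Type*} [Fintype α] [NormedAddCommGroup F] [NormedSpace ℝ F]
    {f : α → 𝔼 → ℝ} {y : 𝔼} (hf : ∀ a, DifferentiableAt ℝ (f a) y) (c : α → F) :
    HasFDerivAt (fun z => ∑ a, f a z • c a) (∑ a, (fderiv ℝ (f a) y).smulRight (c a)) y :=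
  HasFDerivAt.fun_sum fun a _ => (hf a).hasFDerivAt.smul_const (c a)

lemma IsMetricNear.hasFDerivAt_bilinField (hG : IsMetricNear G y) :
    HasFDerivAt (bilinField G) (∑ p : Fin n × Fin n,
      (fderiv ℝ (fun z => G z p.1 p.2) y).smulRight (bilinBasis p.1 p.2)) y :=
  hasFDerivAt_sum_smul (f := fun (p : Fin n × Fin n) z => G z p.1 p.2)
    (fun p => hG.differentiableAt p.1 p.2) (fun p => bilinBasis p.1 p.2)

lemma IsMetricNear.hasFDerivAt_chrField (hG : IsMetricNear G y) :
    HasFDerivAt (chrField G) (∑ p : Fin n × Fin n × Fin n,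
      (fderiv ℝ (christoffel G p.2.2 p.1 p.2.1) y).smulRight (bilinVecBasis p.2.2 p.1 p.2.1)) y :=
  hasFDerivAt_sum_smul (f := fun p : Fin n × Fin n × Fin n => christoffel G p.2.2 p.1 p.2.1)
    (fun p => hG.differentiableAt_christoffel p.2.2 p.1 p.2.1)
    (fun p => bilinVecBasis p.2.2 p.1 p.2.1)

lemma IsMetricNear.fderiv_bilinField_apply (hG : IsMetricNear G y) (x u v : 𝔼) :
    fderiv ℝ (bilinField G) y x u v
      = ∑ i, ∑ j, fderiv ℝ (fun z => G z i j) y x * (u i * v j) := by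
  rw [hG.hasFDerivAt_bilinField.fderiv]
  simp [sum_apply, bilinBasis_apply, Fintype.sum_prod_type]

lemma IsMetricNear.fderiv_chrField_apply (hG : IsMetricNear G y) (x u v : 𝔼) (k : Fin n) :
    fderiv ℝ (chrField G) y x u v k
      = ∑ i, ∑ j, fderiv ℝ (christoffel G k i j) y x * (u i * v j) := by
  rw [hG.hasFDerivAt_chrField.fderiv]
  simp [sum_apply, Finset.sum_apply, bilinVecBasis_apply, Fintype.sum_prod_type]

lemma IsMetricNear.bilinField_comm (hG : IsMetricNear G y) (u v : 𝔼) :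
    bilinField G y u v = bilinField G y v u := by
  rw [bilinField_apply, bilinField_apply, Finset.sum_comm]
  exact Finset.sum_congr rfl fun i _ => Finset.sum_congr rfl fun j _ => by
    rw [hG.apply_comm]; ring

lemma IsMetricNear.chrField_comm (hG : IsMetricNear G y) (u v : 𝔼) :
    chrField G y u v = chrField G y v u := by
  ext k
  rw [chrField_apply, chrField_apply, Finset.sum_comm]
  exact Finset.sum_congr rfl fun i _ => Finset.sum_congr rfl fun j _ => by
    rw [hG.christoffel_symm]; ring

lemma IsMetricNear.eq_zero_of_bilinField (hG : IsMetricNear G y) {u : 𝔼}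
    (hu : ∀ w, bilinField G y u w = 0) : u = 0 := by
  have h1 : Matrix.vecMul (WithLp.ofLp u) (G y) = 0 := by
    funext j
    have := hu (basisVec j)
    rw [bilinField_apply] at this
    simp only [Pi.zero_apply, Matrix.vecMul, dotProduct]
    rw [← this]
    refine Finset.sum_congr rfl fun i _ => ?_
    simp [mul_comm]
  have h2 := congrArg (fun a => Matrix.vecMul a (G y)⁻¹) h1
  simp only [Matrix.vecMul_vecMul, hG.mul_inv, Matrix.vecMul_one, Matrix.zero_vecMul] at h2
  ext i
  exact congrFun h2 i

lemma IsMetricNear.fderiv_bilinField (hG : IsMetricNear G y) (x u v : 𝔼) :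
    fderiv ℝ (bilinField G) y x u v
      = bilinField G y (chrField G y x u) v + bilinField G y u (chrField G y x v) := by
  rw [hG.fderiv_bilinField_apply]
  simp only [fderiv_eq_sum_partialDeriv, hG.partialDeriv_eq, bilinField_apply, chrField_apply,
    add_mul, Finset.sum_add_distrib, Finset.mul_sum, Finset.sum_mul]
  congr 1
  · calc _ = ∑ j, ∑ i, ∑ k, ∑ m, G y j m * christoffel G m k i y * x k * (u i * v j) :=
          Finset.sum_comm
      _ = ∑ j, ∑ m, ∑ k, ∑ i, G y j m * christoffel G m k i y * x k * (u i * v j) := by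
          refine Finset.sum_congr rfl fun j _ => ?_
          rw [Finset.sum_comm]
          rw [show (∑ m, ∑ k, ∑ i, G y j m * christoffel G m k i y * x k * (u i * v j))
            = ∑ k, ∑ m, ∑ i, G y j m * christoffel G m k i y * x k * (u i * v j) from
              Finset.sum_comm]
          exact Finset.sum_congr rfl fun k _ => Finset.sum_comm
      _ = _ := by
          rw [Finset.sum_comm]
          refine Finset.sum_congr rfl fun m _ => Finset.sum_congr rfl fun j _ =>
            Finset.sum_congr rfl fun k _ => Finset.sum_congr rfl fun i _ => ?_
          rw [hG.apply_comm j m]; ring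
  · refine Finset.sum_congr rfl fun i _ => ?_
    calc _ = ∑ j, ∑ m, ∑ k, G y i m * christoffel G m k j y * x k * (u i * v j) :=
          Finset.sum_congr rfl fun j _ => Finset.sum_comm
      _ = ∑ m, ∑ j, ∑ k, G y i m * christoffel G m k j y * x k * (u i * v j) := Finset.sum_comm
      _ = _ := by
          refine Finset.sum_congr rfl fun m _ => ?_
          rw [Finset.sum_comm]
          exact Finset.sum_congr rfl fun k _ => Finset.sum_congr rfl fun j _ => by ring

/-- The Koszul formula. -/
lemma IsMetricNear.koszul (hG : IsMetricNear G y) (u v w : 𝔼) :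
    2 * bilinField G y (chrField G y u v) w
      = fderiv ℝ (bilinField G) y u v w + fderiv ℝ (bilinField G) y v u w
        - fderiv ℝ (bilinField G) y w u v := by
  rw [hG.fderiv_bilinField, hG.fderiv_bilinField, hG.fderiv_bilinField, hG.chrField_comm v u,
    hG.chrField_comm w u, hG.chrField_comm w v, hG.bilinField_comm v (chrField G y u w)]
  ring

/-- The curvature operator `x ↦ R(x, u) v` of a metric in coordinates. -/
def curvOp (G : 𝔼 → Matrix (Fin n) (Fin n) ℝ) (y u v : 𝔼) : 𝔼 →L[ℝ] 𝔼 :=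
  ((fderiv ℝ (chrField G) y).flip u).flip v - (fderiv ℝ (chrField G) y u).flip v
    + (chrField G y).flip (chrField G y u v) - (chrField G y u).comp ((chrField G y).flip v)

lemma curvOp_apply (u v x : 𝔼) :
    curvOp G y u v x = fderiv ℝ (chrField G) y x u v - fderiv ℝ (chrField G) y u x v
      + chrField G y x (chrField G y u v) - chrField G y u (chrField G y x v) := rfl

lemma trace_eq_sum (T : 𝔼 →L[ℝ] 𝔼) :
    LinearMap.trace ℝ 𝔼 (T : 𝔼 →ₗ[ℝ] 𝔼) = ∑ k, T (basisVec k) k := by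
  rw [LinearMap.trace_eq_matrix_trace ℝ (EuclideanSpace.basisFun (Fin n) ℝ).toBasis]
  simp [Matrix.trace, LinearMap.toMatrix_apply]

/-- The Ricci tensor is the trace of the curvature operator. -/
lemma IsMetricNear.ricciMatrix_eq_trace (hG : IsMetricNear G y) (i j : Fin n) :
    ricciMatrix G y i j
      = LinearMap.trace ℝ 𝔼 (curvOp G y (basisVec j) (basisVec i) : 𝔼 →ₗ[ℝ] 𝔼) := by
  have h0 : ∀ k a b m, partialDeriv m (christoffel G k a b) y
      = partialDeriv m (christoffel G k b a) y := fun k a b m =>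
    partialDeriv_congr (hG.eventually.mono fun _ hz => hz.christoffel_symm k a b) m
  have h1 : ∀ a b c k, fderiv ℝ (chrField G) y (basisVec a) (basisVec b) (basisVec c) k
      = partialDeriv a (christoffel G k b c) y := by
    intro a b c k
    rw [hG.fderiv_chrField_apply]
    simp [partialDeriv]
  have h2 : ∀ a b k, chrField G y (basisVec a) (basisVec b) k = christoffel G k a b y := by
    intro a b k
    rw [chrField_apply]
    simp
  have h3 : ∀ a b c k, chrField G y (basisVec a) (chrField G y (basisVec b) (basisVec c)) k
      = ∑ l, christoffel G k a l y * christoffel G l b c y := by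
    intro a b c k
    rw [chrField_apply]
    simp only [h2]
    simp
  rw [trace_eq_sum]
  simp only [curvOp_apply, PiLp.add_apply, PiLp.sub_apply, h1, h3, Finset.sum_add_distrib,
    Finset.sum_sub_distrib, ricciMatrix, Matrix.of_apply]
  simp only [h0 _ j i, h0 _ _ i, hG.christoffel_symm _ j i, hG.christoffel_symm _ _ i]

lemma trace_curvOp_eq_sum (u v : 𝔼) :
    LinearMap.trace ℝ 𝔼 (curvOp G y u v : 𝔼 →ₗ[ℝ] 𝔼)
      = ∑ a, ∑ b, u a * (v b * LinearMap.trace ℝ 𝔼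
        (curvOp G y (basisVec a) (basisVec b) : 𝔼 →ₗ[ℝ] 𝔼)) := by
  set B : 𝔼 →ₗ[ℝ] 𝔼 →ₗ[ℝ] ℝ := LinearMap.mk₂ ℝ
    (fun u v => LinearMap.trace ℝ 𝔼 (curvOp G y u v : 𝔼 →ₗ[ℝ] 𝔼))
    (fun u u' v => by
      simp only [trace_eq_sum, curvOp_apply, map_add, add_apply, PiLp.add_apply,
        PiLp.sub_apply, ← Finset.sum_add_distrib]
      exact Finset.sum_congr rfl fun _ _ => by ring)
    (fun c u v => by
      simp only [trace_eq_sum, curvOp_apply, map_smul, smul_apply, PiLp.add_apply,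
        PiLp.sub_apply, PiLp.smul_apply, smul_eq_mul, Finset.mul_sum]
      exact Finset.sum_congr rfl fun _ _ => by ring)
    (fun u v v' => by
      simp only [trace_eq_sum, curvOp_apply, map_add, PiLp.add_apply,
        PiLp.sub_apply, ← Finset.sum_add_distrib]
      exact Finset.sum_congr rfl fun _ _ => by ring)
    (fun c u v => by
      simp only [trace_eq_sum, curvOp_apply, map_smul, PiLp.add_apply,
        PiLp.sub_apply, PiLp.smul_apply, smul_eq_mul, Finset.mul_sum]
      exact Finset.sum_congr rfl fun _ _ => by ring) with hB
  have hx : ∀ x : 𝔼, x = ∑ k, x k • basisVec k := by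
    intro x
    ext i
    simp [Finset.sum_apply, Pi.single_apply]
  change B u v = ∑ a, ∑ b, u a * (v b * B (basisVec a) (basisVec b))
  conv_lhs => rw [hx u, hx v]
  simp only [map_sum, map_smul, LinearMap.sum_apply, LinearMap.smul_apply, smul_eq_mul,
    Finset.mul_sum]
  rw [Finset.sum_comm]
  exact Finset.sum_congr rfl fun _ _ => Finset.sum_congr rfl fun _ _ => by ring

variable {φ : EuclideanSpace ℝ (Fin n) → EuclideanSpace ℝ (Fin n)}

/-- The Jacobian matrix of `φ`. -/
def jacMatrix (φ : 𝔼 → 𝔼) (y : 𝔼) : Matrix (Fin n) (Fin n) ℝ :=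
  Matrix.of fun i j => fderiv ℝ φ y (basisVec j) i

lemma jacMatrix_apply_sum (u : 𝔼) (i : Fin n) :
    fderiv ℝ φ y u i = ∑ j, jacMatrix φ y i j * u j := by
  have hx : u = ∑ k, u k • basisVec k := by
    ext i
    simp [Finset.sum_apply, Pi.single_apply]
  conv_lhs => rw [hx]
  simp [jacMatrix, Finset.sum_apply, mul_comm]

lemma bilinField_pullback (h : G' y = (jacMatrix φ y).transpose * G (φ y) * jacMatrix φ y)
    (u v : 𝔼) : bilinField G' y u v = bilinField G (φ y) (fderiv ℝ φ y u) (fderiv ℝ φ y v) := by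
  have key : ∀ (A : 𝔼 → Matrix (Fin n) (Fin n) ℝ) (z a b : 𝔼),
      bilinField A z a b = dotProduct (WithLp.ofLp a) ((A z).mulVec (WithLp.ofLp b)) := by
    intro A z a b
    rw [bilinField_apply]
    simp only [dotProduct, Matrix.mulVec, Finset.mul_sum]
    exact Finset.sum_congr rfl fun _ _ => Finset.sum_congr rfl fun _ _ => by ring
  have hJ : ∀ a : 𝔼, WithLp.ofLp (fderiv ℝ φ y a) = (jacMatrix φ y).mulVec (WithLp.ofLp a) := by
    intro a
    funext i
    exact jacMatrix_apply_sum a i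
  rw [key, key, hJ, hJ, h, ← Matrix.mulVec_mulVec, ← Matrix.mulVec_mulVec,
    Matrix.dotProduct_mulVec, Matrix.vecMul_transpose]

/-- `G'` is the pullback of `G` under the map `φ`, near `y`. -/
def IsPullbackNear (G' G : 𝔼 → Matrix (Fin n) (Fin n) ℝ) (φ : 𝔼 → 𝔼) (y : 𝔼) : Prop :=
  ∀ᶠ z in 𝓝 y, G' z = (jacMatrix φ z).transpose * G (φ z) * jacMatrix φ z

lemma IsMetricNear.injective_fderiv (hG' : IsMetricNear G' y)
    (h : G' y = (jacMatrix φ y).transpose * G (φ y) * jacMatrix φ y) :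
    Function.Injective (fderiv ℝ φ y) := by
  rw [injective_iff_map_eq_zero]
  intro u hu
  refine hG'.eq_zero_of_bilinField fun w => ?_
  rw [bilinField_pullback h, hu]
  simp

/-- Transformation of the Christoffel symbols: `J Γ'(u, v) = Γ(J u, J v) + D²φ(u, v)`. -/
lemma fderiv_chrField_pullback (hφ : ContDiffAt ℝ ∞ φ y) (hG : IsMetricNear G (φ y))
    (hG' : IsMetricNear G' y) (h : IsPullbackNear G' G φ y) (u v : 𝔼) :
    fderiv ℝ φ y (chrField G' y u v)
      = chrField G (φ y) (fderiv ℝ φ y u) (fderiv ℝ φ y v)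
        + fderiv ℝ (fderiv ℝ φ) y u v := by
  have hinj := hG'.injective_fderiv h.self_of_nhds
  have hsurj : Function.Surjective (fderiv ℝ φ y) :=
    LinearMap.surjective_of_injective (f := (fderiv ℝ φ y : 𝔼 →ₗ[ℝ] 𝔼)) hinj
  have hd1 : HasFDerivAt φ (fderiv ℝ φ y) y := (hφ.differentiableAt (by simp)).hasFDerivAt
  have hd2 : HasFDerivAt (fderiv ℝ φ) (fderiv ℝ (fderiv ℝ φ) y) y :=
    ((hφ.fderiv_right (m := 1) (by norm_cast)).differentiableAt one_ne_zero).hasFDerivAt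
  have hsym : ∀ a b, fderiv ℝ (fderiv ℝ φ) y a b = fderiv ℝ (fderiv ℝ φ) y b a :=
    fun a b => (hφ.isSymmSndFDerivAt (by simp; norm_cast)).eq a b
  have hB : HasFDerivAt (fun z => bilinField G (φ z))
      ((fderiv ℝ (bilinField G) (φ y)).comp (fderiv ℝ φ y)) y :=
    HasFDerivAt.comp (g := bilinField G) y
      hG.hasFDerivAt_bilinField.differentiableAt.hasFDerivAt hd1
  have hder : ∀ x a b, fderiv ℝ (bilinField G') y x a b
      = fderiv ℝ (bilinField G) (φ y) (fderiv ℝ φ y x) (fderiv ℝ φ y a) (fderiv ℝ φ y b)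
        + bilinField G (φ y) (fderiv ℝ (fderiv ℝ φ) y x a) (fderiv ℝ φ y b)
        + bilinField G (φ y) (fderiv ℝ φ y a) (fderiv ℝ (fderiv ℝ φ) y x b) := by
    intro x a b
    have e1 : (fun z => bilinField G' z a b)
        =ᶠ[𝓝 y] fun z => bilinField G (φ z) (fderiv ℝ φ z a) (fderiv ℝ φ z b) :=
      h.mono fun z hz => bilinField_pullback hz a b
    have e2 := (hG'.hasFDerivAt_bilinField.differentiableAt.hasFDerivAt.clm_apply
      (hasFDerivAt_const a y)).clm_apply (hasFDerivAt_const b y)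
    have e3 := (hB.clm_apply (hd2.clm_apply (hasFDerivAt_const a y))).clm_apply
      (hd2.clm_apply (hasFDerivAt_const b y))
    have e4 := DFunLike.congr_fun (e2.unique (e3.congr_of_eventuallyEq e1)) x
    simp at e4
    rw [e4]
    ring
  have key : ∀ w, bilinField G (φ y) (fderiv ℝ φ y (chrField G' y u v)
      - (chrField G (φ y) (fderiv ℝ φ y u) (fderiv ℝ φ y v)
        + fderiv ℝ (fderiv ℝ φ) y u v)) w = 0 := by
    intro w
    obtain ⟨w, rfl⟩ := hsurj w
    have k1 := hG'.koszul u v w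
    have k2 := hG.koszul (fderiv ℝ φ y u) (fderiv ℝ φ y v) (fderiv ℝ φ y w)
    rw [bilinField_pullback h.self_of_nhds, hder, hder, hder, hsym v u, hsym w u, hsym w v,
      hG.bilinField_comm (fderiv ℝ φ y v) (fderiv ℝ (fderiv ℝ φ) y u w)] at k1
    simp only [map_sub, map_add, sub_apply, add_apply]
    linarith
  exact sub_eq_zero.1 (hG.eq_zero_of_bilinField key)

/-- Transformation of the curvature operator. -/
lemma fderiv_curvOp_pullback (hφn : ∀ᶠ z in 𝓝 y, ContDiffAt ℝ ∞ φ z)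
    (hG : IsMetricNear G (φ y)) (hG' : IsMetricNear G' y) (h : IsPullbackNear G' G φ y)
    (u v x : 𝔼) :
    fderiv ℝ φ y (curvOp G' y u v x)
      = curvOp G (φ y) (fderiv ℝ φ y u) (fderiv ℝ φ y v) (fderiv ℝ φ y x) := by
  have hφ := hφn.self_of_nhds
  have hd1 : HasFDerivAt φ (fderiv ℝ φ y) y := (hφ.differentiableAt (by simp)).hasFDerivAt
  have hc2 : ContDiffAt ℝ ∞ (fderiv ℝ φ) y := hφ.fderiv_right (by simp)
  have hd2 : HasFDerivAt (fderiv ℝ φ) (fderiv ℝ (fderiv ℝ φ) y) y :=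
    (hc2.differentiableAt (by simp)).hasFDerivAt
  have hd3 : HasFDerivAt (fderiv ℝ (fderiv ℝ φ)) (fderiv ℝ (fderiv ℝ (fderiv ℝ φ)) y) y :=
    ((hc2.fderiv_right (m := 1) (by norm_cast)).differentiableAt one_ne_zero).hasFDerivAt
  have hsym : ∀ a b, fderiv ℝ (fderiv ℝ φ) y a b = fderiv ℝ (fderiv ℝ φ) y b a :=
    fun a b => (hφ.isSymmSndFDerivAt (by simp; norm_cast)).eq a b
  have hsym3 : ∀ a b, fderiv ℝ (fderiv ℝ (fderiv ℝ φ)) y a b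
      = fderiv ℝ (fderiv ℝ (fderiv ℝ φ)) y b a :=
    fun a b => (hc2.isSymmSndFDerivAt (by simp; norm_cast)).eq a b
  have hC : HasFDerivAt (fun z => chrField G (φ z))
      ((fderiv ℝ (chrField G) (φ y)).comp (fderiv ℝ φ y)) y :=
    HasFDerivAt.comp (g := chrField G) y hG.hasFDerivAt_chrField.differentiableAt.hasFDerivAt hd1
  have hGn : ∀ᶠ z in 𝓝 y, IsMetricNear G (φ z) := hφ.continuousAt.eventually hG.eventually
  -- The derivative of the transformation law of the Christoffel symbols.
  have hder : ∀ x a b, fderiv ℝ (fderiv ℝ φ) y x (chrField G' y a b)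
        + fderiv ℝ φ y (fderiv ℝ (chrField G') y x a b)
      = fderiv ℝ (chrField G) (φ y) (fderiv ℝ φ y x) (fderiv ℝ φ y a) (fderiv ℝ φ y b)
        + chrField G (φ y) (fderiv ℝ (fderiv ℝ φ) y x a) (fderiv ℝ φ y b)
        + chrField G (φ y) (fderiv ℝ φ y a) (fderiv ℝ (fderiv ℝ φ) y x b)
        + fderiv ℝ (fderiv ℝ (fderiv ℝ φ)) y x a b := by
    intro x a b
    have e1 : (fun z => fderiv ℝ φ z (chrField G' z a b))
        =ᶠ[𝓝 y] fun z => chrField G (φ z) (fderiv ℝ φ z a) (fderiv ℝ φ z b)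
          + fderiv ℝ (fderiv ℝ φ) z a b := by
      filter_upwards [hφn, hGn, hG'.eventually, h.eventually_nhds] with z h0 h1 h2 h3
      exact fderiv_chrField_pullback h0 h1 h2 h3 a b
    have e2 := hd2.clm_apply ((hG'.hasFDerivAt_chrField.differentiableAt.hasFDerivAt.clm_apply
      (hasFDerivAt_const a y)).clm_apply (hasFDerivAt_const b y))
    have e3 := ((hC.clm_apply (hd2.clm_apply (hasFDerivAt_const a y))).clm_apply
      (hd2.clm_apply (hasFDerivAt_const b y))).add
      ((hd3.clm_apply (hasFDerivAt_const a y)).clm_apply (hasFDerivAt_const b y))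
    have e4 := DFunLike.congr_fun (e2.unique (e3.congr_of_eventuallyEq e1)) x
    simp at e4
    rw [add_comm, e4]
    abel
  have hJ : ∀ a b, fderiv ℝ φ y (chrField G' y a b)
      = chrField G (φ y) (fderiv ℝ φ y a) (fderiv ℝ φ y b) + fderiv ℝ (fderiv ℝ φ) y a b :=
    fderiv_chrField_pullback hφ hG hG' h
  have hx := eq_sub_of_add_eq' (hder x u v)
  have hu := eq_sub_of_add_eq' (hder u x v)
  simp only [curvOp_apply, map_sub, map_add, hx, hu, hJ]
  rw [hsym u x, hsym3 u x]
  abel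

/-- The Ricci tensor is a tensor: `Ric' = Jᵀ (Ric ∘ φ) J`. -/
lemma ricciMatrix_pullback (hφ : ∀ᶠ z in 𝓝 y, ContDiffAt ℝ ∞ φ z)
    (hG : IsMetricNear G (φ y)) (hG' : IsMetricNear G' y) (h : IsPullbackNear G' G φ y) :
    ricciMatrix G' y = (jacMatrix φ y).transpose * ricciMatrix G (φ y) * jacMatrix φ y := by
  have hinj := hG'.injective_fderiv h.self_of_nhds
  set e : 𝔼 ≃ₗ[ℝ] 𝔼 := LinearEquiv.ofInjectiveEndo (fderiv ℝ φ y : 𝔼 →ₗ[ℝ] 𝔼) hinj with he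
  have htr : ∀ u v, LinearMap.trace ℝ 𝔼 (curvOp G' y u v : 𝔼 →ₗ[ℝ] 𝔼)
      = LinearMap.trace ℝ 𝔼 (curvOp G (φ y) (fderiv ℝ φ y u) (fderiv ℝ φ y v) : 𝔼 →ₗ[ℝ] 𝔼) := by
    intro u v
    rw [← LinearMap.trace_conj' (curvOp G' y u v : 𝔼 →ₗ[ℝ] 𝔼) e]
    congr 1
    ext1 x
    obtain ⟨x, rfl⟩ := e.surjective x
    rw [LinearEquiv.conj_apply_apply, LinearEquiv.symm_apply_apply]
    exact fderiv_curvOp_pullback hφ hG hG' h u v x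
  ext i j
  rw [hG'.ricciMatrix_eq_trace, htr, trace_curvOp_eq_sum]
  simp only [← hG.ricciMatrix_eq_trace, Matrix.mul_apply, Finset.sum_mul, Matrix.transpose_apply,
    jacMatrix, Matrix.of_apply]
  exact Finset.sum_congr rfl fun a _ => Finset.sum_congr rfl fun b _ => by ring

end Tensoriality

/-! ### First variation of the curvature -/

section Variation

variable {n : ℕ}

local notation "𝔼" => EuclideanSpace ℝ (Fin n)

/-- Near `y`, the matrix function `H` is smooth and symmetric. -/
def IsSymNear (H : 𝔼 → Matrix (Fin n) (Fin n) ℝ) (y : 𝔼) : Prop :=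
  ∀ᶠ z in 𝓝 y, (∀ i j, ContDiffAt ℝ ∞ (fun w => H w i j) z) ∧ (H z).IsSymm

/-- The first variation of the Christoffel symbols,
`G^{kl} (1/2 (∂_i H_{jl} + ∂_j H_{il} - ∂_l H_{ij}) - H_{lm} Γ^m_{ij})`. -/
def dChr (G H : 𝔼 → Matrix (Fin n) (Fin n) ℝ) (k i j : Fin n) (y : 𝔼) : ℝ :=
  ∑ l, (G y)⁻¹ k l * ((1 / 2) * (partialDeriv i (fun z => H z j l) y
    + partialDeriv j (fun z => H z i l) y - partialDeriv l (fun z => H z i j) y)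
      - ∑ m, H y l m * christoffel G m i j y)

/-- The first variation of the Ricci tensor. -/
def dRic (G H : 𝔼 → Matrix (Fin n) (Fin n) ℝ) (y : 𝔼) (i j : Fin n) : ℝ :=
  ∑ k, partialDeriv k (dChr G H k i j) y
    - ∑ k, partialDeriv j (dChr G H k i k) y
    + ∑ k, ∑ l, (dChr G H k k l y * christoffel G l i j y
      + christoffel G k k l y * dChr G H l i j y)
    - ∑ k, ∑ l, (dChr G H k j l y * christoffel G l i k y
      + christoffel G k j l y * dChr G H l i k y)

/-- The first variation of the scalar curvature. -/
def dScal (G H : 𝔼 → Matrix (Fin n) (Fin n) ℝ) (y : 𝔼) : ℝ :=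
  ∑ i, ∑ j, ((-((G y)⁻¹ * H y * (G y)⁻¹)) i j * ricciMatrix G y i j + (G y)⁻¹ i j * dRic G H y i j)

variable {G H H' : EuclideanSpace ℝ (Fin n) → Matrix (Fin n) (Fin n) ℝ}
  {y : EuclideanSpace ℝ (Fin n)}

lemma IsSymNear.eventually (hH : IsSymNear H y) : ∀ᶠ z in 𝓝 y, IsSymNear H z :=
  hH.eventually_nhds

lemma IsSymNear.smooth (hH : IsSymNear H y) (i j : Fin n) :
    ContDiffAt ℝ ∞ (fun w => H w i j) y := hH.self_of_nhds.1 i j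

lemma IsSymNear.differentiableAt (hH : IsSymNear H y) (i j : Fin n) :
    DifferentiableAt ℝ (fun w => H w i j) y := (hH.smooth i j).differentiableAt (by simp)

lemma IsSymNear.partialDeriv_comm_index (hH : IsSymNear H y) (k i j : Fin n) :
    partialDeriv k (fun z => H z i j) y = partialDeriv k (fun z => H z j i) y :=
  partialDeriv_congr (hH.mono fun _ hz => hz.2.apply j i) k

lemma IsMetricNear.isSymNear (hG : IsMetricNear G y) : IsSymNear G y :=
  hG.mono fun _ hz => ⟨hz.1, hz.2.1⟩

lemma dChr_symm (hG : IsMetricNear G y) (hH : IsSymNear H y) (k i j : Fin n) :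
    dChr G H k i j y = dChr G H k j i y := by
  unfold dChr
  refine Finset.sum_congr rfl fun l _ => ?_
  rw [hH.partialDeriv_comm_index l i j]
  simp only [hG.christoffel_symm _ i j]
  ring

lemma contDiffAt_dChr (hG : IsMetricNear G y) (hH : IsSymNear H y) (k i j : Fin n) :
    ContDiffAt ℝ ∞ (dChr G H k i j) y := by
  refine ContDiffAt.sum fun l _ => (hG.contDiffAt_inv_apply k l).mul (ContDiffAt.sub ?_ ?_)
  · exact contDiffAt_const.mul (((contDiffAt_partialDeriv (hH.smooth j l) i).add
      (contDiffAt_partialDeriv (hH.smooth i l) j)).sub (contDiffAt_partialDeriv (hH.smooth i j) l))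
  · exact ContDiffAt.sum fun m _ => (hH.smooth l m).mul (hG.contDiffAt_christoffel m i j)

lemma differentiableAt_dChr (hG : IsMetricNear G y) (hH : IsSymNear H y) (k i j : Fin n) :
    DifferentiableAt ℝ (dChr G H k i j) y :=
  (contDiffAt_dChr hG hH k i j).differentiableAt (by simp)

section Linearity

lemma dChr_add (hH : IsSymNear H y) (hH' : IsSymNear H' y) (k i j : Fin n) :
    dChr G (fun z => H z + H' z) k i j y = dChr G H k i j y + dChr G H' k i j y := by
  have h : ∀ m a b, partialDeriv m (fun z => H z a b + H' z a b) y
      = partialDeriv m (fun z => H z a b) y + partialDeriv m (fun z => H' z a b) y :=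
    fun m a b => partialDeriv_add (hH.differentiableAt a b) (hH'.differentiableAt a b) m
  simp only [dChr, h, Matrix.add_apply, ← Finset.sum_add_distrib]
  refine Finset.sum_congr rfl fun l _ => ?_
  simp only [add_mul, Finset.sum_add_distrib]
  ring

lemma dRic_add (hG : IsMetricNear G y) (hH : IsSymNear H y) (hH' : IsSymNear H' y)
    (i j : Fin n) : dRic G (fun z => H z + H' z) y i j = dRic G H y i j + dRic G H' y i j := by
  have h1 := dChr_add (G := G) hH hH'
  have h2 : ∀ m k i j, partialDeriv m (dChr G (fun z => H z + H' z) k i j) y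
      = partialDeriv m (dChr G H k i j) y + partialDeriv m (dChr G H' k i j) y := by
    intro m k i j
    rw [← partialDeriv_add (differentiableAt_dChr hG hH k i j) (differentiableAt_dChr hG hH' k i j)]
    refine partialDeriv_congr ?_ m
    filter_upwards [hH.eventually, hH'.eventually] with z hz hz'
    exact dChr_add hz hz' k i j
  simp only [dRic, h1, h2, add_mul, mul_add, Finset.sum_add_distrib]
  ring

lemma dScal_add (hG : IsMetricNear G y) (hH : IsSymNear H y) (hH' : IsSymNear H' y) :
    dScal G (fun z => H z + H' z) y = dScal G H y + dScal G H' y := by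
  simp only [dScal, dRic_add hG hH hH', Matrix.mul_add, Matrix.add_mul, Matrix.neg_apply,
    Matrix.add_apply, ← Finset.sum_add_distrib]
  exact Finset.sum_congr rfl fun i _ => Finset.sum_congr rfl fun j _ => by ring

lemma dChr_eq_zero (hH : H =ᶠ[𝓝 y] 0) (k i j : Fin n) : dChr G H k i j y = 0 := by
  have h : ∀ m a b, partialDeriv m (fun z => H z a b) y = 0 := by
    intro m a b
    have : (fun z => H z a b) =ᶠ[𝓝 y] fun _ => (0 : ℝ) := hH.mono fun z hz => by simp [hz]
    rw [partialDeriv_congr this]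
    simp [partialDeriv]
  simp [dChr, h, hH.self_of_nhds]

lemma dScal_eq_zero (hH : H =ᶠ[𝓝 y] 0) : dScal G H y = 0 := by
  have h : ∀ m k i j, partialDeriv m (dChr G H k i j) y = 0 := by
    intro m k i j
    have : dChr G H k i j =ᶠ[𝓝 y] fun _ => (0 : ℝ) :=
      hH.eventually_nhds.mono fun z hz => dChr_eq_zero hz k i j
    rw [partialDeriv_congr this]
    simp [partialDeriv]
  simp [dScal, dRic, h, dChr_eq_zero hH, hH.self_of_nhds]

end Linearity

/-- The affine family of matrix functions `G + t H`. -/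
def lineFamily (G H : 𝔼 → Matrix (Fin n) (Fin n) ℝ) (t : ℝ) (z : 𝔼) : Matrix (Fin n) (Fin n) ℝ :=
  G z + t • H z

@[simp] lemma lineFamily_zero : lineFamily G H 0 = G := by
  funext z
  simp [lineFamily]

lemma lineFamily_apply (t : ℝ) (z : 𝔼) (i j : Fin n) :
    lineFamily G H t z i j = G z i j + t * H z i j := rfl

lemma contDiffAt_lineFamily {t : ℝ} (hG : IsSymNear G y) (hH : IsSymNear H y) (i j : Fin n) :
    ContDiffAt ℝ ∞ (fun q : ℝ × 𝔼 => lineFamily G H q.1 q.2 i j) (t, y) := by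
  simp only [lineFamily_apply]
  exact (contDiffAt_family_const (hG.smooth i j)).add
    (contDiffAt_fst.mul (contDiffAt_family_const (hH.smooth i j)))

lemma isMetricNear_lineFamily {t : ℝ} (hG : IsSymNear G y) (hH : IsSymNear H y)
    (hdet : (lineFamily G H t y).det ≠ 0) : IsMetricNear (lineFamily G H t) y := by
  have h1 : ∀ᶠ z in 𝓝 y, (lineFamily G H t z).det ≠ 0 :=
    (contDiffAt_det fun i j => (hG.smooth i j).add
      (contDiffAt_const.mul (hH.smooth i j))).continuousAt.eventually_ne hdet
  filter_upwards [h1, hG, hH] with z h2 h3 h4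
  exact ⟨fun i j => (h3.1 i j).add (contDiffAt_const.mul (h4.1 i j)), h3.2.add (h4.2.smul t), h2⟩

lemma hasDerivAt_lineFamily (z : 𝔼) (i j : Fin n) (t : ℝ) :
    HasDerivAt (fun t => lineFamily G H t z i j) (H z i j) t := by
  simp only [lineFamily_apply]
  simpa using ((hasDerivAt_id t).mul_const (H z i j)).const_add (G z i j)

lemma partialDeriv_lineFamily (hG : IsSymNear G y) (hH : IsSymNear H y) (t : ℝ) (m i j : Fin n) :
    partialDeriv m (fun z => lineFamily G H t z i j) y
      = partialDeriv m (fun z => G z i j) y + t * partialDeriv m (fun z => H z i j) y := by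
  simp only [lineFamily_apply]
  rw [partialDeriv_add (hG.differentiableAt i j) ((hH.differentiableAt i j).const_mul t),
    partialDeriv_const_mul]

lemma hasDerivAt_inv_lineFamily (hG : IsMetricNear G y) (i j : Fin n) :
    HasDerivAt (fun t => (lineFamily G H t y)⁻¹ i j) ((-((G y)⁻¹ * H y * (G y)⁻¹)) i j) 0 := by
  have := hasDerivAt_inv (A := fun t => lineFamily G H t y) (A' := H y) (t := 0)
    (fun a b => hasDerivAt_lineFamily y a b 0) (by simpa using hG.det_ne_zero) i j
  simpa using this

lemma hasDerivAt_christoffel (hG : IsMetricNear G y) (hH : IsSymNear H y) (k i j : Fin n) :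
    HasDerivAt (fun t => christoffel (lineFamily G H t) k i j y) (dChr G H k i j y) 0 := by
  unfold christoffel
  simp only [partialDeriv_lineFamily hG.isSymNear hH]
  set K : Fin n → ℝ := fun l => partialDeriv i (fun z => G z j l) y
    + partialDeriv j (fun z => G z i l) y - partialDeriv l (fun z => G z i j) y with hK
  set K' : Fin n → ℝ := fun l => partialDeriv i (fun z => H z j l) y
    + partialDeriv j (fun z => H z i l) y - partialDeriv l (fun z => H z i j) y with hK'
  have h1 : ∀ l, HasDerivAt (fun t : ℝ => (partialDeriv i (fun z => G z j l) y
      + t * partialDeriv i (fun z => H z j l) y) + (partialDeriv j (fun z => G z i l) y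
      + t * partialDeriv j (fun z => H z i l) y) - (partialDeriv l (fun z => G z i j) y
      + t * partialDeriv l (fun z => H z i j) y)) (K' l) 0 := by
    intro l
    have h : ∀ a b : ℝ, HasDerivAt (fun t : ℝ => a + t * b) b 0 := fun a b => by
      simpa using ((hasDerivAt_id (0 : ℝ)).mul_const b).const_add a
    exact ((h _ _).add (h _ _)).sub (h _ _)
  have h2 := (HasDerivAt.fun_sum fun l (_ : l ∈ (Finset.univ : Finset (Fin n))) =>
    (hasDerivAt_inv_lineFamily (H := H) hG k l).mul (h1 l)).const_mul (1 / 2 : ℝ)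
  refine h2.congr_deriv ?_
  simp only [lineFamily_zero, zero_mul, add_zero]
  -- `1/2 K = G Γ`, so that `- G⁻¹ H G⁻¹ (1/2 K) = - G⁻¹ H Γ`.
  have hΓ : ∀ l, (1 / 2) * K l = ∑ m, G y l m * christoffel G m i j y := fun l =>
    (hG.sum_mul_christoffel l i j).symm
  set v : Fin n → ℝ := fun m => christoffel G m i j y with hv
  have h3 : ∑ l, ((G y)⁻¹ * H y * (G y)⁻¹) k l * ((1 / 2) * K l)
      = ∑ l, (G y)⁻¹ k l * ∑ m, H y l m * v m := by
    have e1 : (fun l => (1 / 2) * K l) = (G y).mulVec v := funext hΓ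
    have e2 : ((G y)⁻¹ * H y * (G y)⁻¹).mulVec ((G y).mulVec v)
        = ((G y)⁻¹).mulVec ((H y).mulVec v) := by
      rw [Matrix.mulVec_mulVec, Matrix.mul_assoc _ _ (G y), hG.inv_mul, Matrix.mul_one,
        Matrix.mulVec_mulVec]
    rw [← e1] at e2
    exact congrFun e2 k
  have h4 : dChr G H k i j y = ∑ l, (G y)⁻¹ k l * ((1 / 2) * K' l)
      - ∑ l, (G y)⁻¹ k l * ∑ m, H y l m * v m := by
    simp only [dChr, hK', hv, mul_sub, Finset.sum_sub_distrib]
  rw [h4, ← h3, Finset.mul_sum, ← Finset.sum_sub_distrib]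
  refine Finset.sum_congr rfl fun l _ => ?_
  simp only [Matrix.neg_apply]
  ring

lemma hasDerivAt_ricciMatrix (hG : IsMetricNear G y) (hH : IsSymNear H y) (i j : Fin n) :
    HasDerivAt (fun t => ricciMatrix (lineFamily G H t) y i j) (dRic G H y i j) 0 := by
  have hc := hasDerivAt_christoffel hG hH
  have hd : ∀ m k i j, HasDerivAt (fun t => partialDeriv m (christoffel (lineFamily G H t) k i j) y)
      (partialDeriv m (dChr G H k i j) y) 0 := by
    intro m k i j
    refine hasDerivAt_partialDeriv_family
      (f := fun t => christoffel (lineFamily G H t) k i j) ?_ ?_ m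
    · exact contDiffAt_christoffel_family
        (fun a b => contDiffAt_lineFamily hG.isSymNear hH a b) (by simpa using hG.det_ne_zero) k i j
    · filter_upwards [hG.eventually, hH.eventually] with z h1 h2
      exact hasDerivAt_christoffel h1 h2 k i j
  simp only [ricciMatrix, Matrix.of_apply]
  have h := (((HasDerivAt.fun_sum fun k (_ : k ∈ (Finset.univ : Finset (Fin n))) => hd k k i j).sub
    (HasDerivAt.fun_sum fun k (_ : k ∈ (Finset.univ : Finset (Fin n))) => hd j k i k)).add
    (HasDerivAt.fun_sum fun k (_ : k ∈ (Finset.univ : Finset (Fin n))) =>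
      HasDerivAt.fun_sum fun l (_ : l ∈ (Finset.univ : Finset (Fin n))) =>
        (hc k k l).mul (hc l i j))).sub
    (HasDerivAt.fun_sum fun k (_ : k ∈ (Finset.univ : Finset (Fin n))) =>
      HasDerivAt.fun_sum fun l (_ : l ∈ (Finset.univ : Finset (Fin n))) =>
        (hc k j l).mul (hc l i k))
  refine h.congr_deriv ?_
  simp only [lineFamily_zero, dRic]

lemma hasDerivAt_scalarCurv (hG : IsMetricNear G y) (hH : IsSymNear H y) :
    HasDerivAt (fun t => scalarCurv (lineFamily G H t) y) (dScal G H y) 0 := by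
  have h := HasDerivAt.fun_sum fun i (_ : i ∈ (Finset.univ : Finset (Fin n))) =>
    HasDerivAt.fun_sum fun j (_ : j ∈ (Finset.univ : Finset (Fin n))) =>
      (hasDerivAt_inv_lineFamily (H := H) hG i j).mul (hasDerivAt_ricciMatrix hG hH i j)
  refine h.congr_deriv ?_
  simp only [lineFamily_zero, dScal]

end Variation

/-! ### The Palatini identity -/

section Palatini

lemma sum_quadruple {ι : Type*} [Fintype ι] (f : ι → ι → ι → ι → ℝ) :
    ∑ a, ∑ b, ∑ c, ∑ d, f a b c d = ∑ p : ι × ι × ι × ι, f p.1 p.2.1 p.2.2.1 p.2.2.2 := by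
  simp only [Fintype.sum_prod_type]

/-- The algebraic content of the Palatini identity: with `∂g` and `∂√g` expressed through the
Christoffel symbols, the quadratic terms of `g^{ij} δR_{ij}` are those of a divergence. -/
lemma palatini_algebra {ι : Type*} [Fintype ι] (g : ι → ι → ℝ) (Γ C : ι → ι → ι → ℝ)
    (D : ι → ι → ι → ι → ℝ) (hΓ : ∀ k i j, Γ k i j = Γ k j i) (hC : ∀ k i j, C k i j = C k j i) :
    ∑ k, ((∑ a, Γ a k a) * (∑ i, ∑ j, g i j * C k i j - ∑ i, ∑ j, g i k * C j i j)
      + (∑ i, ∑ j, ((-(∑ a, Γ i k a * g a j) - ∑ a, Γ j k a * g i a) * C k i j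
          + g i j * D k k i j)
        - ∑ i, ∑ j, ((-(∑ a, Γ i k a * g a k) - ∑ a, Γ k k a * g i a) * C j i j
          + g i k * D k j i j)))
      = ∑ i, ∑ j, g i j * (∑ k, D k k i j - ∑ k, D j k i k
        + ∑ k, ∑ l, (C k k l * Γ l i j + Γ k k l * C l i j)
        - ∑ k, ∑ l, (C k j l * Γ l i k + Γ k j l * C l i k)) := by
  have hD1 : ∑ k, ∑ i, ∑ j, g i j * D k k i j = ∑ i, ∑ j, ∑ k, g i j * D k k i j := by
    rw [Finset.sum_comm]
    exact Finset.sum_congr rfl fun i _ => Finset.sum_comm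
  have hD2 : ∑ k, ∑ i, ∑ j, g i k * D k j i j = ∑ i, ∑ j, ∑ k, g i j * D j k i k :=
    Finset.sum_comm
  have h1 : ∑ k, ∑ i, ∑ j, ∑ a, Γ a k a * (g i j * C k i j)
      = ∑ i, ∑ j, ∑ k, ∑ l, g i j * (Γ k k l * C l i j) := by
    rw [sum_quadruple (fun k i j a => Γ a k a * (g i j * C k i j)),
      sum_quadruple (fun i j k l => g i j * (Γ k k l * C l i j))]
    refine Finset.sum_nbij' (fun p => (p.2.1, p.2.2.1, p.2.2.2, p.1))
      (fun p => (p.2.2.2, p.1, p.2.1, p.2.2.1)) ?_ ?_ ?_ ?_ ?_ <;> try simp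
    intro k i j a
    rw [hΓ a k a]; ring
  have h2 : ∑ k, ∑ i, ∑ j, ∑ a, Γ a k a * (g i k * C j i j)
      = ∑ k, ∑ i, ∑ j, ∑ a, Γ k k a * g i a * C j i j := by
    rw [sum_quadruple (fun k i j a => Γ a k a * (g i k * C j i j)),
      sum_quadruple (fun k i j a => Γ k k a * g i a * C j i j)]
    refine Finset.sum_nbij' (fun p => (p.2.2.2, p.2.1, p.2.2.1, p.1))
      (fun p => (p.2.2.2, p.2.1, p.2.2.1, p.1)) ?_ ?_ ?_ ?_ ?_ <;> try simp
    intro k i j a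
    rw [hΓ a k a]; ring
  have h3 : ∑ k, ∑ i, ∑ j, ∑ a, Γ i k a * g a j * C k i j
      = ∑ i, ∑ j, ∑ k, ∑ l, g i j * (C k j l * Γ l i k) := by
    rw [sum_quadruple (fun k i j a => Γ i k a * g a j * C k i j),
      sum_quadruple (fun i j k l => g i j * (C k j l * Γ l i k))]
    refine Finset.sum_nbij' (fun p => (p.2.2.2, p.2.2.1, p.1, p.2.1))
      (fun p => (p.2.2.1, p.2.2.2, p.2.1, p.1)) ?_ ?_ ?_ ?_ ?_ <;> try simp
    intro k i j a
    rw [hΓ i k a, hC k i j]; ring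
  have h4 : ∑ k, ∑ i, ∑ j, ∑ a, Γ j k a * g i a * C k i j
      = ∑ i, ∑ j, ∑ k, ∑ l, g i j * (Γ k j l * C l i k) := by
    rw [sum_quadruple (fun k i j a => Γ j k a * g i a * C k i j),
      sum_quadruple (fun i j k l => g i j * (Γ k j l * C l i k))]
    refine Finset.sum_nbij' (fun p => (p.2.1, p.2.2.2, p.2.2.1, p.1))
      (fun p => (p.2.2.2, p.1, p.2.2.1, p.2.1)) ?_ ?_ ?_ ?_ ?_ <;> try simp
    intro k i j a
    rw [hΓ j k a]; ring
  have h5 : ∑ k, ∑ i, ∑ j, ∑ a, Γ i k a * g a k * C j i j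
      = ∑ i, ∑ j, ∑ k, ∑ l, g i j * (C k k l * Γ l i j) := by
    rw [sum_quadruple (fun k i j a => Γ i k a * g a k * C j i j),
      sum_quadruple (fun i j k l => g i j * (C k k l * Γ l i j))]
    refine Finset.sum_nbij' (fun p => (p.2.2.2, p.1, p.2.2.1, p.2.1))
      (fun p => (p.2.1, p.2.2.2, p.2.2.1, p.1)) ?_ ?_ ?_ ?_ ?_ <;> try simp
    intro k i j a
    rw [hΓ i k a, hC j i j]; ring
  simp only [mul_add, mul_sub, sub_mul, neg_mul, Finset.sum_add_distrib,
    Finset.sum_sub_distrib, Finset.sum_neg_distrib, Finset.mul_sum, Finset.sum_mul]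
  simp only [hD1, hD2, h1, h2, h3, h4, h5]
  ring

variable {n : ℕ}

local notation "𝔼" => EuclideanSpace ℝ (Fin n)

variable {G H : EuclideanSpace ℝ (Fin n) → Matrix (Fin n) (Fin n) ℝ}
  {y : EuclideanSpace ℝ (Fin n)}

/-- The vector density `√g (g^{ij} C^k_{ij} - g^{ik} C^j_{ij})`, with `C` the first variation of the
Christoffel symbols; its divergence is `√g g^{ij} δR_{ij}`. -/
def palatiniField (G H : 𝔼 → Matrix (Fin n) (Fin n) ℝ) (k : Fin n) (y : 𝔼) : ℝ :=
  √(G y).det * (∑ i, ∑ j, (G y)⁻¹ i j * dChr G H k i j y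
    - ∑ i, ∑ j, (G y)⁻¹ i k * dChr G H j i j y)

lemma contDiffAt_sqrt_det (hG : IsMetricNear G y) : ContDiffAt ℝ ∞ (fun z => √(G z).det) y :=
  (contDiffAt_det hG.smooth).sqrt hG.det_ne_zero

lemma contDiffAt_palatiniField (hG : IsMetricNear G y) (hH : IsSymNear H y) (k : Fin n) :
    ContDiffAt ℝ ∞ (palatiniField G H k) y :=
  (contDiffAt_sqrt_det hG).mul ((ContDiffAt.sum fun _ _ => ContDiffAt.sum fun _ _ =>
    (hG.contDiffAt_inv_apply _ _).mul (contDiffAt_dChr hG hH _ _ _)).sub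
    (ContDiffAt.sum fun _ _ => ContDiffAt.sum fun _ _ =>
      (hG.contDiffAt_inv_apply _ _).mul (contDiffAt_dChr hG hH _ _ _)))

lemma partialDeriv_sqrt_det (hG : IsMetricNear G y) (hpos : 0 < (G y).det) (k : Fin n) :
    partialDeriv k (fun z => √(G z).det) y = √(G y).det * ∑ a, christoffel G a k a y := by
  have hd : DifferentiableAt ℝ (fun z => (G z).det) y :=
    (contDiffAt_det hG.smooth).differentiableAt (by simp)
  have : partialDeriv k (fun z => √(G z).det) y
      = (1 / (2 * √(G y).det)) * partialDeriv k (fun z => (G z).det) y := by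
    unfold partialDeriv
    rw [fderiv_sqrt hd hG.det_ne_zero]; rfl
  rw [this, hG.partialDeriv_det]
  have h1 : √(G y).det ≠ 0 := (Real.sqrt_pos.2 hpos).ne'
  have h2 : (G y).det = √(G y).det * √(G y).det := (Real.mul_self_sqrt hpos.le).symm
  field_simp
  rw [Real.sq_sqrt hpos.le]

/-- The Palatini identity: `√g g^{ij} δR_{ij}` is a divergence. -/
lemma sum_partialDeriv_palatiniField (hG : IsMetricNear G y) (hH : IsSymNear H y)
    (hpos : 0 < (G y).det) :
    ∑ k, partialDeriv k (palatiniField G H k) y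
      = √(G y).det * ∑ i, ∑ j, (G y)⁻¹ i j * dRic G H y i j := by
  have hS : DifferentiableAt ℝ (fun z => √(G z).det) y :=
    (contDiffAt_sqrt_det hG).differentiableAt (by simp)
  have hI : ∀ i j, DifferentiableAt ℝ (fun z => (G z)⁻¹ i j) y := fun i j =>
    (hG.contDiffAt_inv_apply i j).differentiableAt (by simp)
  have hC := differentiableAt_dChr hG hH
  have hp : ∀ a b k i j, DifferentiableAt ℝ (fun z => (G z)⁻¹ a b * dChr G H k i j z) y :=
    fun a b k i j => (hI a b).mul (hC k i j)
  have h1 : ∀ k, partialDeriv k (palatiniField G H k) y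
      = √(G y).det * ((∑ a, christoffel G a k a y) * (∑ i, ∑ j, (G y)⁻¹ i j * dChr G H k i j y
          - ∑ i, ∑ j, (G y)⁻¹ i k * dChr G H j i j y)
        + (∑ i, ∑ j, ((-(∑ a, christoffel G i k a y * (G y)⁻¹ a j)
              - ∑ a, christoffel G j k a y * (G y)⁻¹ i a) * dChr G H k i j y
            + (G y)⁻¹ i j * partialDeriv k (dChr G H k i j) y)
          - ∑ i, ∑ j, ((-(∑ a, christoffel G i k a y * (G y)⁻¹ a k)
              - ∑ a, christoffel G k k a y * (G y)⁻¹ i a) * dChr G H j i j y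
            + (G y)⁻¹ i k * partialDeriv k (dChr G H j i j) y))) := by
    intro k
    have e1 : partialDeriv k (fun z => ∑ i, ∑ j, (G z)⁻¹ i j * dChr G H k i j z) y
        = ∑ i, ∑ j, ((-(∑ a, christoffel G i k a y * (G y)⁻¹ a j)
              - ∑ a, christoffel G j k a y * (G y)⁻¹ i a) * dChr G H k i j y
            + (G y)⁻¹ i j * partialDeriv k (dChr G H k i j) y) := by
      rw [partialDeriv_sum fun i _ => DifferentiableAt.fun_sum fun j _ => hp i j k i j]
      refine Finset.sum_congr rfl fun i _ => ?_
      rw [partialDeriv_sum fun j _ => hp i j k i j]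
      refine Finset.sum_congr rfl fun j _ => ?_
      rw [partialDeriv_mul (hI i j) (hC k i j), hG.partialDeriv_inv_eq]
    have e2 : partialDeriv k (fun z => ∑ i, ∑ j, (G z)⁻¹ i k * dChr G H j i j z) y
        = ∑ i, ∑ j, ((-(∑ a, christoffel G i k a y * (G y)⁻¹ a k)
              - ∑ a, christoffel G k k a y * (G y)⁻¹ i a) * dChr G H j i j y
            + (G y)⁻¹ i k * partialDeriv k (dChr G H j i j) y) := by
      rw [partialDeriv_sum fun i _ => DifferentiableAt.fun_sum fun j _ => hp i k j i j]
      refine Finset.sum_congr rfl fun i _ => ?_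
      rw [partialDeriv_sum fun j _ => hp i k j i j]
      refine Finset.sum_congr rfl fun j _ => ?_
      rw [partialDeriv_mul (hI i k) (hC j i j), hG.partialDeriv_inv_eq]
    have d1 : DifferentiableAt ℝ (fun z => ∑ i, ∑ j, (G z)⁻¹ i j * dChr G H k i j z) y :=
      DifferentiableAt.fun_sum fun i _ => DifferentiableAt.fun_sum fun j _ => hp i j k i j
    have d2 : DifferentiableAt ℝ (fun z => ∑ i, ∑ j, (G z)⁻¹ i k * dChr G H j i j z) y :=
      DifferentiableAt.fun_sum fun i _ => DifferentiableAt.fun_sum fun j _ => hp i k j i j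
    have e3 := partialDeriv_mul hS (d1.fun_sub d2) k
    rw [partialDeriv_sub d1 d2, e1, e2, partialDeriv_sqrt_det hG hpos] at e3
    change partialDeriv k (palatiniField G H k) y = _ at e3
    rw [e3]
    ring
  simp only [h1]
  rw [← Finset.mul_sum]
  congr 1
  exact palatini_algebra (fun i j => (G y)⁻¹ i j) (fun k i j => christoffel G k i j y)
    (fun k i j => dChr G H k i j y) (fun m k i j => partialDeriv m (dChr G H k i j) y)
    hG.christoffel_symm (dChr_symm hG hH)

end Palatini

/-! ### Integrals in coordinates -/

section CoordinateIntegrals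

open MeasureTheory Set

variable {n : ℕ}

local notation "𝔼" => EuclideanSpace ℝ (Fin n)

variable {U K : Set (EuclideanSpace ℝ (Fin n))}

lemma integrableOn_of_eq_zero_off_compact {f : 𝔼 → ℝ} (hU : IsOpen U) (hK : IsCompact K)
    (hKU : K ⊆ U) (hf : ContinuousOn f U) (hf0 : ∀ y ∈ U \ K, f y = 0) : IntegrableOn f U :=
  ((hf.mono hKU).integrableOn_compact hK).of_forall_sdiff_eq_zero hU.measurableSet hf0

lemma integral_partialDeriv_eq_zero {f : 𝔼 → ℝ} (hf : ContDiff ℝ 1 f) (hc : HasCompactSupport f)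
    (k : Fin n) : ∫ y, partialDeriv k f y = 0 := by
  have hcont : Continuous fun y => fderiv ℝ f y (basisVec k) :=
    (hf.continuous_fderiv one_ne_zero).clm_apply continuous_const
  have hcs : HasCompactSupport fun y => fderiv ℝ f y (basisVec k) :=
    (hc.fderiv ℝ).mono fun y hy h => hy (by simp [h])
  have hint : Integrable fun y => fderiv ℝ f y (basisVec k) :=
    hcont.integrable_of_hasCompactSupport hcs
  have h := integral_mul_fderiv_eq_neg_fderiv_mul_of_integrable (μ := (volume : Measure 𝔼))
    (f := fun _ => (1 : ℝ)) (g := f) (v := basisVec k) (by simp) (by simpa using hint)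
    (by simpa using hf.continuous.integrable_of_hasCompactSupport hc)
    (fun _ _ => differentiableAt_const _) (fun y _ => hf.differentiable one_ne_zero y)
  simpa [partialDeriv] using h

/-- Differentiation under the integral sign for a smooth family weighted by a compactly supported
function. -/
lemma hasDerivAt_integral_family {w : 𝔼 → ℝ} {Φ : ℝ → 𝔼 → ℝ} {Φ' : 𝔼 → ℝ} {ε : ℝ} (hε : 0 < ε)
    (hU : IsOpen U) (hK : IsCompact K) (hKU : K ⊆ U) (hw : ContinuousOn w U)
    (hw0 : ∀ y ∈ U \ K, w y = 0)
    (hΦ : ∀ t : ℝ, |t| < ε → ∀ y ∈ U, ContDiffAt ℝ ∞ (fun q : ℝ × 𝔼 => Φ q.1 q.2) (t, y))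
    (hΦ' : ∀ y ∈ U, HasDerivAt (fun t => Φ t y) (Φ' y) 0) :
    HasDerivAt (fun t => ∫ y in U, w y * Φ t y) (∫ y in U, w y * Φ' y) 0 := by
  set D : ℝ × 𝔼 → ℝ := fun q => fderiv ℝ (fun q : ℝ × 𝔼 => Φ q.1 q.2) q (1, 0) with hD
  have hder : ∀ t : ℝ, |t| < ε → ∀ y ∈ U, HasDerivAt (fun s => Φ s y) (D (t, y)) t := by
    intro t ht y hy
    have h1 : HasDerivAt (fun s : ℝ => ((s, y) : ℝ × 𝔼)) (1, 0) t :=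
      (hasDerivAt_id t).prodMk (hasDerivAt_const t y)
    exact HasFDerivAt.comp_hasDerivAt (f := fun s : ℝ => ((s, y) : ℝ × 𝔼)) t
      ((hΦ t ht y hy).differentiableAt (by simp)).hasFDerivAt h1
  have hDc : ∀ t : ℝ, |t| < ε → ∀ y ∈ U, ContinuousAt D (t, y) := by
    intro t ht y hy
    exact (((hΦ t ht y hy).fderiv_right (m := 0) (by simp)).clm_apply
      contDiffAt_const).continuousAt
  have hε2 : ∀ t ∈ Icc (-(ε / 2)) (ε / 2), |t| < ε := fun t ht => by
    rw [abs_lt]; constructor <;> linarith [ht.1, ht.2]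
  have hcompact : IsCompact (Icc (-(ε / 2)) (ε / 2) ×ˢ K) := isCompact_Icc.prod hK
  have hcontF' : ContinuousOn (fun q : ℝ × 𝔼 => w q.2 * D q) (Icc (-(ε / 2)) (ε / 2) ×ˢ K) := by
    refine ContinuousOn.mul ((hw.mono hKU).comp continuousOn_snd fun q hq => hq.2) ?_
    exact fun q hq => (hDc q.1 (hε2 _ hq.1) q.2 (hKU hq.2)).continuousWithinAt
  obtain ⟨B, hB⟩ := hcompact.exists_bound_of_continuousOn hcontF'
  have hcontF : ∀ t : ℝ, |t| < ε → ContinuousOn (fun y => w y * Φ t y) U := by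
    intro t ht
    refine hw.mul fun y hy => ContinuousAt.continuousWithinAt ?_
    exact ContinuousAt.comp (g := fun q : ℝ × 𝔼 => Φ q.1 q.2) (f := fun y => (t, y))
      (hΦ t ht y hy).continuousAt (Continuous.prodMk_right t).continuousAt
  have hset : ∀ f : 𝔼 → ℝ, ∫ y in U, w y * f y = ∫ y in K, w y * f y := fun f =>
    setIntegral_eq_of_subset_of_forall_sdiff_eq_zero hU.measurableSet hKU
      fun y hy => by rw [hw0 y hy, zero_mul]
  simp only [hset]
  have hmem : Icc (-(ε / 2)) (ε / 2) ∈ 𝓝 (0 : ℝ) := Icc_mem_nhds (by linarith) (by linarith)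
  have h0 : |(0 : ℝ)| < ε := by simpa using hε
  have h := (hasDerivAt_integral_of_dominated_loc_of_deriv_le (μ := volume.restrict K)
    (F := fun t y => w y * Φ t y) (F' := fun t y => w y * D (t, y)) (bound := fun _ => B)
    hmem ?_ ?_ ?_ ?_ ?_ ?_).2
  · refine h.congr_deriv (setIntegral_congr_fun hK.measurableSet fun y hy => ?_)
    rw [(hder 0 h0 y (hKU hy)).unique (hΦ' y (hKU hy))]
  · filter_upwards [hmem] with t ht
    exact ((hcontF t (hε2 t ht)).mono hKU).aestronglyMeasurable hK.measurableSet
  · exact ((hcontF 0 h0).mono hKU).integrableOn_compact hK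
  · refine ContinuousOn.aestronglyMeasurable ?_ hK.measurableSet
    exact hcontF'.comp (f := fun y : 𝔼 => ((0 : ℝ), y)) (Continuous.prodMk_right 0).continuousOn
      fun y hy => ⟨mem_of_mem_nhds hmem, hy⟩
  · refine (ae_restrict_iff' hK.measurableSet).2 (Filter.Eventually.of_forall fun y hy t ht => ?_)
    exact hB (t, y) ⟨ht, hy⟩
  · exact (continuousOn_const (c := B)).integrableOn_compact hK
  · refine (ae_restrict_iff' hK.measurableSet).2 (Filter.Eventually.of_forall fun y hy t ht => ?_)
    exact (hder t (hε2 t ht) y (hKU hy)).const_mul (w y)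

lemma setIntegral_pos_of_pos_at {f : 𝔼 → ℝ} (hU : IsOpen U) (hK : IsCompact K)
    (hKU : K ⊆ U) (hf : ContinuousOn f U) (hf0 : ∀ y ∈ U \ K, f y = 0)
    (hpos : ∀ y ∈ U, 0 ≤ f y) {y : 𝔼} (hy : y ∈ U) (hfy : 0 < f y) : 0 < ∫ y in U, f y := by
  rw [setIntegral_pos_iff_support_of_nonneg_ae
    ((ae_restrict_iff' hU.measurableSet).2 (Filter.Eventually.of_forall hpos))
    (integrableOn_of_eq_zero_off_compact hU hK hKU hf hf0)]
  have h1 : ∀ᶠ z in 𝓝 y, 0 < f z ∧ z ∈ U :=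
    ((hf.continuousAt (hU.mem_nhds hy)).eventually (lt_mem_nhds hfy)).and (hU.mem_nhds hy)
  refine MeasureTheory.Measure.measure_pos_of_mem_nhds _ (x := y) ?_
  filter_upwards [h1] with z hz
  exact ⟨hz.1.ne', hz.2⟩

/-- In coordinates, `∫ δR dv = - c ∫ tr_G H dv` for a compactly supported variation `H` of a metric
with `Ric = c G`. -/
lemma integral_dScal {G H : 𝔼 → Matrix (Fin n) (Fin n) ℝ} {c : ℝ} (hU : IsOpen U)
    (hK : IsCompact K) (hKU : K ⊆ U) (hG : ∀ y ∈ U, IsMetricNear G y)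
    (hpos : ∀ y ∈ U, 0 < (G y).det) (hH : ∀ y ∈ U, IsSymNear H y)
    (hH0 : ∀ y ∈ U \ K, H y = 0) (hRic : ∀ y ∈ U, ricciMatrix G y = c • G y) :
    ∫ y in U, dScal G H y * √(G y).det
      = -c * ∫ y in U, ((G y)⁻¹ * H y).trace * √(G y).det := by
  have hHev : ∀ y ∈ U \ K, H =ᶠ[𝓝 y] 0 := fun y hy => by
    filter_upwards [(hU.sdiff hK.isClosed).mem_nhds hy] with z hz
    exact hH0 z hz
  -- The divergence part is the divergence of a compactly supported field on the whole space.
  set F : Fin n → 𝔼 → ℝ := fun k => U.indicator (palatiniField G H k) with hF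
  have hF0 : ∀ k, ∀ y ∉ K, F k y = 0 := by
    intro k y hy
    by_cases hyU : y ∈ U
    · have h0 := fun k i j => dChr_eq_zero (G := G) (hHev y ⟨hyU, hy⟩) k i j
      simp [hF, hyU, palatiniField, h0]
    · simp [hF, hyU]
  have hFU : ∀ k, ∀ y ∈ U, F k =ᶠ[𝓝 y] palatiniField G H k := by
    intro k y hy
    filter_upwards [hU.mem_nhds hy] with z hz
    simp [hF, hz]
  have hFs : ∀ k, ContDiff ℝ 1 (F k) := by
    intro k
    rw [contDiff_iff_contDiffAt]
    intro y
    by_cases hy : y ∈ U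
    · exact ((contDiffAt_palatiniField (hG y hy) (hH y hy) k).of_le
        (by norm_cast)).congr_of_eventuallyEq (hFU k y hy)
    · have : F k =ᶠ[𝓝 y] fun _ => (0 : ℝ) := by
        filter_upwards [hK.isClosed.isOpen_compl.mem_nhds fun h => hy (hKU h)] with z hz
        exact hF0 k z hz
      exact contDiffAt_const.congr_of_eventuallyEq this
  have hFc : ∀ k, HasCompactSupport (F k) := fun k => HasCompactSupport.intro hK (hF0 k)
  have hFd : ∀ k, ∀ y ∉ U, partialDeriv k (F k) y = 0 := by
    intro k y hy
    have : F k =ᶠ[𝓝 y] fun _ => (0 : ℝ) := by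
      filter_upwards [hK.isClosed.isOpen_compl.mem_nhds fun h => hy (hKU h)] with z hz
      exact hF0 k z hz
    rw [partialDeriv_congr this]
    simp [partialDeriv]
  have hFi : ∀ k, Integrable fun y => partialDeriv k (F k) y := fun k =>
    (((hFs k).continuous_fderiv one_ne_zero).clm_apply
      continuous_const).integrable_of_hasCompactSupport
      (((hFc k).fderiv ℝ).mono fun y hy h => hy (by simp [h]))
  have hFint : ∀ k, ∫ y in U, partialDeriv k (F k) y = 0 := by
    intro k
    rw [setIntegral_eq_integral_of_forall_compl_eq_zero (hFd k)]
    exact integral_partialDeriv_eq_zero (hFs k) (hFc k) k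
  have hpt : ∀ y ∈ U, dScal G H y * √(G y).det
      = -c * (((G y)⁻¹ * H y).trace * √(G y).det) + ∑ k, partialDeriv k (F k) y := by
    intro y hy
    have h1 : ∑ k, partialDeriv k (F k) y
        = √(G y).det * ∑ i, ∑ j, (G y)⁻¹ i j * dRic G H y i j := by
      rw [← sum_partialDeriv_palatiniField (hG y hy) (hH y hy) (hpos y hy)]
      exact Finset.sum_congr rfl fun k _ => partialDeriv_congr (hFU k y hy) k
    have h2 : ∑ i, ∑ j, (-((G y)⁻¹ * H y * (G y)⁻¹)) i j * ricciMatrix G y i j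
        = -c * ((G y)⁻¹ * H y).trace := by
      have e1 : ∀ A : Matrix (Fin n) (Fin n) ℝ, ∑ i, ∑ j, A i j * G y i j = (A * G y).trace := by
        intro A
        simp only [Matrix.trace, Matrix.diag, Matrix.mul_apply]
        exact Finset.sum_congr rfl fun i _ => Finset.sum_congr rfl fun j _ => by
          rw [(hG y hy).apply_comm]
      rw [hRic y hy]
      have e2 : ∀ i j, (-((G y)⁻¹ * H y * (G y)⁻¹)) i j * (c • G y) i j
          = -c * (((G y)⁻¹ * H y * (G y)⁻¹) i j * G y i j) := fun i j => by
        simp only [Matrix.neg_apply, Matrix.smul_apply, smul_eq_mul]; ring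
      simp only [e2, ← Finset.mul_sum]
      rw [e1, Matrix.mul_assoc, (hG y hy).inv_mul, Matrix.mul_one]
    rw [h1]
    simp only [dScal, Finset.sum_add_distrib]
    rw [h2]
    ring
  have htr : IntegrableOn (fun y => ((G y)⁻¹ * H y).trace * √(G y).det) U := by
    refine integrableOn_of_eq_zero_off_compact hU hK hKU ?_ ?_
    · intro y hy
      refine ContinuousAt.continuousWithinAt (ContDiffAt.continuousAt (n := ∞) (𝕜 := ℝ) ?_)
      refine ContDiffAt.mul ?_ (contDiffAt_sqrt_det (hG y hy))
      simp only [Matrix.trace, Matrix.diag, Matrix.mul_apply]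
      exact ContDiffAt.sum fun i _ => ContDiffAt.sum fun j _ =>
        ((hG y hy).contDiffAt_inv_apply i j).mul ((hH y hy).smooth j i)
    · intro y hy
      simp [hH0 y hy]
  rw [setIntegral_congr_fun hU.measurableSet hpt, integral_add (htr.const_mul _)
    (integrable_finsetSum _ fun k _ => (hFi k).integrableOn),
    integral_finsetSum _ fun k _ => (hFi k).integrableOn, integral_const_mul]
  simp [hFint]

end CoordinateIntegrals

/-! ### Curvature quantities under a change of coordinates -/

section Pullback

variable {n : ℕ}

local notation "𝔼" => EuclideanSpace ℝ (Fin n)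

variable {G G' H H' : EuclideanSpace ℝ (Fin n) → Matrix (Fin n) (Fin n) ℝ}
  {φ : EuclideanSpace ℝ (Fin n) → EuclideanSpace ℝ (Fin n)} {y : EuclideanSpace ℝ (Fin n)}

lemma IsMetricNear.det_jacMatrix_ne_zero (hG' : IsMetricNear G' y)
    (h : IsPullbackNear G' G φ y) : (jacMatrix φ y).det ≠ 0 := by
  intro h0
  apply hG'.det_ne_zero
  rw [h.self_of_nhds, Matrix.det_mul, h0, mul_zero]

/-- The endomorphisms `G⁻¹ T` of two related tensors are conjugate under the Jacobian. -/
lemma inv_mul_pullback {A B J : Matrix (Fin n) (Fin n) ℝ} (hJ : J.det ≠ 0) :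
    (J.transpose * A * J)⁻¹ * (J.transpose * B * J) = J⁻¹ * (A⁻¹ * B) * J := by
  have h1 : (J.transpose)⁻¹ * J.transpose = 1 :=
    Matrix.nonsing_inv_mul _ (isUnit_iff_ne_zero.2 (by rwa [Matrix.det_transpose]))
  rw [Matrix.mul_inv_rev, Matrix.mul_inv_rev]
  calc _ = J⁻¹ * A⁻¹ * ((J.transpose)⁻¹ * J.transpose) * B * J := by
        simp only [Matrix.mul_assoc]
    _ = _ := by rw [h1, Matrix.mul_one]; simp only [Matrix.mul_assoc]

lemma trace_conj_eq {A J : Matrix (Fin n) (Fin n) ℝ} (hJ : J.det ≠ 0) :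
    (J⁻¹ * A * J).trace = A.trace := by
  rw [Matrix.trace_mul_comm, ← Matrix.mul_assoc,
    Matrix.mul_nonsing_inv _ (isUnit_iff_ne_zero.2 hJ), Matrix.one_mul]

lemma charpoly_conj_eq {A J : Matrix (Fin n) (Fin n) ℝ} (hJ : J.det ≠ 0) :
    (J⁻¹ * A * J).charpoly = A.charpoly := by
  rw [Matrix.charpoly_mul_comm, ← Matrix.mul_assoc,
    Matrix.mul_nonsing_inv _ (isUnit_iff_ne_zero.2 hJ), Matrix.one_mul]

lemma trace_inv_mul_pullback (hG' : IsMetricNear G' y) (h : IsPullbackNear G' G φ y)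
    (h2 : IsPullbackNear H' H φ y) :
    ((G' y)⁻¹ * H' y).trace = ((G (φ y))⁻¹ * H (φ y)).trace := by
  have hJ := hG'.det_jacMatrix_ne_zero h
  rw [h.self_of_nhds, h2.self_of_nhds, inv_mul_pullback hJ, trace_conj_eq hJ]

lemma scalarCurv_eq_trace (hG : IsMetricNear G y) :
    scalarCurv G y = ((G y)⁻¹ * ricciMatrix G y).trace := by
  simp only [scalarCurv, Matrix.trace, Matrix.diag, Matrix.mul_apply]
  exact Finset.sum_congr rfl fun i _ => Finset.sum_congr rfl fun j _ => by
    rw [hG.ricciMatrix_isSymm.apply]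

lemma scalarCurv_pullback (hφ : ∀ᶠ z in 𝓝 y, ContDiffAt ℝ ∞ φ z)
    (hG : IsMetricNear G (φ y)) (hG' : IsMetricNear G' y) (h : IsPullbackNear G' G φ y) :
    scalarCurv G' y = scalarCurv G (φ y) := by
  have hJ := hG'.det_jacMatrix_ne_zero h
  rw [scalarCurv_eq_trace hG, scalarCurv_eq_trace hG', ricciMatrix_pullback hφ hG hG' h,
    h.self_of_nhds, inv_mul_pullback hJ, trace_conj_eq hJ]

lemma sigmaCoord_pullback (k : ℕ) (hφ : ∀ᶠ z in 𝓝 y, ContDiffAt ℝ ∞ φ z)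
    (hG : IsMetricNear G (φ y)) (hG' : IsMetricNear G' y) (h : IsPullbackNear G' G φ y) :
    sigmaCoord k G' y = sigmaCoord k G (φ y) := by
  have hJ := hG'.det_jacMatrix_ne_zero h
  have hS : schoutenMatrix G' y
      = (jacMatrix φ y).transpose * schoutenMatrix G (φ y) * jacMatrix φ y := by
    unfold schoutenMatrix
    rw [scalarCurv_pullback hφ hG hG' h, ricciMatrix_pullback hφ hG hG' h, h.self_of_nhds,
      Matrix.mul_sub, Matrix.sub_mul, Matrix.mul_smul, Matrix.smul_mul]
  unfold sigmaCoord
  rw [hS, h.self_of_nhds, inv_mul_pullback hJ, charpoly_conj_eq hJ]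

lemma IsPullbackNear.lineFamily (h : IsPullbackNear G' G φ y) (h2 : IsPullbackNear H' H φ y)
    (t : ℝ) : IsPullbackNear (lineFamily G' H' t) (lineFamily G H t) φ y := by
  filter_upwards [h, h2] with z h3 h4
  unfold TotalSigma.lineFamily
  rw [h3, h4, Matrix.mul_add, Matrix.add_mul, Matrix.mul_smul, Matrix.smul_mul]

lemma eventually_isMetricNear_lineFamily (hG : IsMetricNear G y) (hH : IsSymNear H y) :
    ∀ᶠ t in 𝓝 (0 : ℝ), IsMetricNear (lineFamily G H t) y := by
  have h1 : ContinuousAt (fun t => (lineFamily G H t y).det) 0 :=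
    (hasDerivAt_det fun i j => hasDerivAt_lineFamily y i j 0).continuousAt
  have h2 : ∀ᶠ t in 𝓝 (0 : ℝ), (lineFamily G H t y).det ≠ 0 :=
    h1.eventually_ne (by simpa using hG.det_ne_zero)
  filter_upwards [h2] with t ht
  exact isMetricNear_lineFamily hG.isSymNear hH ht

/-- The first variation of the scalar curvature is a scalar, as the derivative of a scalar. -/
lemma dScal_pullback (hφ : ∀ᶠ z in 𝓝 y, ContDiffAt ℝ ∞ φ z)
    (hG : IsMetricNear G (φ y)) (hG' : IsMetricNear G' y) (h : IsPullbackNear G' G φ y)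
    (hH : IsSymNear H (φ y)) (hH' : IsSymNear H' y) (h2 : IsPullbackNear H' H φ y) :
    dScal G' H' y = dScal G H (φ y) := by
  refine (hasDerivAt_scalarCurv hG' hH').unique
    ((hasDerivAt_scalarCurv hG hH).congr_of_eventuallyEq ?_)
  filter_upwards [eventually_isMetricNear_lineFamily hG hH,
    eventually_isMetricNear_lineFamily hG' hH'] with t h3 h4
  exact scalarCurv_pullback hφ h3 h4 (h.lineFamily h2 t)

end Pullback

/-! ### Tensor fields in charts -/

section Charts

variable {n : ℕ} {M : Type*} [TopologicalSpace M] [ChartedSpace (EuclideanSpace ℝ (Fin n)) M]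
  [IsManifold (𝓡 n) ∞ M]

local notation "𝔼" => EuclideanSpace ℝ (Fin n)

/-- A symmetric tensor field that is smooth in the preferred charts. -/
structure IsSmoothSym (h : TwoTensorField n M) : Prop where
  smooth : ∀ (p : M) (i j : Fin n),
    ContDiffOn ℝ ∞ (fun y => coordMatrix h (chartAt 𝔼 p) y i j) (chartAt 𝔼 p).target
  symm : ∀ (x : M) (v w : TangentSpace (𝓡 n) x), h x v w = h x w v

/-- A Riemannian metric that is smooth in the preferred charts. -/
structure IsSmoothMetric (g : TwoTensorField n M) : Prop extends IsSmoothSym g where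
  pos : IsPositive g

lemma contMDiffOn_coordVector (p : M) (i : Fin n) :
    ContMDiffOn (𝓡 n) (𝓡 n).tangent ∞ (fun y : 𝔼 => (Bundle.TotalSpace.mk' 𝔼
      ((chartAt 𝔼 p).symm y) (coordVector (chartAt 𝔼 p) y i) : TangentBundle (𝓡 n) M))
      (chartAt 𝔼 p).target := by
  have h1 : ContMDiffOn (𝓡 n) (𝓡 n) ∞ (chartAt 𝔼 p).symm (chartAt 𝔼 p).target :=
    contMDiffOn_chart_symm
  have h2 := h1.contMDiffOn_tangentMapWithin (m := ∞) (by simp)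
    (chartAt 𝔼 p).open_target.uniqueMDiffOn
  have h3 : ContMDiff (𝓡 n) (𝓡 n).tangent ∞
      (fun y : 𝔼 => (⟨y, (basisVec i : 𝔼)⟩ : TangentBundle (𝓡 n) 𝔼)) :=
    contMDiff_vectorSpace_iff_contDiff.2 contDiff_const
  refine (h2.comp h3.contMDiffOn (fun y hy => hy)).congr fun y hy => ?_
  simp only [Function.comp_apply, tangentMapWithin,
    mfderivWithin_of_isOpen (chartAt 𝔼 p).open_target hy]
  rfl

lemma contDiffOn_coordMatrix {h : TwoTensorField n M} (hh : ContMDiff (𝓡 n)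
    ((𝓡 n).prod 𝓘(ℝ, EuclideanSpace ℝ (Fin n) →L[ℝ] EuclideanSpace ℝ (Fin n) →L[ℝ] ℝ)) ∞
    (fun x : M => Bundle.TotalSpace.mk'
      (EuclideanSpace ℝ (Fin n) →L[ℝ] EuclideanSpace ℝ (Fin n) →L[ℝ] ℝ) x (h x))) (p : M)
    (i j : Fin n) :
    ContDiffOn ℝ ∞ (fun y => coordMatrix h (chartAt 𝔼 p) y i j) (chartAt 𝔼 p).target := by
  have h1 : ContMDiffOn (𝓡 n) (𝓡 n) ∞ (chartAt 𝔼 p).symm (chartAt 𝔼 p).target :=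
    contMDiffOn_chart_symm
  have h2 := hh.comp_contMDiffOn h1
  have h3 := ContMDiffOn.clm_bundle_apply₂ (E₃ := Bundle.Trivial M ℝ) (F₃ := ℝ) h2
    (contMDiffOn_coordVector p i) (contMDiffOn_coordVector p j)
  intro y hy
  have h4 := h3 y hy
  rw [Bundle.contMDiffWithinAt_totalSpace] at h4
  exact h4.2.contDiffWithinAt

end Charts

section ChartChange

variable {n : ℕ} {M : Type*} [TopologicalSpace M] [ChartedSpace (EuclideanSpace ℝ (Fin n)) M]

local notation "𝔼" => EuclideanSpace ℝ (Fin n)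

/-- The transition map from the preferred chart at `p` to the preferred chart at `q`. -/
def transition (p q : M) (y : 𝔼) : 𝔼 := chartAt 𝔼 q ((chartAt 𝔼 p).symm y)

/-- The domain of the transition map, in the coordinates of the chart at `p`. -/
def overlap (p q : M) : Set 𝔼 :=
  (chartAt 𝔼 p).target ∩ (chartAt 𝔼 p).symm ⁻¹' (chartAt 𝔼 q).source

lemma isOpen_overlap (p q : M) : IsOpen (overlap p q : Set 𝔼) :=
  (chartAt 𝔼 p).isOpen_inter_preimage_symm (chartAt 𝔼 q).open_source

lemma transition_mem {p q : M} {y : 𝔼} (hy : y ∈ overlap p q) : transition p q y ∈ overlap q p := by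
  refine ⟨(chartAt 𝔼 q).map_source hy.2, ?_⟩
  simp only [transition, Set.mem_preimage, (chartAt 𝔼 q).left_inv hy.2]
  exact (chartAt 𝔼 p).map_target hy.1

lemma symm_transition {p q : M} {y : 𝔼} (hy : y ∈ overlap p q) :
    (chartAt 𝔼 q).symm (transition p q y) = (chartAt 𝔼 p).symm y :=
  (chartAt 𝔼 q).left_inv hy.2

lemma transition_transition {p q : M} {y : 𝔼} (hy : y ∈ overlap p q) :
    transition q p (transition p q y) = y := by
  unfold transition
  rw [(chartAt 𝔼 q).left_inv hy.2, (chartAt 𝔼 p).right_inv hy.1]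

lemma injOn_transition (p q : M) : Set.InjOn (transition p q) (overlap p q : Set 𝔼) :=
  Set.LeftInvOn.injOn (f₁' := transition q p) fun _ hy => transition_transition hy

lemma image_transition (p q : M) : transition p q '' (overlap p q : Set 𝔼) = overlap q p := by
  ext z
  constructor
  · rintro ⟨y, hy, rfl⟩
    exact transition_mem hy
  · intro hz
    exact ⟨transition q p z, transition_mem hz, transition_transition hz⟩

section Tensors

variable {h h' : TwoTensorField n M} {p : M} {y : EuclideanSpace ℝ (Fin n)}

lemma IsSmoothSym.isSymNear (hh : IsSmoothSym h) (hy : y ∈ (chartAt 𝔼 p).target) :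
    IsSymNear (coordMatrix h (chartAt 𝔼 p)) y := by
  filter_upwards [(chartAt 𝔼 p).open_target.mem_nhds hy] with z hz
  exact ⟨fun i j => (hh.smooth p i j).contDiffAt ((chartAt 𝔼 p).open_target.mem_nhds hz),
    Matrix.IsSymm.ext fun i j => hh.symm _ _ _⟩

lemma coordMatrix_add_smul (t : ℝ) :
    coordMatrix (h + t • h') (chartAt 𝔼 p)
      = lineFamily (coordMatrix h (chartAt 𝔼 p)) (coordMatrix h' (chartAt 𝔼 p)) t := rfl

lemma coordMatrix_smul (ρ : M → ℝ) (y : 𝔼) :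
    coordMatrix (fun x => ρ x • h x : TwoTensorField n M) (chartAt 𝔼 p) y
      = ρ ((chartAt 𝔼 p).symm y) • coordMatrix h (chartAt 𝔼 p) y := rfl

lemma IsSmoothSym.add (hh : IsSmoothSym h) (hh' : IsSmoothSym h') : IsSmoothSym (h + h') where
  smooth p i j := (hh.smooth p i j).add (hh'.smooth p i j)
  symm x v w := congrArg₂ (· + ·) (hh.symm x v w) (hh'.symm x v w)

lemma IsSmoothSym.const_smul (hh : IsSmoothSym h) (t : ℝ) : IsSmoothSym (t • h) where
  smooth p i j := contDiffOn_const.mul (hh.smooth p i j)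
  symm x v w := congrArg (t * ·) (hh.symm x v w)

lemma isSmoothSym_zero : IsSmoothSym (0 : TwoTensorField n M) where
  smooth _ _ _ := contDiffOn_const (c := 0)
  symm _ _ _ := rfl

lemma mem_overlap (x : M) (hx : x ∈ (chartAt 𝔼 p).source) : chartAt 𝔼 x x ∈ overlap x p := by
  refine ⟨(chartAt 𝔼 x).map_source (mem_chart_source 𝔼 x), ?_⟩
  rwa [Set.mem_preimage, (chartAt 𝔼 x).left_inv (mem_chart_source 𝔼 x)]

lemma transition_self (x : M) : transition x p (chartAt 𝔼 x x) = chartAt 𝔼 p x := by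
  unfold transition
  rw [(chartAt 𝔼 x).left_inv (mem_chart_source 𝔼 x)]

/-- The quadratic form of `g` on a tangent vector with coordinates `u`. -/
lemma apply_mfderiv_symm (g : TwoTensorField n M) (p : M) (y u : 𝔼) :
    (g ((chartAt 𝔼 p).symm y) : 𝔼 →L[ℝ] 𝔼 →L[ℝ] ℝ)
        ((mfderiv (𝓡 n) (𝓡 n) (chartAt 𝔼 p).symm y : 𝔼 →L[ℝ] 𝔼) u)
        ((mfderiv (𝓡 n) (𝓡 n) (chartAt 𝔼 p).symm y : 𝔼 →L[ℝ] 𝔼) u)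
      = ∑ i, ∑ j, coordMatrix g (chartAt 𝔼 p) y i j * (u i * u j) := by
  set D : 𝔼 →L[ℝ] 𝔼 := mfderiv (𝓡 n) (𝓡 n) (chartAt 𝔼 p).symm y with hD
  set B : 𝔼 →L[ℝ] 𝔼 →L[ℝ] ℝ := g ((chartAt 𝔼 p).symm y) with hB
  have hx : u = ∑ k, u k • basisVec k := by
    ext i
    simp [Finset.sum_apply, Pi.single_apply]
  have h2 : ∀ a b, coordMatrix g (chartAt 𝔼 p) y a b
    = B (D (basisVec a)) (D (basisVec b)) := fun a b => rfl
  have h3 : ∀ c : Fin n → ℝ, B (D (∑ k, c k • basisVec k)) (D (∑ k, c k • basisVec k))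
      = ∑ i, ∑ j, B (D (basisVec i)) (D (basisVec j)) * (c i * c j) := by
    intro c
    simp only [map_sum, map_smul, sum_apply, smul_apply, smul_eq_mul, Finset.mul_sum]
    rw [Finset.sum_comm]
    refine Finset.sum_congr rfl fun a _ => Finset.sum_congr rfl fun b _ => ?_
    ring
  simp only [h2]
  rw [← h3, ← hx]
  rfl

end Tensors

variable [IsManifold (𝓡 n) ∞ M]

lemma contDiffAt_transition {p q : M} {y : 𝔼} (hy : y ∈ overlap p q) :
    ContDiffAt ℝ ∞ (transition p q) y := by
  have h1 : ContMDiffOn (𝓡 n) (𝓡 n) ∞ (chartAt 𝔼 p).symm (chartAt 𝔼 p).target :=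
    contMDiffOn_chart_symm
  have h2 : ContMDiffOn (𝓡 n) (𝓡 n) ∞ (chartAt 𝔼 q) (chartAt 𝔼 q).source :=
    contMDiffOn_chart
  have h3 : ContMDiffOn (𝓡 n) (𝓡 n) ∞ (transition p q) (overlap p q) :=
    h2.comp (h1.mono fun _ hz => hz.1) fun _ hz => hz.2
  exact (h3.contDiffOn).contDiffAt ((isOpen_overlap p q).mem_nhds hy)

lemma mfderiv_symm_eq {p q : M} {y : 𝔼} (hy : y ∈ overlap p q) :
    (mfderiv (𝓡 n) (𝓡 n) (chartAt 𝔼 p).symm y : 𝔼 →L[ℝ] 𝔼)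
      = (mfderiv (𝓡 n) (𝓡 n) (chartAt 𝔼 q).symm (transition p q y) : 𝔼 →L[ℝ] 𝔼).comp
        (fderiv ℝ (transition p q) y) := by
  have h1 : ((chartAt 𝔼 p).symm : 𝔼 → M) =ᶠ[𝓝 y] (chartAt 𝔼 q).symm ∘ transition p q := by
    filter_upwards [(isOpen_overlap p q).mem_nhds hy] with z hz
    exact (symm_transition hz).symm
  have h2 : MDifferentiableAt (𝓡 n) (𝓡 n) (transition p q) y :=
    ((contDiffAt_transition hy).differentiableAt (by simp)).mdifferentiableAt
  have h3 : MDifferentiableAt (𝓡 n) (𝓡 n) (chartAt 𝔼 q).symm (transition p q y) :=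
    mdifferentiableAt_atlas_symm (chart_mem_atlas 𝔼 q) (transition_mem hy).1
  have h4 := h1.mfderiv_eq (I := 𝓡 n) (I' := 𝓡 n)
  have h5 := mfderiv_comp y h3 h2
  rw [mfderiv_eq_fderiv] at h5
  exact h4.trans h5

lemma coordMatrix_pullback (h : TwoTensorField n M) {p q : M} {y : 𝔼} (hy : y ∈ overlap p q) :
    coordMatrix h (chartAt 𝔼 p) y = (jacMatrix (transition p q) y).transpose
      * coordMatrix h (chartAt 𝔼 q) (transition p q y) * jacMatrix (transition p q) y := by
  have hcong : ∀ (x x' : M) (_ : x = x') (u v : 𝔼),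
      (h x : 𝔼 →L[ℝ] 𝔼 →L[ℝ] ℝ) u v = (h x' : 𝔼 →L[ℝ] 𝔼 →L[ℝ] ℝ) u v := by
    rintro x _ rfl u v
    rfl
  set D : 𝔼 →L[ℝ] 𝔼 := mfderiv (𝓡 n) (𝓡 n) (chartAt 𝔼 q).symm (transition p q y) with hD
  set J : 𝔼 →L[ℝ] 𝔼 := fderiv ℝ (transition p q) y with hJ
  set B : 𝔼 →L[ℝ] 𝔼 →L[ℝ] ℝ := h ((chartAt 𝔼 q).symm (transition p q y)) with hB
  have hx : ∀ u : 𝔼, u = ∑ k, u k • basisVec k := by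
    intro u
    ext i
    simp [Finset.sum_apply, Pi.single_apply]
  have hJe : ∀ i, J (basisVec i) = ∑ a, jacMatrix (transition p q) y a i • basisVec a :=
    fun i => hx _
  ext i j
  have h1 : coordMatrix h (chartAt 𝔼 p) y i j = B (D (J (basisVec i))) (D (J (basisVec j))) := by
    have e1 : ∀ k, (coordVector (chartAt 𝔼 p) y k : 𝔼) = D (J (basisVec k)) := fun k =>
      DFunLike.congr_fun (mfderiv_symm_eq hy) (basisVec k)
    have e2 := hcong _ _ (symm_transition hy).symm (coordVector (chartAt 𝔼 p) y i)
      (coordVector (chartAt 𝔼 p) y j)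
    rw [e1, e1] at e2
    refine Eq.trans ?_ e2
    rw [← e1, ← e1]
    rfl
  have h2 : ∀ a b, coordMatrix h (chartAt 𝔼 q) (transition p q y) a b
      = B (D (basisVec a)) (D (basisVec b)) := fun a b => rfl
  rw [h1, hJe, hJe]
  simp only [Matrix.mul_apply, Matrix.transpose_apply, h2, map_sum, map_smul, sum_apply,
    smul_apply, smul_eq_mul, Finset.mul_sum, Finset.sum_mul]
  exact Finset.sum_congr rfl fun a _ => Finset.sum_congr rfl fun b _ => by ring

lemma isPullbackNear_coordMatrix (h : TwoTensorField n M) {p q : M} {y : 𝔼}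
    (hy : y ∈ overlap p q) : IsPullbackNear (coordMatrix h (chartAt 𝔼 p))
      (coordMatrix h (chartAt 𝔼 q)) (transition p q) y := by
  filter_upwards [(isOpen_overlap p q).mem_nhds hy] with z hz
  exact coordMatrix_pullback h hz

lemma eventually_contDiffAt_transition {p q : M} {y : 𝔼} (hy : y ∈ overlap p q) :
    ∀ᶠ z in 𝓝 y, ContDiffAt ℝ ∞ (transition p q) z := by
  filter_upwards [(isOpen_overlap p q).mem_nhds hy] with z hz
  exact contDiffAt_transition hz

section Tensors

variable {g h h' : TwoTensorField n M} {p : M} {y : EuclideanSpace ℝ (Fin n)}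

lemma IsSmoothMetric.posDef (hg : IsSmoothMetric g) (hy : y ∈ (chartAt 𝔼 p).target) :
    (coordMatrix g (chartAt 𝔼 p) y).PosDef := by
  refine Matrix.PosDef.of_dotProduct_mulVec_pos ?_ fun v hv => ?_
  · rw [Matrix.IsHermitian, Matrix.conjTranspose_eq_transpose_of_trivial]
    exact Matrix.IsSymm.ext fun i j => hg.symm _ _ _
  · have hinj :=
      (mdifferentiable_of_mem_atlas (I := 𝓡 n) (chart_mem_atlas 𝔼 p)).symm.mfderiv_injective hy
    have hu : (WithLp.toLp 2 v : 𝔼) ≠ 0 := fun h0 => hv (by simpa using congrArg WithLp.ofLp h0)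
    refine lt_of_lt_of_eq (hg.pos _ _ fun h0 => hu (hinj (h0.trans (map_zero _).symm)))
      ((apply_mfderiv_symm g p y (WithLp.toLp 2 v)).trans ?_)
    simp only [dotProduct, Matrix.mulVec, Finset.mul_sum, star_trivial]
    refine Finset.sum_congr rfl fun a _ => Finset.sum_congr rfl fun b _ => ?_
    ring

lemma IsSmoothMetric.det_pos (hg : IsSmoothMetric g) (hy : y ∈ (chartAt 𝔼 p).target) :
    0 < (coordMatrix g (chartAt 𝔼 p) y).det := (hg.posDef hy).det_pos

lemma IsSmoothMetric.isMetricNear (hg : IsSmoothMetric g) (hy : y ∈ (chartAt 𝔼 p).target) :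
    IsMetricNear (coordMatrix g (chartAt 𝔼 p)) y := by
  filter_upwards [(hg.toIsSmoothSym.isSymNear hy), (chartAt 𝔼 p).open_target.mem_nhds hy]
    with z h1 hz
  exact ⟨h1.1, h1.2, (hg.det_pos hz).ne'⟩

lemma contDiffOn_comp_symm {ρ : M → ℝ} (hρ : ContMDiff (𝓡 n) 𝓘(ℝ, ℝ) ∞ ρ) (p : M) :
    ContDiffOn ℝ ∞ (fun y => ρ ((chartAt 𝔼 p).symm y)) (chartAt 𝔼 p).target :=
  (hρ.comp_contMDiffOn (contMDiffOn_chart_symm (I := 𝓡 n) (n := ∞) (x := p))).contDiffOn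

lemma IsSmoothSym.smul (hh : IsSmoothSym h) {ρ : M → ℝ} (hρ : ContMDiff (𝓡 n) 𝓘(ℝ, ℝ) ∞ ρ) :
    IsSmoothSym (fun x => ρ x • h x : TwoTensorField n M) where
  smooth p i j := (contDiffOn_comp_symm hρ p).mul (hh.smooth p i j)
  symm x v w := congrArg (ρ x * ·) (hh.symm x v w)

lemma SymTwoTensor.isSmoothSym (h : SymTwoTensor n M) : IsSmoothSym h.form where
  smooth := contDiffOn_coordMatrix h.contMDiff
  symm := h.symm

lemma isSmoothMetric_of_rMetric (g : RMetric n M) : IsSmoothMetric g.inner where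
  smooth := contDiffOn_coordMatrix g.contMDiff
  symm := g.symm
  pos := g.pos

/-- The `σ_k`-curvature can be computed in any of the preferred charts. -/
lemma sigmaCurv_eq (k : ℕ) (hg : IsSmoothMetric g) {x : M} (hx : x ∈ (chartAt 𝔼 p).source) :
    sigmaCurv k g x = sigmaCoord k (coordMatrix g (chartAt 𝔼 p)) (chartAt 𝔼 p x) := by
  have hy := mem_overlap x hx
  have h1 := sigmaCoord_pullback k (eventually_contDiffAt_transition hy)
    (hg.isMetricNear (transition_mem hy).1) (hg.isMetricNear hy.1)
    (isPullbackNear_coordMatrix g hy)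
  rw [transition_self] at h1
  exact h1

/-- The first variation of the scalar curvature of `g` in the direction `h`. -/
def dScalField (g h : TwoTensorField n M) (x : M) : ℝ :=
  dScal (coordMatrix g (chartAt 𝔼 x)) (coordMatrix h (chartAt 𝔼 x)) (chartAt 𝔼 x x)

/-- The trace of `h` with respect to `g`. -/
def traceField (g h : TwoTensorField n M) (x : M) : ℝ :=
  ((coordMatrix g (chartAt 𝔼 x) (chartAt 𝔼 x x))⁻¹
    * coordMatrix h (chartAt 𝔼 x) (chartAt 𝔼 x x)).trace

lemma dScalField_eq (hg : IsSmoothMetric g) (hh : IsSmoothSym h) {x : M}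
    (hx : x ∈ (chartAt 𝔼 p).source) :
    dScalField g h x = dScal (coordMatrix g (chartAt 𝔼 p)) (coordMatrix h (chartAt 𝔼 p))
      (chartAt 𝔼 p x) := by
  have hy := mem_overlap x hx
  have h1 := dScal_pullback (eventually_contDiffAt_transition hy)
    (hg.isMetricNear (transition_mem hy).1) (hg.isMetricNear hy.1)
    (isPullbackNear_coordMatrix g hy) (hh.isSymNear (transition_mem hy).1) (hh.isSymNear hy.1)
    (isPullbackNear_coordMatrix h hy)
  rw [transition_self] at h1
  exact h1

lemma traceField_eq (hg : IsSmoothMetric g) {x : M} (hx : x ∈ (chartAt 𝔼 p).source) :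
    traceField g h x = ((coordMatrix g (chartAt 𝔼 p) (chartAt 𝔼 p x))⁻¹
      * coordMatrix h (chartAt 𝔼 p) (chartAt 𝔼 p x)).trace := by
  have hy := mem_overlap x hx
  have h1 := trace_inv_mul_pullback (hg.isMetricNear hy.1)
    (isPullbackNear_coordMatrix g hy) (isPullbackNear_coordMatrix h hy)
  rw [transition_self] at h1
  exact h1

/-- The Einstein equation holds in all preferred charts. -/
lemma IsEinstein.ricciMatrix_eq {lam : ℝ} (hE : IsEinstein g lam) (hg : IsSmoothMetric g)
    (hy : y ∈ (chartAt 𝔼 p).target) :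
    ricciMatrix (coordMatrix g (chartAt 𝔼 p)) y
      = (((n : ℝ) - 1) * lam) • coordMatrix g (chartAt 𝔼 p) y := by
  set x := (chartAt 𝔼 p).symm y with hx
  have hyo : y ∈ overlap p x := ⟨hy, mem_chart_source 𝔼 x⟩
  have h1 := ricciMatrix_pullback (eventually_contDiffAt_transition hyo)
    (hg.isMetricNear (transition_mem hyo).1) (hg.isMetricNear hyo.1)
    (isPullbackNear_coordMatrix g hyo)
  have h2 : transition p x y = chartAt 𝔼 x x := rfl
  rw [h1, coordMatrix_pullback g hyo, h2, hE x, Matrix.mul_smul, Matrix.smul_mul]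

end Tensors

end ChartChange

/-! ### Variation of the `σ_k`-curvature at an Einstein metric, in coordinates -/

section EinsteinCoordinates

variable {n : ℕ}

local notation "𝔼" => EuclideanSpace ℝ (Fin n)

variable {G H : EuclideanSpace ℝ (Fin n) → Matrix (Fin n) (Fin n) ℝ}
  {y : EuclideanSpace ℝ (Fin n)}

lemma contDiffAt_dScal (hG : IsMetricNear G y) (hH : IsSymNear H y) :
    ContDiffAt ℝ ∞ (dScal G H) y := by
  have hC := contDiffAt_dChr hG hH
  have hΓ := hG.contDiffAt_christoffel
  have hI := hG.contDiffAt_inv_apply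
  have hR : ∀ i j, ContDiffAt ℝ ∞ (fun z => ricciMatrix G z i j) y := fun i j =>
    contDiffAt_of_family (f := fun _ z => ricciMatrix G z i j) (t := 0)
      (contDiffAt_ricciMatrix_family (𝒢 := fun _ => G)
        (fun i j => contDiffAt_family_const (hG.smooth i j)) hG.det_ne_zero i j)
  have hd : ∀ i j, ContDiffAt ℝ ∞ (fun z => dRic G H z i j) y := by
    intro i j
    refine (((ContDiffAt.sum fun k _ => ?_).sub (ContDiffAt.sum fun k _ => ?_)).add
      (ContDiffAt.sum fun k _ => ContDiffAt.sum fun l _ => ?_)).sub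
      (ContDiffAt.sum fun k _ => ContDiffAt.sum fun l _ => ?_)
    · exact contDiffAt_partialDeriv (hC k i j) k
    · exact contDiffAt_partialDeriv (hC k i k) j
    · exact ((hC k k l).mul (hΓ l i j)).add ((hΓ k k l).mul (hC l i j))
    · exact ((hC k j l).mul (hΓ l i k)).add ((hΓ k j l).mul (hC l i k))
  refine ContDiffAt.sum fun i _ => ContDiffAt.sum fun j _ =>
    ContDiffAt.add (ContDiffAt.mul ?_ (hR i j)) ((hI i j).mul (hd i j))
  simp only [Matrix.neg_apply, Matrix.mul_apply]
  exact (ContDiffAt.sum fun a _ => (ContDiffAt.sum fun b _ =>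
    (hI i b).mul (hH.smooth b a)).mul (hI a j)).neg

lemma contDiffAt_trace_inv_mul (hG : IsMetricNear G y) (hH : IsSymNear H y) :
    ContDiffAt ℝ ∞ (fun z => ((G z)⁻¹ * H z).trace) y := by
  simp only [Matrix.trace, Matrix.diag, Matrix.mul_apply]
  exact ContDiffAt.sum fun i _ => ContDiffAt.sum fun j _ =>
    (hG.contDiffAt_inv_apply i j).mul (hH.smooth j i)

/-- For a positive definite metric the `σ_k`-curvature is a polynomial in the endomorphism
`G⁻¹ S`. -/
lemma sigmaCoord_eq_sigmaPoly {k : ℕ} (hk : k ≤ n) (hG : IsMetricNear G y) (hpos : (G y).PosDef) :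
    sigmaCoord k G y = sigmaPoly k ((G y)⁻¹ * schoutenMatrix G y) :=
  esymm_roots_charpoly (splits_charpoly_inv_mul hpos hG.schoutenMatrix_isSymm) (by simpa using hk)

lemma trace_inv_mul_schouten (hn : 2 ≤ n) (hG : IsMetricNear G y) :
    ((G y)⁻¹ * schoutenMatrix G y).trace
      = ((n : ℝ) - 2) / (2 * ((n : ℝ) - 1)) * scalarCurv G y := by
  have hn1 : (n : ℝ) - 1 ≠ 0 := by
    have : (2 : ℝ) ≤ n := by exact_mod_cast hn
    linarith
  rw [schoutenMatrix, Matrix.mul_sub, Matrix.trace_sub, ← scalarCurv_eq_trace hG, Matrix.mul_smul,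
    hG.inv_mul, Matrix.trace_smul, Matrix.trace_one, Fintype.card_fin, smul_eq_mul]
  field_simp
  ring

lemma inv_mul_schouten_of_einstein {lam : ℝ} (hn : 2 ≤ n) (hG : IsMetricNear G y)
    (hE : ricciMatrix G y = (((n : ℝ) - 1) * lam) • G y) :
    (G y)⁻¹ * schoutenMatrix G y = (((n : ℝ) - 2) * lam / 2) • (1 : Matrix (Fin n) (Fin n) ℝ) := by
  have hn1 : (n : ℝ) - 1 ≠ 0 := by
    have : (2 : ℝ) ≤ n := by exact_mod_cast hn
    linarith
  have hR : scalarCurv G y = ((n : ℝ) - 1) * lam * n := by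
    rw [scalarCurv_eq_trace hG, hE, Matrix.mul_smul, hG.inv_mul, Matrix.trace_smul,
      Matrix.trace_one, Fintype.card_fin, smul_eq_mul]
  rw [schoutenMatrix, hR, hE, ← sub_smul, Matrix.mul_smul, hG.inv_mul]
  congr 1
  field_simp
  ring

/-- First variation of `σ_k` at an Einstein metric. -/
lemma hasDerivAt_sigmaPoly_lineFamily {lam : ℝ} (hn : 2 ≤ n) (k : ℕ) (hG : IsMetricNear G y)
    (hH : IsSymNear H y) (hE : ricciMatrix G y = (((n : ℝ) - 1) * lam) • G y) :
    HasDerivAt (fun t => sigmaPoly k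
        ((lineFamily G H t y)⁻¹ * schoutenMatrix (lineFamily G H t) y))
      ((k * n.choose k / n : ℝ) * (((n : ℝ) - 2) * lam / 2) ^ (k - 1)
        * (((n : ℝ) - 2) / (2 * ((n : ℝ) - 1)) * dScal G H y)) 0 := by
  have : Nonempty (Fin n) := ⟨⟨0, by omega⟩⟩
  set A : ℝ → Matrix (Fin n) (Fin n) ℝ := fun t =>
    (lineFamily G H t y)⁻¹ * schoutenMatrix (lineFamily G H t) y with hA
  have hAs : ∀ i j, DifferentiableAt ℝ (fun t => A t i j) 0 := by
    intro i j
    have h1 := contDiffAt_inv_mul_schouten_family (𝒢 := lineFamily G H) (p := ((0 : ℝ), y))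
      (fun a b => contDiffAt_lineFamily hG.isSymNear hH a b) (by simpa using hG.det_ne_zero) i j
    exact (ContDiffAt.comp (f := fun t : ℝ => (t, y)) (0 : ℝ) h1
      (contDiffAt_id.prodMk contDiffAt_const)).differentiableAt (by simp)
  set A' : Matrix (Fin n) (Fin n) ℝ := Matrix.of fun i j => deriv (fun t => A t i j) 0 with hA'
  have hder : ∀ i j, HasDerivAt (fun t => A t i j) (A' i j) 0 := fun i j => (hAs i j).hasDerivAt
  have hA0 : A 0 = (((n : ℝ) - 2) * lam / 2) • 1 := by
    simp only [hA, lineFamily_zero]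
    exact inv_mul_schouten_of_einstein hn hG hE
  have htr : A'.trace = ((n : ℝ) - 2) / (2 * ((n : ℝ) - 1)) * dScal G H y := by
    have h1 : HasDerivAt (fun t => (A t).trace) A'.trace 0 :=
      HasDerivAt.fun_sum fun i _ => hder i i
    have h2 := (hasDerivAt_scalarCurv hG hH).const_mul (((n : ℝ) - 2) / (2 * ((n : ℝ) - 1)))
    refine h1.unique (h2.congr_of_eventuallyEq ?_)
    filter_upwards [eventually_isMetricNear_lineFamily hG hH] with t ht
    exact trace_inv_mul_schouten hn ht
  have h := hasDerivAt_sigmaPoly k hder hA0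
  rwa [htr, Fintype.card_fin] at h

lemma hasDerivAt_sqrt_det_lineFamily (hG : IsMetricNear G y) (hpos : 0 < (G y).det) :
    HasDerivAt (fun t => √(lineFamily G H t y).det)
      ((1 / 2) * ((G y)⁻¹ * H y).trace * √(G y).det) 0 := by
  have h1 := hasDerivAt_det_of_ne_zero (A := fun t => lineFamily G H t y) (A' := H y) (t := 0)
    (fun i j => hasDerivAt_lineFamily y i j 0) (by simpa using hG.det_ne_zero)
  have h2 := h1.sqrt (by simpa using hG.det_ne_zero)
  refine h2.congr_deriv ?_
  have h3 : √(G y).det ≠ 0 := (Real.sqrt_pos.2 hpos).ne'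
  simp only [lineFamily_zero]
  field_simp
  rw [Real.sq_sqrt hpos.le]
  ring

end EinsteinCoordinates

/-! ### Integration over the manifold -/

section GlobalIntegral

open MeasureTheory Set

variable {n : ℕ} {M : Type*} [TopologicalSpace M] [ChartedSpace (EuclideanSpace ℝ (Fin n)) M]

local notation "𝔼" => EuclideanSpace ℝ (Fin n)

section ChartIntegrals

variable {g h : TwoTensorField n M} {f f' : M → ℝ}

/-- The integral of `f` over the domain of the preferred chart at `p`. -/
def chartIntegral (p : M) (g : TwoTensorField n M) (f : M → ℝ) : ℝ :=
  ∫ y in (chartAt 𝔼 p).target, f ((chartAt 𝔼 p).symm y) * √(coordMatrix g (chartAt 𝔼 p) y).det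

/-- Continuity of a function, expressed in the preferred charts. -/
def IsChartContinuous (f : M → ℝ) : Prop :=
  ∀ p : M, ContinuousOn (fun y => f ((chartAt 𝔼 p).symm y)) (chartAt 𝔼 p).target

lemma isChartContinuous_of_continuous {f : M → ℝ} (hf : Continuous f) :
    IsChartContinuous (n := n) f := fun p => hf.comp_continuousOn (chartAt 𝔼 p).continuousOn_symm

lemma IsChartContinuous.mul (hf : IsChartContinuous (n := n) f)
    (hf' : IsChartContinuous (n := n) f') : IsChartContinuous (n := n) (fun x => f x * f' x) :=
  fun p => (hf p).mul (hf' p)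

lemma chartIntegral_const_mul (c : ℝ) (p : M) :
    chartIntegral p g (fun x => c * f x) = c * chartIntegral p g f := by
  unfold chartIntegral
  rw [← integral_const_mul]
  simp only [mul_assoc]

lemma det_fderiv_eq (φ : 𝔼 → 𝔼) (y : 𝔼) : (fderiv ℝ φ y).det = (jacMatrix φ y).det := by
  rw [ContinuousLinearMap.det, ← LinearMap.det_toMatrix (EuclideanSpace.basisFun (Fin n) ℝ).toBasis]
  congr 1

variable [IsManifold (𝓡 n) ∞ M]

lemma IsSmoothMetric.continuousOn_sqrt_det (hg : IsSmoothMetric g) (p : M) :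
    ContinuousOn (fun y => √(coordMatrix g (chartAt 𝔼 p) y).det) (chartAt 𝔼 p).target :=
  fun _ hy => (contDiffAt_sqrt_det (hg.isMetricNear hy)).continuousAt.continuousWithinAt

/-- Change of variables between two charts. -/
lemma chartIntegral_eq {p q : M}
    (hp : ∀ x ∉ (chartAt 𝔼 p).source, f x = 0) (hq : ∀ x ∉ (chartAt 𝔼 q).source, f x = 0) :
    chartIntegral p g f = chartIntegral q g f := by
  have hred : ∀ a b : M, (∀ x ∉ (chartAt 𝔼 b).source, f x = 0) → chartIntegral a g f
      = ∫ y in overlap a b,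
        f ((chartAt 𝔼 a).symm y) * √(coordMatrix g (chartAt 𝔼 a) y).det := by
    intro a b hb
    refine setIntegral_eq_of_subset_of_forall_sdiff_eq_zero
      (chartAt 𝔼 a).open_target.measurableSet (fun y hy => hy.1) fun y hy => ?_
    rw [hb _ fun h => hy.2 ⟨hy.1, h⟩, zero_mul]
  rw [hred p q hq, hred q p hp, ← image_transition p q,
    integral_image_eq_integral_abs_det_fderiv_smul volume (isOpen_overlap p q).measurableSet
      (fun y hy => ((contDiffAt_transition hy).differentiableAt
        (by simp)).hasFDerivAt.hasFDerivWithinAt) (injOn_transition p q)]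
  refine setIntegral_congr_fun (isOpen_overlap p q).measurableSet fun y hy => ?_
  have hd : (coordMatrix g (chartAt 𝔼 p) y).det = (jacMatrix (transition p q) y).det ^ 2
      * (coordMatrix g (chartAt 𝔼 q) (transition p q y)).det := by
    rw [coordMatrix_pullback g hy, Matrix.det_mul, Matrix.det_mul, Matrix.det_transpose]
    ring
  simp only [symm_transition hy, hd, det_fderiv_eq, smul_eq_mul]
  rw [Real.sqrt_mul (sq_nonneg _), Real.sqrt_sq_eq_abs]
  ring

lemma isChartContinuous_dScalField (hg : IsSmoothMetric g) (hh : IsSmoothSym h) :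
    IsChartContinuous (n := n) (dScalField g h) := by
  intro p
  have h1 : ContinuousOn (dScal (coordMatrix g (chartAt 𝔼 p)) (coordMatrix h (chartAt 𝔼 p)))
      (chartAt 𝔼 p).target := fun y hy =>
    (contDiffAt_dScal (hg.isMetricNear hy) (hh.isSymNear hy)).continuousAt.continuousWithinAt
  refine h1.congr fun y hy => ?_
  have h2 := dScalField_eq hg hh ((chartAt 𝔼 p).map_target hy)
  rwa [(chartAt 𝔼 p).right_inv hy] at h2

lemma isChartContinuous_traceField (hg : IsSmoothMetric g) (hh : IsSmoothSym h) :
    IsChartContinuous (n := n) (traceField g h) := by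
  intro p
  have h1 : ContinuousOn (fun y => ((coordMatrix g (chartAt 𝔼 p) y)⁻¹
      * coordMatrix h (chartAt 𝔼 p) y).trace) (chartAt 𝔼 p).target := fun y hy =>
    (contDiffAt_trace_inv_mul (hg.isMetricNear hy)
      (hh.isSymNear hy)).continuousAt.continuousWithinAt
  refine h1.congr fun y hy => ?_
  have h2 := traceField_eq (h := h) hg ((chartAt 𝔼 p).map_target hy)
  rwa [(chartAt 𝔼 p).right_inv hy] at h2

lemma dScalField_sum {ι : Type*} (s : Finset ι) (hg : IsSmoothMetric g)
    {h : ι → TwoTensorField n M} (hh : ∀ a, IsSmoothSym (h a)) (x : M) :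
    dScalField g (∑ a ∈ s, h a) x = ∑ a ∈ s, dScalField g (h a) x := by
  classical
  have hx : chartAt 𝔼 x x ∈ (chartAt 𝔼 x).target :=
    (chartAt 𝔼 x).map_source (mem_chart_source 𝔼 x)
  have hs : ∀ s : Finset ι, IsSmoothSym (∑ a ∈ s, h a) := by
    intro s
    induction s using Finset.induction_on with
    | empty => simpa using isSmoothSym_zero
    | insert a s ha ih => rw [Finset.sum_insert ha]; exact (hh a).add ih
  induction s using Finset.induction_on with
  | empty =>
    simp only [Finset.sum_empty]
    exact dScal_eq_zero (Filter.Eventually.of_forall fun _ => rfl)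
  | insert a s ha ih =>
    rw [Finset.sum_insert ha, Finset.sum_insert ha, ← ih]
    exact dScal_add (hg.isMetricNear hx) ((hh a).isSymNear hx) ((hs s).isSymNear hx)

end ChartIntegrals

variable [IsManifold (𝓡 n) ∞ M] [CompactSpace M] [T2Space M]

lemma chartPartition_tsupport_subset (p : M) :
    tsupport (chartPartition n M p) ⊆ (chartAt 𝔼 p).source :=
  Classical.choose_spec (SmoothPartitionOfUnity.exists_isSubordinate_chartAt_source (𝓡 n) M) p

variable (n M) in
lemma finite_chartPartition : {p : M | (Function.support (chartPartition n M p)).Nonempty}.Finite :=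
  (chartPartition n M).locallyFinite.finite_nonempty_of_compact

variable (n M) in
/-- The finitely many indices at which the partition of unity does not vanish identically. -/
def partIndex : Finset M := (finite_chartPartition n M).toFinset

lemma chartPartition_eq_zero {p : M} (hp : p ∉ partIndex n M) (x : M) :
    chartPartition n M p x = 0 := by
  by_contra h
  exact hp ((finite_chartPartition n M).mem_toFinset.2 ⟨x, h⟩)

lemma sum_chartPartition (x : M) : ∑ p ∈ partIndex n M, chartPartition n M p x = 1 := by
  rw [← (chartPartition n M).sum_eq_one (mem_univ x)]
  refine (finsum_eq_sum_of_support_subset _ fun p hp => ?_).symm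
  by_contra h
  exact hp (chartPartition_eq_zero h x)

lemma volIntegral_eq_sum (g : TwoTensorField n M) (f : M → ℝ) :
    volIntegral g f
      = ∑ p ∈ partIndex n M, chartIntegral p g (fun x => chartPartition n M p x * f x) := by
  refine finsum_eq_sum_of_support_subset _ fun p hp => ?_
  by_contra h
  exact hp (by simp [chartPartition_eq_zero h])

/-- The image of the support of the `p`-th partition function in the chart at `p`. -/
def chartSupport (p : M) : Set 𝔼 := chartAt 𝔼 p '' tsupport (chartPartition n M p)

lemma isCompact_chartSupport (p : M) : IsCompact (chartSupport p : Set 𝔼) :=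
  ((isClosed_tsupport _).isCompact).image_of_continuousOn
    ((chartAt 𝔼 p).continuousOn.mono (chartPartition_tsupport_subset p))

lemma chartSupport_subset (p : M) : (chartSupport p : Set 𝔼) ⊆ (chartAt 𝔼 p).target := by
  rintro _ ⟨x, hx, rfl⟩
  exact (chartAt 𝔼 p).map_source (chartPartition_tsupport_subset p hx)

lemma notMem_tsupport {p : M} {y : 𝔼} (hy : y ∈ (chartAt 𝔼 p).target \ chartSupport p) :
    (chartAt 𝔼 p).symm y ∉ tsupport (chartPartition n M p) := fun h =>
  hy.2 ⟨_, h, (chartAt 𝔼 p).right_inv hy.1⟩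

lemma isChartContinuous_chartPartition (p : M) :
    IsChartContinuous (n := n) (fun x => chartPartition n M p x) :=
  isChartContinuous_of_continuous (chartPartition n M p).contMDiff.continuous

section

variable {g h : TwoTensorField n M} {f f' : M → ℝ}

lemma integrableOn_chart (hg : IsSmoothMetric g) (hf : IsChartContinuous (n := n) f) {p : M}
    (hf0 : ∀ x ∉ tsupport (chartPartition n M p), f x = 0) :
    IntegrableOn (fun y => f ((chartAt 𝔼 p).symm y) * √(coordMatrix g (chartAt 𝔼 p) y).det)
      (chartAt 𝔼 p).target :=
  integrableOn_of_eq_zero_off_compact (chartAt 𝔼 p).open_target (isCompact_chartSupport p)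
    (chartSupport_subset p) ((hf p).mul (hg.continuousOn_sqrt_det p))
    fun y hy => by rw [hf0 _ (notMem_tsupport hy), zero_mul]

lemma chartPartition_eq_zero_of_notMem {p x : M} (hx : x ∉ tsupport (chartPartition n M p)) :
    chartPartition n M p x = 0 := image_eq_zero_of_notMem_tsupport hx

lemma chartIntegral_sum {ι : Type*} {s : Finset ι} (hg : IsSmoothMetric g) {f : ι → M → ℝ}
    (hf : ∀ a ∈ s, IsChartContinuous (n := n) (f a)) {p : M}
    (hf0 : ∀ a ∈ s, ∀ x ∉ tsupport (chartPartition n M p), f a x = 0) :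
    chartIntegral p g (fun x => ∑ a ∈ s, f a x) = ∑ a ∈ s, chartIntegral p g (f a) := by
  unfold chartIntegral
  rw [← integral_finsetSum _ fun a ha => integrableOn_chart hg (hf a ha) (hf0 a ha)]
  simp only [Finset.sum_mul]

lemma volIntegral_sum {ι : Type*} {s : Finset ι} (hg : IsSmoothMetric g) {f : ι → M → ℝ}
    (hf : ∀ a ∈ s, IsChartContinuous (n := n) (f a)) :
    volIntegral g (fun x => ∑ a ∈ s, f a x) = ∑ a ∈ s, volIntegral g (f a) := by
  simp only [volIntegral_eq_sum]
  rw [Finset.sum_comm]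
  refine Finset.sum_congr rfl fun p _ => ?_
  simp only [Finset.mul_sum]
  exact chartIntegral_sum hg (fun a ha => (isChartContinuous_chartPartition p).mul (hf a ha))
    fun a _ x hx => by rw [chartPartition_eq_zero_of_notMem hx, zero_mul]

lemma volIntegral_const_mul (c : ℝ) : volIntegral g (fun x => c * f x) = c * volIntegral g f := by
  simp only [volIntegral_eq_sum, Finset.mul_sum, ← chartIntegral_const_mul]
  simp only [mul_left_comm]

lemma volIntegral_add (hg : IsSmoothMetric g) (hf : IsChartContinuous (n := n) f)
    (hf' : IsChartContinuous (n := n) f') :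
    volIntegral g (fun x => f x + f' x) = volIntegral g f + volIntegral g f' := by
  have := volIntegral_sum (s := Finset.univ) hg (f := fun b : Bool => if b then f else f')
    (by intro a _; cases a <;> simpa)
  simpa using this

/-- The integral of a function supported in one of the charts is its integral in that chart. -/
lemma volIntegral_eq_chartIntegral (hg : IsSmoothMetric g) (hf : IsChartContinuous (n := n) f)
    {q : M} (hf0 : ∀ x ∉ tsupport (chartPartition n M q), f x = 0) :
    volIntegral g f = chartIntegral q g f := by
  have h1 : ∀ p ∈ partIndex n M, chartIntegral p g (fun x => chartPartition n M p x * f x)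
      = chartIntegral q g (fun x => chartPartition n M p x * f x) := by
    intro p _
    refine chartIntegral_eq (fun x hx => ?_) (fun x hx => ?_)
    · rw [chartPartition_eq_zero_of_notMem fun h => hx (chartPartition_tsupport_subset p h),
        zero_mul]
    · rw [hf0 x fun h => hx (chartPartition_tsupport_subset q h), mul_zero]
  rw [volIntegral_eq_sum, Finset.sum_congr rfl h1, ← chartIntegral_sum hg
    (fun p _ => (isChartContinuous_chartPartition p).mul hf)
    (fun p _ x hx => by rw [hf0 x hx, mul_zero])]
  simp only [← Finset.sum_mul, sum_chartPartition, one_mul]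

/-- The piece `ρ_q h` of the tensor `h`, supported in the chart at `q`. -/
def cutOff (q : M) (h : TwoTensorField n M) : TwoTensorField n M :=
  fun x => chartPartition n M q x • h x

lemma IsSmoothSym.cutOff (hh : IsSmoothSym h) (q : M) : IsSmoothSym (cutOff q h) :=
  hh.smul (chartPartition n M q).contMDiff

lemma sum_cutOff (h : TwoTensorField n M) : ∑ q ∈ partIndex n M, cutOff q h = h := by
  funext x
  rw [Finset.sum_apply]
  simp only [TotalSigma.cutOff, ← Finset.sum_smul, sum_chartPartition, one_smul]

lemma traceField_cutOff (q x : M) :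
    traceField g (cutOff q h) x = chartPartition n M q x * traceField g h x := by
  unfold traceField cutOff
  rw [coordMatrix_smul, Matrix.mul_smul, Matrix.trace_smul, smul_eq_mul,
    (chartAt 𝔼 x).left_inv (mem_chart_source 𝔼 x)]

lemma dScalField_cutOff_eq_zero {q x : M} (hx : x ∉ tsupport (chartPartition n M q)) :
    dScalField g (cutOff q h) x = 0 := by
  refine dScal_eq_zero ?_
  have h1 : ContinuousAt (chartAt 𝔼 x).symm (chartAt 𝔼 x x) :=
    (chartAt 𝔼 x).continuousAt_symm ((chartAt 𝔼 x).map_source (mem_chart_source 𝔼 x))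
  have h2 : (tsupport (chartPartition n M q))ᶜ ∈ 𝓝 ((chartAt 𝔼 x).symm (chartAt 𝔼 x x)) := by
    rw [(chartAt 𝔼 x).left_inv (mem_chart_source 𝔼 x)]
    exact (isClosed_tsupport _).isOpen_compl.mem_nhds hx
  filter_upwards [h1 h2] with y hy
  unfold cutOff
  rw [coordMatrix_smul, chartPartition_eq_zero_of_notMem hy, zero_smul]
  rfl

/-- `∫ δR dv = - (n - 1) λ ∫ tr h dv` for an Einstein metric. -/
lemma volIntegral_dScalField {lam : ℝ} (hE : IsEinstein g lam) (hg : IsSmoothMetric g)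
    (hh : IsSmoothSym h) :
    volIntegral g (dScalField g h) = -(((n : ℝ) - 1) * lam) * volIntegral g (traceField g h) := by
  have hpiece : ∀ q ∈ partIndex n M, volIntegral g (dScalField g (cutOff q h))
      = -(((n : ℝ) - 1) * lam) * volIntegral g (traceField g (cutOff q h)) := by
    intro q _
    rw [volIntegral_eq_chartIntegral hg (isChartContinuous_dScalField hg (hh.cutOff q))
        (q := q) (fun x hx => dScalField_cutOff_eq_zero hx),
      volIntegral_eq_chartIntegral hg (isChartContinuous_traceField hg (hh.cutOff q))
        (q := q) (fun x hx => by
          rw [traceField_cutOff, chartPartition_eq_zero_of_notMem hx, zero_mul])]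
    have h1 := integral_dScal (G := coordMatrix g (chartAt 𝔼 q))
      (H := coordMatrix (cutOff q h) (chartAt 𝔼 q)) (c := ((n : ℝ) - 1) * lam)
      (chartAt 𝔼 q).open_target (isCompact_chartSupport q) (chartSupport_subset q)
      (fun y hy => hg.isMetricNear hy) (fun y hy => hg.det_pos hy)
      (fun y hy => (hh.cutOff q).isSymNear hy) (fun y hy => by
        unfold cutOff
        rw [coordMatrix_smul, chartPartition_eq_zero_of_notMem (notMem_tsupport hy), zero_smul])
      (fun y hy => hE.ricciMatrix_eq hg hy)
    unfold chartIntegral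
    refine Eq.trans ?_ (h1.trans ?_)
    · refine setIntegral_congr_fun (chartAt 𝔼 q).open_target.measurableSet fun y hy => ?_
      simp only [dScalField_eq hg (hh.cutOff q) ((chartAt 𝔼 q).map_target hy),
        (chartAt 𝔼 q).right_inv hy]
    · congr 1
      refine setIntegral_congr_fun (chartAt 𝔼 q).open_target.measurableSet fun y hy => ?_
      simp only [traceField_eq hg ((chartAt 𝔼 q).map_target hy), (chartAt 𝔼 q).right_inv hy]
  have h1 : dScalField g h = fun x => ∑ q ∈ partIndex n M, dScalField g (cutOff q h) x := by
    funext x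
    rw [← dScalField_sum _ hg fun q => hh.cutOff q, sum_cutOff]
  have h2 : traceField g h = fun x => ∑ q ∈ partIndex n M, traceField g (cutOff q h) x := by
    funext x
    simp only [traceField_cutOff, ← Finset.sum_mul, sum_chartPartition, one_mul]
  rw [h1, h2, volIntegral_sum hg fun q _ => isChartContinuous_dScalField hg (hh.cutOff q),
    volIntegral_sum hg fun q _ => isChartContinuous_traceField hg (hh.cutOff q), Finset.mul_sum]
  exact Finset.sum_congr rfl hpiece

end

end GlobalIntegral

/-! ### Metrics near a given one -/

section Positivity

variable {n : ℕ} {M : Type*} [TopologicalSpace M] [ChartedSpace (EuclideanSpace ℝ (Fin n)) M]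
  [IsManifold (𝓡 n) ∞ M]

local notation "𝔼" => EuclideanSpace ℝ (Fin n)

variable [CompactSpace M] [T2Space M] {g h : TwoTensorField n M}

lemma exists_mem_partIndex (x : M) :
    ∃ p ∈ partIndex n M, x ∈ tsupport (chartPartition n M p) := by
  by_contra hx
  push Not at hx
  have h1 := sum_chartPartition (n := n) x
  rw [Finset.sum_eq_zero fun p hp => chartPartition_eq_zero_of_notMem (hx p hp)] at h1
  exact zero_ne_one h1

/-- On a compact manifold, positive definiteness is stable under small perturbations, because it
can be tested on the finitely many compact sets `chartSupport p ×ˢ sphere 0 1`. -/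
lemma IsSmoothMetric.eventually_isPositive (hg : IsSmoothMetric g) (hh : IsSmoothSym h) :
    ∀ᶠ t : ℝ in 𝓝 0, IsPositive (g + t • h) := by
  have h1 : ∀ p : M, ∀ᶠ t : ℝ in 𝓝 0, ∀ q ∈ (chartSupport p : Set 𝔼) ×ˢ Metric.sphere (0 : 𝔼) 1,
      0 < ∑ i, ∑ j, coordMatrix (g + t • h) (chartAt 𝔼 p) q.1 i j * (q.2 i * q.2 j) := by
    intro p
    refine IsCompact.eventually_forall_of_forall_eventually
      ((isCompact_chartSupport p).prod (isCompact_sphere _ _)) fun q hq => ?_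
    have hy := chartSupport_subset p hq.1
    have hc : ContinuousAt (fun z : ℝ × (𝔼 × 𝔼) =>
        ∑ i, ∑ j, coordMatrix (g + z.1 • h) (chartAt 𝔼 p) z.2.1 i j * (z.2.2 i * z.2.2 j))
        (0, q) := by
      refine tendsto_finsetSum _ fun i _ => tendsto_finsetSum _ fun j _ =>
        ContinuousAt.mul ?_ (by fun_prop)
      simp only [coordMatrix_add_smul]
      exact ContinuousAt.comp (f := fun z : ℝ × (𝔼 × 𝔼) => (z.1, z.2.1)) (x := ((0 : ℝ), q))
        (contDiffAt_lineFamily (t := 0) (hg.isSymNear hy) (hh.isSymNear hy) i j).continuousAt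
        (by fun_prop)
    refine hc.eventually (lt_mem_nhds ?_)
    refine lt_of_lt_of_eq (hg.pos _ _ fun h0 => ?_)
      ((apply_mfderiv_symm g p q.1 q.2).trans (by
        simp only [coordMatrix_add_smul, lineFamily_zero]))
    have hq2 : q.2 = 0 :=
      (mdifferentiable_of_mem_atlas (chart_mem_atlas 𝔼 p)).symm.mfderiv_injective hy
        (h0.trans (map_zero _).symm)
    simpa [hq2] using hq.2
  have h2 := (Filter.eventually_all_finset (partIndex n M)).2 fun p _ => h1 p
  filter_upwards [h2] with t ht x v hv
  obtain ⟨p, hp, hx⟩ := exists_mem_partIndex (n := n) x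
  have hxs := chartPartition_tsupport_subset p hx
  have hy := (chartAt 𝔼 p).map_source hxs
  obtain ⟨y, hy0⟩ : ∃ y, y = chartAt 𝔼 p x := ⟨_, rfl⟩
  obtain rfl : x = (chartAt 𝔼 p).symm y := by rw [hy0, (chartAt 𝔼 p).left_inv hxs]
  have hyt : y ∈ (chartAt 𝔼 p).target := by rw [hy0]; exact hy
  have hys : y ∈ (chartSupport p : Set 𝔼) := ⟨_, hx, hy0.symm⟩
  obtain ⟨u, rfl⟩ : ∃ u : 𝔼, (mfderiv (𝓡 n) (𝓡 n) (chartAt 𝔼 p).symm y : 𝔼 →L[ℝ] 𝔼) u = v :=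
    (mdifferentiable_of_mem_atlas (chart_mem_atlas 𝔼 p)).symm.mfderiv_surjective hyt v
  have hu : u ≠ 0 := by
    rintro rfl
    exact hv (map_zero _)
  have hu0 : 0 < ‖u‖ := norm_pos_iff.2 hu
  refine lt_of_lt_of_eq ?_ (apply_mfderiv_symm (g + t • h) p y u).symm
  have h3 := ht p hp (y, ‖u‖⁻¹ • u) ⟨hys, by simp [norm_smul, hu0.ne']⟩
  have h4 : ∑ i, ∑ j, coordMatrix (g + t • h) (chartAt 𝔼 p) y i j * (u i * u j)
      = ‖u‖ ^ 2 * ∑ i, ∑ j, coordMatrix (g + t • h) (chartAt 𝔼 p) y i j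
        * ((‖u‖⁻¹ • u) i * (‖u‖⁻¹ • u) j) := by
    simp only [Finset.mul_sum]
    refine Finset.sum_congr rfl fun i _ => Finset.sum_congr rfl fun j _ => ?_
    simp only [PiLp.smul_apply, smul_eq_mul]
    field_simp
  rw [h4]
  exact mul_pos (by positivity) h3

lemma IsSmoothMetric.exists_forall_add_smul (hg : IsSmoothMetric g) (hh : IsSmoothSym h) :
    ∃ ε > 0, ∀ t : ℝ, |t| < ε → IsSmoothMetric (g + t • h) := by
  obtain ⟨ε, hε, h1⟩ := Metric.eventually_nhds_iff.1 (hg.eventually_isPositive hh)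
  exact ⟨ε, hε, fun t ht => ⟨hg.toIsSmoothSym.add (hh.const_smul t), h1 (by simpa using ht)⟩⟩

end Positivity

/-! ### First variation of the total curvatures -/

section TotalCurvature

open MeasureTheory Set

variable {n : ℕ} {M : Type*} [TopologicalSpace M] [ChartedSpace (EuclideanSpace ℝ (Fin n)) M]
  [IsManifold (𝓡 n) ∞ M]

local notation "𝔼" => EuclideanSpace ℝ (Fin n)

variable {g h : TwoTensorField n M} {k : ℕ} {lam : ℝ}

lemma sigmaCurv_eq_sigmaPoly (hk : k ≤ n) (hg : IsSmoothMetric g) {p : M} {y : 𝔼}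
    (hy : y ∈ (chartAt 𝔼 p).target) :
    sigmaCurv k g ((chartAt 𝔼 p).symm y)
      = sigmaPoly k ((coordMatrix g (chartAt 𝔼 p) y)⁻¹
        * schoutenMatrix (coordMatrix g (chartAt 𝔼 p)) y) := by
  rw [sigmaCurv_eq k hg ((chartAt 𝔼 p).map_target hy), (chartAt 𝔼 p).right_inv hy]
  exact sigmaCoord_eq_sigmaPoly hk (hg.isMetricNear hy) (hg.posDef hy)

lemma IsEinstein.sigmaCurv_eq (hE : IsEinstein g lam) (hg : IsSmoothMetric g) (hn : 2 ≤ n)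
    (hk : k ≤ n) (x : M) :
    sigmaCurv k g x = n.choose k * (((n : ℝ) - 2) * lam / 2) ^ k := by
  have hy := (chartAt 𝔼 x).map_source (mem_chart_source 𝔼 x)
  have h1 := sigmaCurv_eq_sigmaPoly hk hg hy
  rw [(chartAt 𝔼 x).left_inv (mem_chart_source 𝔼 x),
    inv_mul_schouten_of_einstein hn (hg.isMetricNear hy) (hE.ricciMatrix_eq hg hy),
    sigmaPoly_smul_one, Fintype.card_fin] at h1
  exact h1

lemma dScalField_symm (hg : IsSmoothMetric g) (hh : IsSmoothSym h) {p : M} {y : 𝔼}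
    (hy : y ∈ (chartAt 𝔼 p).target) : dScalField g h ((chartAt 𝔼 p).symm y)
      = dScal (coordMatrix g (chartAt 𝔼 p)) (coordMatrix h (chartAt 𝔼 p)) y := by
  rw [dScalField_eq hg hh ((chartAt 𝔼 p).map_target hy), (chartAt 𝔼 p).right_inv hy]

lemma traceField_symm (hg : IsSmoothMetric g) {p : M} {y : 𝔼}
    (hy : y ∈ (chartAt 𝔼 p).target) : traceField g h ((chartAt 𝔼 p).symm y)
      = ((coordMatrix g (chartAt 𝔼 p) y)⁻¹ * coordMatrix h (chartAt 𝔼 p) y).trace := by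
  rw [traceField_eq hg ((chartAt 𝔼 p).map_target hy), (chartAt 𝔼 p).right_inv hy]

variable [CompactSpace M] [T2Space M]

/-- Differentiation of the integral of a family of functions with respect to a family of metrics,
where the integrands in the charts are smooth in the parameter and the coordinates together. -/
lemma hasDerivAt_volIntegral_family {gf : ℝ → TwoTensorField n M} {f : ℝ → M → ℝ} {D : M → ℝ}
    {Φ : M → ℝ → 𝔼 → ℝ} {ε : ℝ} (hε : 0 < ε)
    (hf : ∀ p, ∀ t : ℝ, |t| < ε → ∀ y ∈ (chartAt 𝔼 p).target,
      f t ((chartAt 𝔼 p).symm y) * √(coordMatrix (gf t) (chartAt 𝔼 p) y).det = Φ p t y)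
    (hΦ : ∀ p, ∀ t : ℝ, |t| < ε → ∀ y ∈ (chartAt 𝔼 p).target,
      ContDiffAt ℝ ∞ (fun q : ℝ × 𝔼 => Φ p q.1 q.2) (t, y))
    (hD : ∀ p, ∀ y ∈ (chartAt 𝔼 p).target, HasDerivAt (fun t => Φ p t y)
      (D ((chartAt 𝔼 p).symm y) * √(coordMatrix g (chartAt 𝔼 p) y).det) 0) :
    HasDerivAt (fun t => volIntegral (gf t) (f t)) (volIntegral g D) 0 := by
  simp only [volIntegral_eq_sum]
  refine HasDerivAt.fun_sum fun p _ => ?_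
  have h1 := hasDerivAt_integral_family (w := fun y => chartPartition n M p ((chartAt 𝔼 p).symm y))
    hε (chartAt 𝔼 p).open_target (isCompact_chartSupport p) (chartSupport_subset p)
    (isChartContinuous_chartPartition p p)
    (fun y hy => chartPartition_eq_zero_of_notMem (notMem_tsupport hy)) (hΦ p) (hD p)
  unfold chartIntegral
  simp only [mul_assoc]
  refine h1.congr_of_eventuallyEq ?_
  filter_upwards [Metric.ball_mem_nhds (0 : ℝ) hε] with t ht
  refine setIntegral_congr_fun (chartAt 𝔼 p).open_target.measurableSet fun y hy => ?_
  simp only [hf p t (by simpa using ht) y hy]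

lemma contDiffAt_sigmaPoly_lineFamily {G H : 𝔼 → Matrix (Fin n) (Fin n) ℝ} {t : ℝ} {y : 𝔼}
    (hG : IsSymNear G y) (hH : IsSymNear H y) (hdet : (lineFamily G H t y).det ≠ 0) :
    ContDiffAt ℝ ∞ (fun q : ℝ × 𝔼 => sigmaPoly k ((lineFamily G H q.1 q.2)⁻¹
      * schoutenMatrix (lineFamily G H q.1) q.2)) (t, y) :=
  contDiffAt_sigmaPoly k fun i j => contDiffAt_inv_mul_schouten_family (p := (t, y))
    (fun a b => contDiffAt_lineFamily hG hH a b) hdet i j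

/-- The coefficient identity behind the first variation: `s = (n - 2) λ / 2` is also
`(n - 1) λ` times the ratio `(n - 2) / (2 (n - 1))` of the traces of `S` and `Ric`. -/
lemma choose_mul_pow_pred_mul (hn : 2 ≤ n) (k : ℕ) (lam : ℝ) :
    (k * n.choose k / n : ℝ) * (((n : ℝ) - 2) * lam / 2) ^ (k - 1)
        * (((n : ℝ) - 2) / (2 * ((n : ℝ) - 1))) * (((n : ℝ) - 1) * lam)
      = (k / n) * (n.choose k * (((n : ℝ) - 2) * lam / 2) ^ k) := by
  have h2 : (2 : ℝ) ≤ n := by exact_mod_cast hn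
  have hn1 : (n : ℝ) - 1 ≠ 0 := by linarith
  have h3 : ((n : ℝ) - 2) / (2 * ((n : ℝ) - 1)) * (((n : ℝ) - 1) * lam)
      = ((n : ℝ) - 2) * lam / 2 := by
    field_simp
  rcases k with _ | k
  · simp
  · rw [mul_assoc, h3, Nat.add_sub_cancel, pow_succ]
    ring

/-- First variation at an Einstein metric of the total `σ_k`-curvature, with respect to the fixed
volume element. -/
lemma IsEinstein.hasDerivAt_volIntegral_fixed (hE : IsEinstein g lam) (hg : IsSmoothMetric g)
    (hh : IsSmoothSym h) (hn : 2 ≤ n) (hk : k ≤ n) :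
    HasDerivAt (fun t : ℝ => volIntegral g (sigmaCurv k (g + t • h)))
      (-(k / n) * (n.choose k * (((n : ℝ) - 2) * lam / 2) ^ k)
        * volIntegral g (traceField g h)) 0 := by
  obtain ⟨ε, hε, hpos⟩ := hg.exists_forall_add_smul hh
  set c : ℝ := (k * n.choose k / n : ℝ) * (((n : ℝ) - 2) * lam / 2) ^ (k - 1)
        * (((n : ℝ) - 2) / (2 * ((n : ℝ) - 1))) with hc
  have h1 : HasDerivAt (fun t : ℝ => volIntegral g (sigmaCurv k (g + t • h)))
      (volIntegral g (fun x => c * dScalField g h x)) 0 := by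
    refine hasDerivAt_volIntegral_family (gf := fun _ => g)
      (Φ := fun p t y => sigmaPoly k
        ((lineFamily (coordMatrix g (chartAt 𝔼 p)) (coordMatrix h (chartAt 𝔼 p)) t y)⁻¹
        * schoutenMatrix
          (lineFamily (coordMatrix g (chartAt 𝔼 p)) (coordMatrix h (chartAt 𝔼 p)) t) y)
        * √(coordMatrix g (chartAt 𝔼 p) y).det) hε ?_ ?_ ?_
    · intro p t ht y hy
      rw [sigmaCurv_eq_sigmaPoly hk (hpos t ht) hy, coordMatrix_add_smul]
    · intro p t ht y hy
      exact (contDiffAt_sigmaPoly_lineFamily (hg.isSymNear hy) (hh.isSymNear hy)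
        ((hpos t ht).det_pos hy).ne').mul
        (contDiffAt_family_const (contDiffAt_sqrt_det (hg.isMetricNear hy)))
    · intro p y hy
      have h2 := (hasDerivAt_sigmaPoly_lineFamily hn k (hg.isMetricNear hy) (hh.isSymNear hy)
        (hE.ricciMatrix_eq hg hy)).mul_const √(coordMatrix g (chartAt 𝔼 p) y).det
      refine h2.congr_deriv ?_
      rw [dScalField_symm hg hh hy, hc]
      ring
  refine h1.congr_deriv ?_
  rw [volIntegral_const_mul, volIntegral_dScalField hE hg hh,
    neg_mul (k / n : ℝ), ← choose_mul_pow_pred_mul hn, ← hc]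
  ring

/-- First variation at an Einstein metric of the total `σ_k`-curvature. -/
lemma IsEinstein.hasDerivAt_volIntegral (hE : IsEinstein g lam) (hg : IsSmoothMetric g)
    (hh : IsSmoothSym h) (hn : 2 ≤ n) (hk : k ≤ n) :
    HasDerivAt (fun t : ℝ => volIntegral (g + t • h) (sigmaCurv k (g + t • h)))
      ((1 / 2 - k / n) * (n.choose k * (((n : ℝ) - 2) * lam / 2) ^ k)
        * volIntegral g (traceField g h)) 0 := by
  obtain ⟨ε, hε, hpos⟩ := hg.exists_forall_add_smul hh
  set c : ℝ := (k * n.choose k / n : ℝ) * (((n : ℝ) - 2) * lam / 2) ^ (k - 1)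
        * (((n : ℝ) - 2) / (2 * ((n : ℝ) - 1))) with hc
  set b : ℝ := n.choose k * (((n : ℝ) - 2) * lam / 2) ^ k with hb
  have h1 : HasDerivAt (fun t : ℝ => volIntegral (g + t • h) (sigmaCurv k (g + t • h)))
      (volIntegral g (fun x => c * dScalField g h x + b / 2 * traceField g h x)) 0 := by
    refine hasDerivAt_volIntegral_family
      (Φ := fun p t y => sigmaPoly k
        ((lineFamily (coordMatrix g (chartAt 𝔼 p)) (coordMatrix h (chartAt 𝔼 p)) t y)⁻¹
        * schoutenMatrix
          (lineFamily (coordMatrix g (chartAt 𝔼 p)) (coordMatrix h (chartAt 𝔼 p)) t) y)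
        * √(lineFamily (coordMatrix g (chartAt 𝔼 p)) (coordMatrix h (chartAt 𝔼 p)) t y).det)
      hε ?_ ?_ ?_
    · intro p t ht y hy
      rw [sigmaCurv_eq_sigmaPoly hk (hpos t ht) hy, coordMatrix_add_smul]
    · intro p t ht y hy
      have hdet := ((hpos t ht).det_pos hy).ne'
      exact (contDiffAt_sigmaPoly_lineFamily (hg.isSymNear hy) (hh.isSymNear hy) hdet).mul
        ((contDiffAt_det fun i j => contDiffAt_lineFamily (hg.isSymNear hy)
          (hh.isSymNear hy) i j).sqrt hdet)
    · intro p y hy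
      have hR := hE.ricciMatrix_eq hg hy
      have h2 := (hasDerivAt_sigmaPoly_lineFamily hn k (hg.isMetricNear hy) (hh.isSymNear hy)
        hR).mul (hasDerivAt_sqrt_det_lineFamily (H := coordMatrix h (chartAt 𝔼 p))
          (hg.isMetricNear hy) (hg.det_pos hy))
      refine h2.congr_deriv ?_
      simp only [lineFamily_zero]
      rw [dScalField_symm hg hh hy, traceField_symm hg hy,
        inv_mul_schouten_of_einstein hn (hg.isMetricNear hy) hR, sigmaPoly_smul_one,
        Fintype.card_fin, hc, hb]
      ring
  refine h1.congr_deriv ?_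
  have hcont : ∀ (a : ℝ) {f : M → ℝ}, IsChartContinuous (n := n) f →
      IsChartContinuous (n := n) fun x => a * f x := fun a f hf p => continuousOn_const.mul (hf p)
  rw [volIntegral_add hg (hcont _ (isChartContinuous_dScalField hg hh))
    (hcont _ (isChartContinuous_traceField hg hh)), volIntegral_const_mul, volIntegral_const_mul,
    volIntegral_dScalField hE hg hh, sub_mul (1 / 2 : ℝ), hb, ← choose_mul_pow_pred_mul hn, ← hc]
  ring

lemma IsEinstein.volIntegral_sigmaCurv (hE : IsEinstein g lam) (hg : IsSmoothMetric g)
    (hn : 2 ≤ n) (hk : k ≤ n) : volIntegral g (sigmaCurv k g)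
      = n.choose k * (((n : ℝ) - 2) * lam / 2) ^ k * volIntegral g (fun _ => 1) := by
  rw [← volIntegral_const_mul]
  congr 1
  funext x
  rw [hE.sigmaCurv_eq hg hn hk, mul_one]

lemma IsSmoothMetric.volIntegral_one_pos [Nonempty M] (hg : IsSmoothMetric g) :
    0 < volIntegral g (fun _ => 1) := by
  rw [volIntegral_eq_sum]
  refine Finset.sum_pos (fun p hp => ?_) ?_
  · obtain ⟨x, hx⟩ := (finite_chartPartition n M).mem_toFinset.1 hp
    have hxs := chartPartition_tsupport_subset p (subset_tsupport _ hx)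
    unfold chartIntegral
    simp only [mul_one]
    refine setIntegral_pos_of_pos_at (chartAt 𝔼 p).open_target (isCompact_chartSupport p)
      (chartSupport_subset p)
      ((isChartContinuous_chartPartition p p).mul (hg.continuousOn_sqrt_det p))
      (fun y hy => by rw [chartPartition_eq_zero_of_notMem (notMem_tsupport hy), zero_mul])
      (fun y _ => mul_nonneg ((chartPartition n M).nonneg _ _) (Real.sqrt_nonneg _))
      ((chartAt 𝔼 p).map_source hxs) ?_
    rw [(chartAt 𝔼 p).left_inv hxs]
    exact mul_pos (((chartPartition n M).nonneg _ _).lt_of_ne' hx)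
      (Real.sqrt_pos.2 (hg.det_pos ((chartAt 𝔼 p).map_source hxs)))
  · obtain ⟨p, hp, -⟩ := exists_mem_partIndex (n := n) (Classical.arbitrary M)
    exact ⟨p, hp⟩

end TotalCurvature

/-! ### Scaling -/

section Scaling

open MeasureTheory

variable {n : ℕ}

local notation "𝔼" => EuclideanSpace ℝ (Fin n)

variable {c : ℝ}

/-- No invertibility is needed: if `A` is singular, both inverses are the junk value `0`. -/
lemma inv_const_smul (hc : c ≠ 0) (A : Matrix (Fin n) (Fin n) ℝ) : (c • A)⁻¹ = c⁻¹ • A⁻¹ := by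
  by_cases hA : IsUnit A.det
  · have : Invertible c := invertibleOfNonzero hc
    rw [Matrix.inv_smul _ _ hA, invOf_eq_inv]
  · rw [Matrix.nonsing_inv_apply_not_isUnit A hA, Matrix.nonsing_inv_apply_not_isUnit, smul_zero]
    rw [Matrix.det_smul]
    simpa [hc] using hA

lemma christoffel_const_smul (hc : c ≠ 0) (G : 𝔼 → Matrix (Fin n) (Fin n) ℝ) (k i j : Fin n) :
    christoffel (c • G) k i j = christoffel G k i j := by
  funext y
  simp only [christoffel, Pi.smul_apply, Matrix.smul_apply, smul_eq_mul, inv_const_smul hc,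
    partialDeriv_const_mul]
  congr 1
  refine Finset.sum_congr rfl fun l _ => ?_
  field_simp

lemma ricciMatrix_const_smul (hc : c ≠ 0) (G : 𝔼 → Matrix (Fin n) (Fin n) ℝ) (y : 𝔼) :
    ricciMatrix (c • G) y = ricciMatrix G y := by
  simp only [ricciMatrix, christoffel_const_smul hc]

lemma schoutenMatrix_const_smul (hc : c ≠ 0) (G : 𝔼 → Matrix (Fin n) (Fin n) ℝ) (y : 𝔼) :
    schoutenMatrix (c • G) y = schoutenMatrix G y := by
  have h1 : scalarCurv (c • G) y = c⁻¹ * scalarCurv G y := by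
    simp only [scalarCurv, ricciMatrix_const_smul hc, Pi.smul_apply, inv_const_smul hc,
      Matrix.smul_apply, smul_eq_mul, Finset.mul_sum, mul_assoc]
  simp only [schoutenMatrix, ricciMatrix_const_smul hc, h1, Pi.smul_apply, smul_smul]
  congr 2
  field_simp

lemma sigmaPoly_const_smul (k : ℕ) (A : Matrix (Fin n) (Fin n) ℝ) :
    sigmaPoly k (c • A) = c ^ k * sigmaPoly k A := by
  unfold sigmaPoly
  rw [Finset.mul_sum]
  refine Finset.sum_congr rfl fun u hu => ?_
  rw [Matrix.submatrix_smul, Pi.smul_apply, Pi.smul_apply, Matrix.det_smul, Fintype.card_coe,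
    (Finset.mem_powersetCard.1 hu).2]

variable {M : Type*} [TopologicalSpace M] [ChartedSpace (EuclideanSpace ℝ (Fin n)) M]
  {g : TwoTensorField n M} {k : ℕ}

lemma IsSmoothMetric.const_smul (hg : IsSmoothMetric g) (hc : 0 < c) : IsSmoothMetric (c • g) where
  toIsSmoothSym := hg.toIsSmoothSym.const_smul c
  pos x v hv := mul_pos hc (hg.pos x v hv)

lemma coordMatrix_const_smul (c : ℝ) (g : TwoTensorField n M)
    (e : OpenPartialHomeomorph M (EuclideanSpace ℝ (Fin n))) :
    coordMatrix (c • g) e = c • coordMatrix g e := rfl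

variable [IsManifold (𝓡 n) ∞ M]

lemma sigmaCurv_const_smul (hg : IsSmoothMetric g) (hc : 0 < c) (hk : k ≤ n) (x : M) :
    sigmaCurv k (c • g) x = c⁻¹ ^ k * sigmaCurv k g x := by
  have hy := (chartAt 𝔼 x).map_source (mem_chart_source 𝔼 x)
  have h1 := sigmaCurv_eq_sigmaPoly hk hg hy
  have h2 := sigmaCurv_eq_sigmaPoly hk (hg.const_smul hc) hy
  rw [(chartAt 𝔼 x).left_inv (mem_chart_source 𝔼 x)] at h1 h2
  rw [h1, h2, coordMatrix_const_smul, schoutenMatrix_const_smul hc.ne', Pi.smul_apply,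
    inv_const_smul hc.ne', Matrix.smul_mul, sigmaPoly_const_smul]

variable [CompactSpace M] [T2Space M]

lemma volIntegral_const_smul (hc : 0 < c) (g : TwoTensorField n M) (f : M → ℝ) :
    volIntegral (c • g) f = √(c ^ n) * volIntegral g f := by
  simp only [volIntegral_eq_sum, Finset.mul_sum, chartIntegral]
  refine Finset.sum_congr rfl fun p _ => ?_
  rw [← integral_const_mul]
  congr 1
  funext y
  rw [coordMatrix_const_smul, Pi.smul_apply, Matrix.det_smul, Fintype.card_fin,
    Real.sqrt_mul (by positivity)]
  ring

/-- Scale invariance: the factors `c ^ (n k) c ^ (-2 k l)` and `c ^ (-k (n - 2 l))` cancel. -/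
lemma functionalF_const_smul {l : ℕ} (gbar : TwoTensorField n M) (hg : IsSmoothMetric g)
    (hc : 0 < c) (hl : l ≤ n) (hk : k ≤ n) :
    functionalF k l gbar (c • g) = functionalF k l gbar g := by
  have h1 : ∀ j ≤ n, sigmaCurv j (c • g) = fun x => c⁻¹ ^ j * sigmaCurv j g x :=
    fun j hj => funext fun x => sigmaCurv_const_smul hg hc hj x
  unfold functionalF
  rw [h1 l hl, h1 k hk, volIntegral_const_mul, volIntegral_const_mul, volIntegral_const_smul hc,
    mul_pow, mul_pow, mul_zpow]
  have h2 : √(c ^ n) ^ (2 * k) = c ^ (n * k) := by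
    rw [pow_mul, Real.sq_sqrt (by positivity), ← pow_mul]
  have h3 : (c⁻¹ ^ l) ^ (2 * k) * c ^ (n * k) * (c⁻¹ ^ k) ^ ((n : ℤ) - 2 * l) = 1 := by
    simp only [← zpow_natCast, inv_zpow', ← zpow_mul, ← zpow_add₀ hc.ne']
    rw [← zpow_zero c]
    congr 1
    push_cast
    ring
  rw [h2]
  linear_combination (volIntegral g (sigmaCurv l g) ^ (2 * k)
    * volIntegral gbar (sigmaCurv k g) ^ ((n : ℤ) - 2 * l)) * h3

end Scaling

/-! ### Criticality -/

section Critical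

/-- `A ^ k * B ^ m` is stationary when the logarithmic derivatives `a` of `A` and `b` of `B` satisfy
`k a + m b = 0`. -/
lemma hasDerivAt_pow_mul_zpow {A B : ℝ → ℝ} {a b : ℝ} {k : ℕ} {m : ℤ}
    (hA : HasDerivAt A (a * A 0) 0) (hB : HasDerivAt B (b * B 0) 0) (hB0 : B 0 ≠ 0)
    (hab : k * a + m * b = 0) :
    HasDerivAt (fun t => A t ^ k * B t ^ m) 0 0 := by
  have h1 := (hA.fun_pow k).mul ((hasDerivAt_zpow m (B 0) (Or.inl hB0)).comp (0 : ℝ) hB)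
  refine h1.congr_deriv ?_
  have h2 : A 0 ^ (k - 1) * (k * A 0) = k * A 0 ^ k := by
    rcases k with _ | k
    · simp
    · rw [Nat.add_sub_cancel, pow_succ]; ring
  have h3 : B 0 ^ (m - 1) * B 0 = B 0 ^ m := by
    rw [← zpow_add_one₀ hB0, sub_add_cancel]
  simp only [Function.comp_apply]
  linear_combination a * B 0 ^ m * h2 + A 0 ^ k * m * b * h3 + A 0 ^ k * B 0 ^ m * hab

lemma hasDerivAt_pow_mul_zpow_of_eq_zero {A B : ℝ → ℝ} {A' B' : ℝ} {k m : ℕ}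
    (hA : HasDerivAt A A' 0) (hB : HasDerivAt B B' 0)
    (h : (A 0 = 0 ∧ 2 ≤ k) ∨ (B 0 = 0 ∧ 2 ≤ m)) :
    HasDerivAt (fun t => A t ^ k * B t ^ m) 0 0 := by
  refine ((hA.fun_pow k).mul (hB.fun_pow m)).congr_deriv ?_
  rcases h with ⟨h0, h2⟩ | ⟨h0, h2⟩
  · rw [h0, zero_pow (by omega : k - 1 ≠ 0), zero_pow (by omega : k ≠ 0)]
    ring
  · rw [h0, zero_pow (by omega : m - 1 ≠ 0), zero_pow (by omega : m ≠ 0)]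
    ring

variable {n : ℕ} {M : Type*} [TopologicalSpace M] [ChartedSpace (EuclideanSpace ℝ (Fin n)) M]
  [IsManifold (𝓡 n) ∞ M] [CompactSpace M] [T2Space M]

/-- An Einstein metric is stationary for the functional along every line of metrics. -/
lemma IsEinstein.hasDerivAt_functionalF {g h : TwoTensorField n M} {lam : ℝ} {k l : ℕ}
    (hE : IsEinstein g lam) (hg : IsSmoothMetric g) (hh : IsSmoothSym h) (hn : 2 ≤ n)
    (hlk : l < k) (hkn : k ≤ n) (hlam : lam ≠ 0 ∨ 2 * l ≤ n) :
    HasDerivAt (fun t : ℝ => functionalF k l g (g + t • h)) 0 0 := by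
  have hA := hE.hasDerivAt_volIntegral hg hh hn (hlk.le.trans hkn)
  have hB := hE.hasDerivAt_volIntegral_fixed hg hh hn hkn
  have h0 : g + (0 : ℝ) • h = g := by
    funext x
    ext v w
    change g x v w + 0 * h x v w = g x v w
    ring
  have hA0 := hE.volIntegral_sigmaCurv hg hn (hlk.le.trans hkn)
  have hB0 := hE.volIntegral_sigmaCurv hg hn hkn
  have hn2 : (2 : ℝ) ≤ n := by exact_mod_cast hn
  unfold functionalF
  -- On the empty manifold all integrals vanish and the functional is constant.
  rcases isEmpty_or_nonempty M with hM | hM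
  · have h1 : ∀ (g' : TwoTensorField n M) (f : M → ℝ), volIntegral g' f = 0 := fun g' f =>
      finsum_of_isEmpty _
    simp only [h1]
    exact hasDerivAt_const _ _
  by_cases hs : ((n : ℝ) - 2) * lam / 2 = 0
  -- If `s = 0`, then `λ = 0` or `n = 2`; in both cases the exponent `n - 2 l` is nonnegative, and
  -- one of the integrals vanishes at `t = 0` and occurs with an exponent at least two.
  · have hln : 2 * l ≤ n := by
      rcases hlam with hlam | hlam
      · have h2 : (n : ℝ) = 2 := by
          rcases mul_eq_zero.1 ((div_eq_zero_iff.1 hs).resolve_right two_ne_zero) with h | h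
          · linarith
          · exact absurd h hlam
        have h3 : n = 2 := by exact_mod_cast h2
        omega
      · exact hlam
    have hm : (n : ℤ) - 2 * (l : ℤ) = ((n - 2 * l : ℕ) : ℤ) := by omega
    rw [hs] at hA0 hB0
    simp only [hm, zpow_natCast]
    refine hasDerivAt_pow_mul_zpow_of_eq_zero hA hB ?_
    simp only [h0]
    rcases Nat.eq_zero_or_pos l with rfl | hl
    · exact Or.inr ⟨by rw [hB0, zero_pow (by omega), mul_zero, zero_mul], by omega⟩
    · exact Or.inl ⟨by rw [hA0, zero_pow (by omega), mul_zero, zero_mul], by omega⟩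
  -- If `s ≠ 0`, both integrals are nonzero at `t = 0` and their logarithmic derivatives cancel.
  · have hV := hg.volIntegral_one_pos
    refine hasDerivAt_pow_mul_zpow
      (a := (1 / 2 - l / n) * (volIntegral g (traceField g h) / volIntegral g (fun _ => 1)))
      (b := -(k / n) * (volIntegral g (traceField g h) / volIntegral g (fun _ => 1)))
      (hA.congr_deriv ?_) (hB.congr_deriv ?_) ?_ ?_
    · rw [h0, hA0]
      field_simp
    · rw [h0, hB0]
      field_simp
    · rw [h0, hB0]
      exact mul_ne_zero (mul_ne_zero (by exact_mod_cast (Nat.choose_pos hkn).ne')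
        (pow_ne_zero _ hs)) hV.ne'
    · push_cast
      field_simp
      ring

end Critical

end TotalSigma

end

theorem proposition3p1 (n k l : ℕ) (hn : 2 ≤ n) (hlk : l < k) (hkn : k ≤ n)
    (M : Type*) [TopologicalSpace M] [ChartedSpace (EuclideanSpace ℝ (Fin n)) M]
    [IsManifold (𝓡 n) ∞ M] [CompactSpace M] [T2Space M]
    (gbar : TotalSigma.RMetric n M) (lam : ℝ)
    (hE : TotalSigma.IsEinstein gbar.inner lam)
    (hlam : lam ≠ 0 ∨ 2 * l ≤ n) :
    (∀ (g : TotalSigma.RMetric n M) (c : ℝ), 0 < c →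
      TotalSigma.functionalF k l gbar.inner (c • g.inner)
        = TotalSigma.functionalF k l gbar.inner g.inner) ∧
    TotalSigma.IsCriticalPoint (TotalSigma.functionalF k l gbar.inner) gbar := by
  have hg := TotalSigma.isSmoothMetric_of_rMetric gbar
  exact ⟨fun g c hc => TotalSigma.functionalF_const_smul _
      (TotalSigma.isSmoothMetric_of_rMetric g) hc (hlk.le.trans hkn) hkn,
    fun h => ⟨hg.eventually_isPositive h.isSmoothSym,
      hE.hasDerivAt_functionalF hg h.isSmoothSym hn hlk hkn hlam⟩⟩
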